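/- Let $E$ be a site. A \emph{sheaf of crossed groups} $\Phi=(A,\rho,\Pi)$ on $E$ (written $(A,\Pi)$) consists of sheaves of groups $A,\Pi$, a morphism $\rho\colon A\to\Pi$ and a left action of $\Pi$ on $A$ by automorphisms with $\rho(g\cdot a)=g\rho(a)g^{-1}$ and $\rho(a)\cdot b=aba^{-1}$; a morphism $(f,\varphi)\colon(A,\Pi)\to(A',\Pi')$ is a pair of morphisms of sheaves of groups with $\varphi\rho=\rho' f$ and $f(g\cdot a)=\varphi(g)\cdot f(a)$. A sequence $$e\to\Phi=(A,\Pi)\xrightarrow{(f,\varphi)}\Phi'=(A',\Pi')\xrightarrow{(h,\psi)}\Phi''=(A'',\Pi'')\to e$$ is \emph{short exact} if $1\to A\xrightarrow{f} A'\xrightarrow{h} A''\to1$ is a short exact sequence of sheaves of groups, $\varphi$ is an isomorphism and $\psi$ is an epimorphism. (One usually identifies $\Pi'$ with $\Pi$ by means of $\varphi$, so that $\varphi=1_\Pi$.) A \emph{gerbe} on $E$ is a stack in groupoids over $E$ which locally has objects and any two of whose objects over the same object of $E$ are locally isomorphic; a morphism of gerbes is a cartesian $E$-functor, and a section of a gerbe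 $H$ is a cartesian $E$-functor $E\to H$. Write $\mathrm{TORSC}(E;\Pi)$ for the gerbe of $\Pi$-torsors (its fiber over $S$ consists of the $\Pi$-torsors on $E/S$). For a $\Pi$-torsor $P$ and a left $\Pi$-object $Q$, $P\wedge^{\Pi}Q$ is the quotient of $P\times Q$ by the action $(p,q)g=(pg,g^{-1}q)$, and for $\varphi\colon\Pi\to\Pi'$ the morphism $\mathrm{TORSC}(E;\varphi)$ is $P\mapsto P\wedge^{\Pi}\Pi'$. An \emph{$(A,\Pi)$-gerbe} is a triple $(G,\mu,j)$ with $G$ a gerbe, $\mu\colon G\to\mathrm{TORSC}(E;\Pi)$ a morphism of gerbes and $j$ a family of isomorphisms of sheaves of groups $j_x\colon\underline{\mathrm{Aut}}_S(x)\to\mu(x)\wedge^{\Pi}A$, natural in $x\in G_S$ and compatible with localization, such that $\mu(j_x^{-1}(a_x))(\alpha)=\alpha\cdot\rho(a)$ for every section $a_x$ of $\mu(x)\wedge^{\Pi}A$ over $S$ and every local representative $(\alpha,a)$ of $a_x$. An \emph{$(f,\varphi)$-morphism} $\lambda\colon(G,\mu,j)\to(G',\mu',j')$, for $(f,\varphi)\colon(A,\Pi)\to(A',\Pi')$,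 is a morphism of gerbes $\lambda\colon G\to G'$ for which there is an isomorphism $i\colon\mathrm{TORSC}(E;\varphi)\circ\mu\to\mu'\circ\lambda$ such that, for every object $x$ of $G$, $j'_{\lambda(x)}\circ\mathrm{Aut}(\lambda)_x=\omega_x\circ j_x$, where $\omega_x\colon\mu(x)\wedge^{\Pi}A\to\mu'(\lambda(x))\wedge^{\Pi'}A'$ is given by $[(p,a)]\mapsto[(i_x([(p,1)]),f(a))]$. Given a morphism of gerbes $\gamma\colon F\to H$ and a section $s$ of $H$, let $K(s)$ be the category over $E$ whose objects over $S$ are the pairs $(z,\alpha)$ with $z$ an object of $F_S$ and $\alpha\colon\gamma(z)\to s(S)$ an isomorphism over $\mathrm{id}_S$, and whose morphisms $(z',\alpha')\to(z,\alpha)$ over $t\colon T\to S$ are the morphisms $m\colon z'\to z$ of $F$ over $t$ with $s(t)\circ\alpha'=\alpha\circ\gamma(m)$; let $k(s)\colon K(s)\to F$ be the functor $(z,\alpha)\mapsto z$. Finally, $H^2(E;\Phi)$ is the set of classes of $(A,\Pi)$-gerbes, two $(A,\Pi)$-gerbes being equivalent if there is an $\mathrm{id}_{(A,\Pi)}$-morphism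 between them. A class is \emph{neutral} if it is the class of an $(A,\Pi)$-gerbe which has a section. For $(f,\varphi)\colon\Phi\to\Phi'$ we write $y=(f,\varphi)^{(2)}(x)$ if there is an $(f,\varphi)$-morphism from an $(A,\Pi)$-gerbe of class $x\in H^2(E;\Phi)$ to an $(A',\Pi')$-gerbe of class $y\in H^2(E;\Phi')$. \textbf{Theorem.} Let a short exact sequence of sheaves of crossed groups as above be given. \begin{enumerate} \item Let $\gamma\colon(F,\nu,k)\to(H,\omega,l)$ be an $(h,\psi)$-morphism from an $(A',\Pi')$-gerbe to an $(A'',\Pi'')$-gerbe and let $s$ be a section of $H$. Then $K(s)$ is a gerbe, and it has a structure of $(A,\Pi)$-gerbe such that $k(s)\colon K(s)\to F$ is an $(f,\varphi)$-morphism (an $(f,1_\Pi)$-morphism when $\Pi'=\Pi$ and $\varphi=1_\Pi$). \item Exactness at $H^2(E;\Phi')$: let $x\in H^2(E;\Phi')$ and $y\in H^2(E;\Phi'')$ with $y=(h,\psi)^{(2)}(x)$. Then $y$ is neutral if and only if there is a $z\in H^2(E;\Phi)$ with $x=(f,\varphi)^{(2)}(z)$. \end{enumerate} -/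

import Mathlib

open CategoryTheory Opposite
open scoped CategoryTheory.BasedFunctor

universe w v₁ u₁ v₂ u₂ v₃ u₃ v u

namespace CrossedGerbes

/-! ### Sheaves of groups and sheaves of crossed groups on a site -/

section Crossed

variable {E : Type u} [Category.{v} E] {J : GrothendieckTopology E}

/-- The group of sections of a sheaf of groups over an object. -/
abbrev Sec (G : Sheaf J GrpCat.{w}) (U : E) : Type w := G.obj.obj (op U)

/-- Restriction of sections of a sheaf of groups. -/
def res (G : Sheaf J GrpCat.{w}) {V U : E} (k : V ⟶ U) : Sec G U →* Sec G V :=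
  (G.obj.map k.op).hom

/-- The action of a morphism of sheaves of groups on sections. -/
def app {G H : Sheaf J GrpCat.{w}} (f : G ⟶ H) (U : E) : Sec G U →* Sec H U :=
  (f.hom.app (op U)).hom

lemma res_id (G : Sheaf J GrpCat.{w}) {U : E} (g : Sec G U) : res G (𝟙 U) g = g := by
  simp [res]

lemma res_comp (G : Sheaf J GrpCat.{w}) {W V U : E} (l : W ⟶ V) (k : V ⟶ U) (g : Sec G U) :
    res G (l ≫ k) g = res G l (res G k g) := by
  simp [res]

lemma app_res {G H : Sheaf J GrpCat.{w}} (f : G ⟶ H) {V U : E} (k : V ⟶ U) (g : Sec G U) :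
    app f V (res G k g) = res H k (app f U g) := by
  have := f.hom.naturality k.op
  exact congrArg (fun m => m.hom g) this

/-- A sheaf of crossed groups `(A, ρ, Π, ·)` on a site: sheaves of groups `A` and `Π`, a morphism
`ρ : A ⟶ Π` and a left action of `Π` on `A` by group automorphisms such that over each object one
has a crossed group (crossed module). -/
structure CrossedSheaf (J : GrothendieckTopology E) where
  A : Sheaf J GrpCat.{w}
  Pi : Sheaf J GrpCat.{w}
  ρ : A ⟶ Pi
  smul : ∀ U : E, Sec Pi U →* MulAut (Sec A U)
  smul_res : ∀ {V U : E} (k : V ⟶ U) (g : Sec Pi U) (a : Sec A U),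
    res A k (smul U g a) = smul V (res Pi k g) (res A k a)
  ρ_smul : ∀ {U : E} (g : Sec Pi U) (a : Sec A U),
    app ρ U (smul U g a) = g * app ρ U a * g⁻¹
  smul_ρ : ∀ {U : E} (a b : Sec A U), smul U (app ρ U a) b = a * b * a⁻¹

/-- A morphism `(f, φ)` of sheaves of crossed groups. -/
structure CrossedHom (Φ Ψ : CrossedSheaf.{w} J) where
  f : Φ.A ⟶ Ψ.A
  φ : Φ.Pi ⟶ Ψ.Pi
  comm : ∀ {U : E} (a : Sec Φ.A U), app φ U (app Φ.ρ U a) = app Ψ.ρ U (app f U a)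
  map_smul : ∀ {U : E} (g : Sec Φ.Pi U) (a : Sec Φ.A U),
    app f U (Φ.smul U g a) = Ψ.smul U (app φ U g) (app f U a)

/-- The identity morphism of a sheaf of crossed groups. -/
def CrossedHom.id (Φ : CrossedSheaf.{w} J) : CrossedHom Φ Φ where
  f := 𝟙 _
  φ := 𝟙 _
  comm _ := rfl
  map_smul _ _ := rfl

/-- `e ⟶ Φ ⟶ Φ' ⟶ Φ'' ⟶ e` is short exact: `1 ⟶ A ⟶ A' ⟶ A'' ⟶ 1` is a short exact sequence
of sheaves of groups, `Π ⟶ Π'` is an isomorphism and `Π' ⟶ Π''` is an epimorphism. -/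
structure IsShortExact {Φ Φ' Φ'' : CrossedSheaf.{w} J}
    (θ : CrossedHom Φ Φ') (η : CrossedHom Φ' Φ'') : Prop where
  f_injective : ∀ U : E, Function.Injective (app θ.f U)
  exact : ∀ (U : E) (a' : Sec Φ'.A U), app η.f U a' = 1 ↔ ∃ a, app θ.f U a = a'
  h_epi : Presheaf.IsLocallySurjective J η.f.hom
  φ_iso : IsIso θ.φ
  ψ_epi : Presheaf.IsLocallySurjective J η.φ.hom

end Crossed

/-! ### Torsors and contracted products -/

section Torsors

variable {E : Type u} [Category.{v} E] {J : GrothendieckTopology E}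

/-- A torsor over `S` under the sheaf of groups `G` on `E`: a sheaf of sets on `E/S` with a right
action of the restriction of `G` to `E/S` which is free and transitive, and which locally has a
section. The sections are allowed to lie in a universe containing `E`, so that contracted products
can be formed over an arbitrary site; by simple transitivity all nonempty sets of sections are in
bijection with the groups of sections of `G`. -/
structure Torsor (G : Sheaf J GrpCat.{w}) (S : E) where
  carrier : (Over S)ᵒᵖ ⥤ Type (max u v w)
  isSheaf : Presieve.IsSheaf (J.over S) carrier
  act : ∀ {V : Over S}, carrier.obj (op V) → Sec G V.left → carrier.obj (op V)
  act_one : ∀ {V : Over S} (p : carrier.obj (op V)), act p 1 = p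
  act_mul : ∀ {V : Over S} (p : carrier.obj (op V)) (g h : Sec G V.left),
    act p (g * h) = act (act p g) h
  act_res : ∀ {V W : Over S} (k : W ⟶ V) (p : carrier.obj (op V)) (g : Sec G V.left),
    carrier.map k.op (act p g) = act (carrier.map k.op p) (res G k.left g)
  simply_transitive : ∀ {V : Over S} (p q : carrier.obj (op V)), ∃! g : Sec G V.left, act p g = q
  locally_nonempty : ∀ V : Over S, ∃ R ∈ (J.over S) V, ∀ ⦃W : Over S⦄ (k : W ⟶ V), R k →
    Nonempty (carrier.obj (op W))

namespace Torsor

variable {G : Sheaf J GrpCat.{w}} {S : E} (P : Torsor G S)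

/-- The element `g` with `p · g = q`. -/
noncomputable def diff {V : Over S} (p q : P.carrier.obj (op V)) : Sec G V.left :=
  (P.simply_transitive p q).choose

lemma act_diff {V : Over S} (p q : P.carrier.obj (op V)) : P.act p (P.diff p q) = q :=
  (P.simply_transitive p q).choose_spec.1

lemma eq_diff {V : Over S} {p q : P.carrier.obj (op V)} {g : Sec G V.left} (h : P.act p g = q) :
    P.diff p q = g :=
  ((P.simply_transitive p q).choose_spec.2 g h).symm

lemma act_injective {V : Over S} (p : P.carrier.obj (op V)) {g h : Sec G V.left}
    (e : P.act p g = P.act p h) : g = h :=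
  (P.eq_diff e).symm.trans (P.eq_diff rfl)

lemma res_diff {V W : Over S} (k : W ⟶ V) (p q : P.carrier.obj (op V)) :
    P.diff (P.carrier.map k.op p) (P.carrier.map k.op q) = res G k.left (P.diff p q) := by
  apply P.eq_diff
  rw [← P.act_res, P.act_diff]

end Torsor

/-- A sheaf of sets on `E` with a left action of the sheaf of groups `G`. -/
structure LeftObj (G : Sheaf J GrpCat.{w}) where
  carrier : Eᵒᵖ ⥤ Type w
  isSheaf : Presieve.IsSheaf J carrier
  smul : ∀ {U : E}, Sec G U → carrier.obj (op U) → carrier.obj (op U)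
  one_smul : ∀ {U : E} (q : carrier.obj (op U)), smul 1 q = q
  mul_smul : ∀ {U : E} (g h : Sec G U) (q : carrier.obj (op U)),
    smul (g * h) q = smul g (smul h q)
  smul_res : ∀ {V U : E} (k : V ⟶ U) (g : Sec G U) (q : carrier.obj (op U)),
    carrier.map k.op (smul g q) = smul (res G k g) (carrier.map k.op q)

lemma isSheaf_forget (G : Sheaf J GrpCat.{w}) :
    Presieve.IsSheaf J (G.obj ⋙ forget GrpCat.{w}) := by
  exact Presieve.isSheaf_iso J (Functor.isoWhiskerLeft G.obj GrpCat.coyonedaObjIsoForget)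
    (G.property _)

/-- The sheaf `A` with the left action of `Π`, for a sheaf of crossed groups `(A, Π)`. -/
def CrossedSheaf.leftObj (Φ : CrossedSheaf.{w} J) : LeftObj Φ.Pi where
  carrier := Φ.A.obj ⋙ forget GrpCat.{w}
  isSheaf := isSheaf_forget Φ.A
  smul {U} g a := Φ.smul U g (a : Sec Φ.A U)
  one_smul {U} a := by
    change Φ.smul U 1 (a : Sec Φ.A U) = a
    rw [map_one]; rfl
  mul_smul {U} g h a := by
    change Φ.smul U (g * h) (a : Sec Φ.A U) = _
    rw [map_mul]; rfl
  smul_res k g a := Φ.smul_res k g a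

/-- The sheaf underlying `H`, with the left action of `G` by left translations via `φ : G ⟶ H`. -/
def translationObj {G H : Sheaf J GrpCat.{w}} (φ : G ⟶ H) : LeftObj G where
  carrier := H.obj ⋙ forget GrpCat.{w}
  isSheaf := isSheaf_forget H
  smul {U} g a := (app φ U g * (a : Sec H U) : Sec H U)
  one_smul {U} a := by
    change (app φ U 1 * (a : Sec H U) : Sec H U) = a
    rw [map_one, one_mul]
  mul_smul {U} g h a := by
    change (app φ U (g * h) * (a : Sec H U) : Sec H U) = app φ U g * (app φ U h * (a : Sec H U))
    rw [map_mul, mul_assoc]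
  smul_res {V U} k g a := by
    change res H k (app φ U g * (a : Sec H U)) = app φ V (res G k g) * res H k (a : Sec H U)
    rw [map_mul, app_res]

lemma LeftObj.isSheaf_over {G : Sheaf J GrpCat.{w}} (Q : LeftObj G) (S : E) :
    Presieve.IsSheaf (J.over S) ((Over.forget S).op ⋙ Q.carrier) := by
  rw [← isSheaf_iff_isSheaf_of_type]
  exact ((J.overPullback (Type w) S).obj
    ⟨Q.carrier, (isSheaf_iff_isSheaf_of_type J Q.carrier).2 Q.isSheaf⟩).property

/-- The sections over `U` of the contracted product of the `G`-torsor `P` over `S` with the left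
`G`-object `Q`, i.e. of the quotient of `P × Q` by the diagonal action
`(p, q) · g = (p · g, g⁻¹ · q)`. Locally on `U` such a section `x` is the class of pairs `(p, q)`;
since `P` is a torsor, `q` is determined by `x` and `p`, so `x` is recorded as the equivariant map
`p ↦ q`. See `class_eq_class_iff`, `exists_local_representative` and `contractedProduct_isSheaf`,
which say that this is the quotient sheaf. -/
structure ContractedSection {G : Sheaf J GrpCat.{w}} {S : E} (P : Torsor G S) (Q : LeftObj G)
    (U : Over S) where
  toFun : ∀ V : Over S, (V ⟶ U) → P.carrier.obj (op V) → Q.carrier.obj (op V.left)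
  map_res : ∀ {V W : Over S} (l : W ⟶ V) (k : V ⟶ U) (p : P.carrier.obj (op V)),
    toFun W (l ≫ k) (P.carrier.map l.op p) = Q.carrier.map l.left.op (toFun V k p)
  map_act : ∀ {V : Over S} (k : V ⟶ U) (p : P.carrier.obj (op V)) (g : Sec G V.left),
    toFun V k (P.act p g) = Q.smul g⁻¹ (toFun V k p)

section Contracted

variable {G : Sheaf J GrpCat.{w}} {S : E} (P : Torsor G S) (Q : LeftObj G)

variable {P Q} in
@[ext]
lemma ContractedSection.ext_toFun {U : Over S} {x y : ContractedSection P Q U}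
    (h : ∀ (V : Over S) (k : V ⟶ U) (p : P.carrier.obj (op V)), x.toFun V k p = y.toFun V k p) :
    x = y := by
  cases x; cases y; congr; funext V k p; exact h V k p

/-- The contracted product of a `G`-torsor `P` over `S` and a left `G`-object `Q`, as a presheaf on
`E/S`. -/
def contractedProduct : (Over S)ᵒᵖ ⥤ Type (max u v w) where
  obj U := ContractedSection P Q U.unop
  map k := TypeCat.ofHom fun x =>
    { toFun := fun V l p => x.toFun V (l ≫ k.unop) p
      map_res := fun l m p => by rw [← x.map_res, Category.assoc]
      map_act := fun l p g => x.map_act _ p g }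
  map_id U := by
    ext x V l p
    exact congrArg (fun m => x.toFun V m p) (Category.comp_id l)
  map_comp k l := by
    ext x V m p
    exact congrArg (fun m => x.toFun V m p) (Category.assoc m l.unop k.unop).symm

/-- The class of a pair `(p, q)` in the contracted product. -/
noncomputable def contractedClass {U : Over S} (p : P.carrier.obj (op U))
    (q : Q.carrier.obj (op U.left)) : ContractedSection P Q U where
  toFun V k p' := Q.smul (P.diff p' (P.carrier.map k.op p)) (Q.carrier.map k.left.op q)
  map_res l k p' := by
    rw [op_comp, Functor.map_comp_apply, P.res_diff, Q.smul_res, Over.comp_left, op_comp,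
      Functor.map_comp_apply]
  map_act k p' g := by
    rw [← Q.mul_smul]
    congr 1
    apply P.eq_diff
    rw [← P.act_mul, mul_inv_cancel_left, P.act_diff]

variable {P Q}

lemma ContractedSection.map_res' {U : Over S} (x : ContractedSection P Q U) {V W : Over S}
    (l : W ⟶ V) (k : V ⟶ U) (m : W ⟶ U) (h : l ≫ k = m) (p : P.carrier.obj (op V)) :
    x.toFun W m (P.carrier.map l.op p) = Q.carrier.map l.left.op (x.toFun V k p) := by
  subst h; exact x.map_res l k p

/-- The value of a section of the contracted product on a section of `P` over an arbitrary `V`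
can be computed from its value on one section of `P` over `U`. -/
lemma ContractedSection.toFun_eq {U : Over S} (x : ContractedSection P Q U) {V : Over S}
    (k : V ⟶ U) (p : P.carrier.obj (op U)) (p' : P.carrier.obj (op V)) :
    x.toFun V k p' = Q.smul (P.diff p' (P.carrier.map k.op p))
      (Q.carrier.map k.left.op (x.toFun U (𝟙 U) p)) := by
  rw [← x.map_res' k (𝟙 U) k (Category.comp_id k) p]
  conv_rhs => rw [← P.act_diff p' (P.carrier.map k.op p)]
  rw [x.map_act, P.act_diff, ← Q.mul_smul, mul_inv_cancel, Q.one_smul]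

lemma contractedClass_self {U : Over S} (p : P.carrier.obj (op U))
    (q : Q.carrier.obj (op U.left)) : (contractedClass P Q p q).toFun U (𝟙 U) p = q := by
  change Q.smul (P.diff p (P.carrier.map (𝟙 (op U)) p)) (Q.carrier.map (𝟙 (op U.left)) q) = q
  rw [Functor.map_id_apply, Functor.map_id_apply, P.eq_diff (P.act_one p), Q.one_smul]

/-- `(p, q)` is a representative of `x` when `x` sends `p` to `q`. -/
theorem class_eq_iff {U : Over S} (p : P.carrier.obj (op U)) (q : Q.carrier.obj (op U.left))
    (x : ContractedSection P Q U) : contractedClass P Q p q = x ↔ x.toFun U (𝟙 U) p = q := by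
  constructor
  · rintro rfl
    exact contractedClass_self p q
  · rintro rfl
    ext V k p'
    exact (x.toFun_eq k p p').symm

/-- Two pairs have the same class if and only if they are in the same orbit of the diagonal
action. -/
theorem class_eq_class_iff {U : Over S} (p p' : P.carrier.obj (op U))
    (q q' : Q.carrier.obj (op U.left)) :
    contractedClass P Q p q = contractedClass P Q p' q' ↔
      ∃ g : Sec G U.left, P.act p g = p' ∧ Q.smul g⁻¹ q = q' := by
  rw [eq_comm, class_eq_iff]
  constructor
  · intro h
    refine ⟨P.diff p p', P.act_diff p p', ?_⟩
    rw [← h, ← P.act_diff p p', ContractedSection.map_act, P.act_diff, contractedClass_self]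
  · rintro ⟨g, rfl, rfl⟩
    rw [ContractedSection.map_act, contractedClass_self]

/-- Every section of the contracted product is locally the class of a pair. -/
theorem exists_local_representative {U : Over S} (x : ContractedSection P Q U) :
    ∃ R ∈ (J.over S) U, ∀ ⦃W : Over S⦄ (k : W ⟶ U), R k →
      ∃ p q, contractedClass P Q p q = (contractedProduct P Q).map k.op x := by
  obtain ⟨R, hR, h⟩ := P.locally_nonempty U
  refine ⟨R, hR, fun W k hk => ?_⟩
  obtain ⟨p⟩ := h k hk
  exact ⟨p, _, (class_eq_iff p _ _).2 rfl⟩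

lemma ContractedSection.existsUnique_glue {U : Over S} (R : Sieve U) (hR : R ∈ (J.over S) U)
    (X : ∀ (W : Over S) (k : W ⟶ U), R k → ContractedSection P Q W)
    (hX : ∀ (W : Over S) (k : W ⟶ U) (h : R k) (Z : Over S) (m : Z ⟶ W) (h' : R (m ≫ k))
      (V : Over S) (l : V ⟶ Z) (p : P.carrier.obj (op V)),
      (X Z (m ≫ k) h').toFun V l p = (X W k h).toFun V (l ≫ m) p) :
    ∃! T : ContractedSection P Q U, ∀ (W : Over S) (k : W ⟶ U) (h : R k) (V : Over S)
      (l : V ⟶ W) (p : P.carrier.obj (op V)), T.toFun V (l ≫ k) p = (X W k h).toFun V l p := by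
  have hQ := Q.isSheaf_over S
  have key : ∀ (V : Over S) (k : V ⟶ U) (p : P.carrier.obj (op V)),
      ∃ t : Q.carrier.obj (op V.left), ∀ (W : Over S) (l : W ⟶ V) (h : R (l ≫ k)),
        Q.carrier.map l.left.op t = (X W (l ≫ k) h).toFun W (𝟙 W) (P.carrier.map l.op p) := by
    intro V k p
    let y : Presieve.FamilyOfElements ((Over.forget S).op ⋙ Q.carrier)
        ((R.pullback k : Sieve V) : Presieve V) := fun W l h =>
      (X W (l ≫ k) h).toFun W (𝟙 W) (P.carrier.map l.op p)
    have hy : y.Compatible := by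
      rw [Presieve.compatible_iff_sieveCompatible]
      intro W Z l m h
      have h' : R (m ≫ l ≫ k) := R.downward_closed h m
      have e : (X Z ((m ≫ l) ≫ k) (by simpa using h')).toFun Z (𝟙 Z) (P.carrier.map (m ≫ l).op p) =
          Q.carrier.map m.left.op ((X W (l ≫ k) h).toFun W (𝟙 W) (P.carrier.map l.op p)) := by
        rw [← ContractedSection.map_res' _ m (𝟙 W) (𝟙 Z ≫ m) (by simp), op_comp,
          Functor.map_comp_apply, ← hX W (l ≫ k) h Z m h']
        simp only [Category.assoc]
      exact e
    obtain ⟨t, ht, -⟩ := hQ _ ((J.over S).pullback_stable k hR) y hy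
    exact ⟨t, fun W l h => ht l h⟩
  choose t ht using key
  have sep : ∀ (V : Over S) (k : V ⟶ U) (a b : Q.carrier.obj (op V.left)),
      (∀ (W : Over S) (l : W ⟶ V), R (l ≫ k) →
        Q.carrier.map l.left.op a = Q.carrier.map l.left.op b) → a = b := fun V k a b h =>
    (hQ _ ((J.over S).pullback_stable k hR)).isSeparatedFor.ext fun W l hl => h W l hl
  refine ⟨⟨t, ?_, ?_⟩, ?_, ?_⟩
  · intro V W l k p
    refine sep W (l ≫ k) _ _ fun Z m hm => ?_
    rw [ht _ _ _ _ _ hm, ← Functor.map_comp_apply, ← Functor.map_comp_apply, ← op_comp,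
      ← op_comp, ← Over.comp_left]
    have hm' : R ((m ≫ l) ≫ k) := by rwa [Category.assoc]
    rw [ht V k p Z (m ≫ l) hm']
    simp only [Category.assoc]
  · intro V k p g
    refine sep V k _ _ fun Z m hm => ?_
    rw [ht _ _ _ _ _ hm, P.act_res, ContractedSection.map_act, Q.smul_res, ht _ _ _ _ _ hm,
      map_inv]
  · intro V k hk W l p
    refine sep W (l ≫ k) _ _ fun Z m hm => ?_
    have hm' : R ((m ≫ l) ≫ k) := by rwa [Category.assoc]
    change Q.carrier.map m.left.op (t W (l ≫ k) p) = _
    rw [ht _ _ _ _ _ hm, ← ContractedSection.map_res' _ m l (𝟙 Z ≫ m ≫ l) (by simp),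
      ← hX V k hk Z (m ≫ l) hm']
    simp only [Category.assoc]
  · intro T' hT'
    ext V k p
    refine sep V k _ _ fun Z m hm => ?_
    change _ = Q.carrier.map m.left.op (t V k p)
    rw [ht _ _ _ _ _ hm, ← hT' Z (m ≫ k) hm,
      ← ContractedSection.map_res' _ m k (𝟙 Z ≫ m ≫ k) (by simp)]

variable (P Q) in
/-- The contracted product is a sheaf on `E/S`. -/
theorem contractedProduct_isSheaf :
    Presieve.IsSheaf (J.over S) (contractedProduct P Q) := by
  intro U R hR x hx
  obtain ⟨T, hT, hT'⟩ := ContractedSection.existsUnique_glue (P := P) (Q := Q) R hR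
    (fun W k h => x k h) (fun W k h Z m h' V l p =>
      congrArg (fun z : ContractedSection P Q Z => z.toFun V l p) (hx.to_sieveCompatible k m h))
  refine ⟨T, fun W k h => ?_, fun T' h => hT' T' fun W k hk V l p => ?_⟩
  · exact ContractedSection.ext_toFun (P := P) (Q := Q) fun V l p => hT W k h V l p
  · exact congrArg (fun z : ContractedSection P Q W => z.toFun V l p) (h k hk)

end Contracted

/-- The value `a` with `x = [(p, a)]`, for a section `x` of `P ∧ A`. -/
abbrev ContractedSection.aval {Φ : CrossedSheaf.{w} J} {S : E} {P : Torsor Φ.Pi S} {U : Over S}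
    (x : ContractedSection P Φ.leftObj U) (V : Over S) (k : V ⟶ U) (p : P.carrier.obj (op V)) :
    Sec Φ.A V.left := x.toFun V k p

lemma ContractedSection.aval_res {Φ : CrossedSheaf.{w} J} {S : E} {P : Torsor Φ.Pi S} {U : Over S}
    (x : ContractedSection P Φ.leftObj U) {V W : Over S} (l : W ⟶ V) (k : V ⟶ U)
    (p : P.carrier.obj (op V)) :
    x.aval W (l ≫ k) (P.carrier.map l.op p) = res Φ.A l.left (x.aval V k p) := x.map_res l k p

lemma ContractedSection.aval_act {Φ : CrossedSheaf.{w} J} {S : E} {P : Torsor Φ.Pi S} {U : Over S}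
    (x : ContractedSection P Φ.leftObj U) {V : Over S} (k : V ⟶ U)
    (p : P.carrier.obj (op V)) (g : Sec Φ.Pi V.left) :
    x.aval V k (P.act p g) = Φ.smul V.left g⁻¹ (x.aval V k p) := x.map_act k p g

/-- The group structure on the sections of `P ∧ A` for a sheaf of crossed groups `(A, Π)` and a
`Π`-torsor `P`: the product of the classes of `(p, a)` and `(p, b)` is the class of `(p, ab)`. -/
instance contractedGroup {Φ : CrossedSheaf.{w} J} {S : E} (P : Torsor Φ.Pi S) (U : Over S) :
    Group (ContractedSection P Φ.leftObj U) where
  mul x y :=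
    { toFun := fun V k p => (x.aval V k p * y.aval V k p :)
      map_res := fun {V W} l k p => by
        rw [x.aval_res, y.aval_res]
        exact (map_mul (res Φ.A l.left) _ _).symm
      map_act := fun {V} k p g => by
        rw [x.aval_act, y.aval_act]
        exact (map_mul (Φ.smul V.left g⁻¹) _ _).symm }
  one :=
    { toFun := fun V k p => (1 : Sec Φ.A V.left)
      map_res := fun {V W} l k p => (map_one (res Φ.A l.left)).symm
      map_act := fun {V} k p g => (map_one (Φ.smul V.left g⁻¹)).symm }
  inv x :=
    { toFun := fun V k p => ((x.aval V k p)⁻¹ :)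
      map_res := fun {V W} l k p => by
        rw [x.aval_res]
        exact (map_inv (res Φ.A l.left) _).symm
      map_act := fun {V} k p g => by
        rw [x.aval_act]
        exact (map_inv (Φ.smul V.left g⁻¹) _).symm }
  mul_assoc x y z := ContractedSection.ext_toFun fun V k p =>
    mul_assoc (x.aval V k p) (y.aval V k p) (z.aval V k p)
  one_mul x := ContractedSection.ext_toFun fun V k p => one_mul (x.aval V k p)
  mul_one x := ContractedSection.ext_toFun fun V k p => mul_one (x.aval V k p)
  inv_mul_cancel x := ContractedSection.ext_toFun fun V k p => inv_mul_cancel (x.aval V k p)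

section Extension

variable {G H : Sheaf J GrpCat.{w}} (φ : G ⟶ H) {S : E} (P : Torsor G S)

variable {φ P} in
/-- The value `h` with `x = [(p, h)]`, for a section `x` of `P ∧ H`. -/
abbrev ContractedSection.tval {U : Over S} (x : ContractedSection P (translationObj φ) U)
    (V : Over S) (k : V ⟶ U) (p : P.carrier.obj (op V)) : Sec H V.left := x.toFun V k p

variable {φ P} in
lemma ContractedSection.tval_res {U : Over S} (x : ContractedSection P (translationObj φ) U)
    {V W : Over S} (l : W ⟶ V) (k : V ⟶ U) (p : P.carrier.obj (op V)) :
    x.tval W (l ≫ k) (P.carrier.map l.op p) = res H l.left (x.tval V k p) := x.map_res l k p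

variable {φ P} in
lemma ContractedSection.tval_act {U : Over S} (x : ContractedSection P (translationObj φ) U)
    {V : Over S} (k : V ⟶ U) (p : P.carrier.obj (op V)) (g : Sec G V.left) :
    x.tval V k (P.act p g) = app φ V.left g⁻¹ * x.tval V k p := x.map_act k p g

/-- The right action of `H` on `P ∧ H`: `[(p, a)] · h = [(p, ah)]`. -/
def extensionAct {U : Over S} (x : ContractedSection P (translationObj φ) U)
    (h : Sec H U.left) : ContractedSection P (translationObj φ) U where
  toFun V k p := (x.tval V k p * res H k.left h :)
  map_res {V W} l k p := by
    rw [x.tval_res, Over.comp_left, res_comp]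
    exact (map_mul (res H l.left) _ _).symm
  map_act {V} k p g := by
    rw [x.tval_act]
    exact mul_assoc (app φ V.left g⁻¹) (x.tval V k p) (res H k.left h)

/-- The sieve of those arrows over whose source the torsor has a section. -/
def Torsor.sectionSieve (U : Over S) : Sieve U where
  arrows V _ := Nonempty (P.carrier.obj (op V))
  downward_closed := fun ⟨p⟩ k => ⟨P.carrier.map k.op p⟩

lemma Torsor.sectionSieve_mem (U : Over S) : P.sectionSieve U ∈ (J.over S) U := by
  obtain ⟨R, hR, h⟩ := P.locally_nonempty U
  exact (J.over S).superset_covering (fun V k hk => h k hk) hR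

lemma extensionAct_simply_transitive {U : Over S}
    (x y : ContractedSection P (translationObj φ) U) :
    ∃! h : Sec H U.left, extensionAct φ P x h = y := by
  have hH := (translationObj φ).isSheaf_over S
  let d (V : Over S) (k : V ⟶ U) (p : P.carrier.obj (op V)) : Sec H V.left :=
    (x.tval V k p)⁻¹ * y.tval V k p
  have d_indep : ∀ V k p p', d V k p = d V k p' := by
    intro V k p p'
    obtain ⟨g, rfl, -⟩ := P.simply_transitive p p'
    change _ = (x.tval V k (P.act p g))⁻¹ * y.tval V k (P.act p g)
    rw [x.tval_act, y.tval_act, mul_inv_rev, mul_assoc, inv_mul_cancel_left]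
  have d_res : ∀ (V W : Over S) (l : W ⟶ V) (k : V ⟶ U) (p : P.carrier.obj (op V)),
      d W (l ≫ k) (P.carrier.map l.op p) = res H l.left (d V k p) := by
    intro V W l k p
    change (x.tval W (l ≫ k) _)⁻¹ * y.tval W (l ≫ k) _ = _
    rw [x.tval_res, y.tval_res, ← map_inv, ← map_mul]
  let z : Presieve.FamilyOfElements ((Over.forget S).op ⋙ (translationObj φ).carrier)
      (P.sectionSieve U : Presieve U) := fun V k hk => d V k hk.some
  have hz : z.Compatible := by
    rw [Presieve.compatible_iff_sieveCompatible]
    intro V W k l hk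
    exact (d_indep _ _ _ _).trans (d_res V W l k _)
  obtain ⟨h, hh, -⟩ := hH _ (P.sectionSieve_mem U) z hz
  refine ⟨h, ?_, ?_⟩
  · refine ContractedSection.ext_toFun fun V k p => ?_
    have e : res H k.left h = d V k p := (hh k ⟨p⟩).trans (d_indep _ _ _ _)
    change x.tval V k p * res H k.left h = _
    rw [e]
    exact mul_inv_cancel_left _ _
  · intro h' hh'
    refine (hH _ (P.sectionSieve_mem U)).isSeparatedFor.ext fun V k hk => ?_
    obtain ⟨p⟩ := hk
    have e : res H k.left h = d V k p := (hh k ⟨p⟩).trans (d_indep _ _ _ _)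
    refine Eq.trans ?_ e.symm
    change res H k.left h' = _
    refine eq_inv_mul_of_mul_eq ?_
    exact congrArg (fun t : ContractedSection P (translationObj φ) U => t.toFun V k p) hh'

/-- The `H`-torsor `P ∧ H` obtained from the `G`-torsor `P` by extension of the structural group
along `φ : G ⟶ H`. -/
def Torsor.extension : Torsor H S where
  carrier := contractedProduct P (translationObj φ)
  isSheaf := contractedProduct_isSheaf P (translationObj φ)
  act x h := extensionAct φ P x h
  act_one {U} x := ContractedSection.ext_toFun fun V k p => by
    change ContractedSection.tval x V k p * res H k.left 1 = _
    rw [map_one, mul_one]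
  act_mul {U} x g h := ContractedSection.ext_toFun fun V k p => by
    change ContractedSection.tval x V k p * res H k.left (g * h) = _
    rw [map_mul, ← mul_assoc]
    rfl
  act_res {U V} k x h := ContractedSection.ext_toFun fun W l p => by
    change ContractedSection.tval x W (l ≫ k) p * res H (l ≫ k).left h =
      ContractedSection.tval x W (l ≫ k) p * res H l.left (res H k.left h)
    rw [Over.comp_left, res_comp]
  simply_transitive x y := extensionAct_simply_transitive φ P x y
  locally_nonempty U := by
    obtain ⟨R, hR, h⟩ := P.locally_nonempty U
    exact ⟨R, hR, fun W k hk => ⟨contractedClass P (translationObj φ) (h k hk).some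
      (1 : Sec H W.left)⟩⟩

/-- The `φ`-morphism `P ⟶ P ∧ H`, `p ↦ [(p, 1)]`. -/
noncomputable def Torsor.toExtension {U : Over S} (p : P.carrier.obj (op U)) :
    (P.extension φ).carrier.obj (op U) :=
  contractedClass P (translationObj φ) p (1 : Sec H U.left)

end Extension

/-- An object of the stack of `G`-torsors on `E`: an object `S` of `E` and a torsor over `S`. -/
structure TorsObj (G : Sheaf J GrpCat.{w}) where
  base : E
  torsor : Torsor G base

variable {G H : Sheaf J GrpCat.{w}}

/-- A morphism of the stack of `G`-torsors from a torsor over `T` to a torsor over `S`: an arrow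
`f : T ⟶ S` and an equivariant morphism from the former to the restriction of the latter
along `f`. -/
structure TorsHom (X Y : TorsObj G) where
  base : X.base ⟶ Y.base
  map : ∀ V : Over X.base, X.torsor.carrier.obj (op V) →
    Y.torsor.carrier.obj (op ((Over.map base).obj V))
  map_res : ∀ {V W : Over X.base} (k : W ⟶ V) (p : X.torsor.carrier.obj (op V)),
    map W (X.torsor.carrier.map k.op p) =
      Y.torsor.carrier.map ((Over.map base).map k).op (map V p)
  map_act : ∀ {V : Over X.base} (p : X.torsor.carrier.obj (op V)) (g : Sec G V.left),
    map V (X.torsor.act p g) = Y.torsor.act (V := (Over.map base).obj V) (map V p) g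

/-- The arrow of `E/S` between two objects with the same source and equal structure arrows. -/
abbrev overEq {S U : E} {s t : U ⟶ S} (h : s = t) : Over.mk s ⟶ Over.mk t :=
  Over.homMk (𝟙 U) (by simp [h])

lemma Torsor.map_self {S : E} (P : Torsor G S) {U : Over S} (k : U ⟶ U) (h : k = 𝟙 U)
    (p : P.carrier.obj (op U)) : P.carrier.map k.op p = p := by
  subst h
  exact Functor.map_id_apply _ _ _

lemma Torsor.map_map {S : E} (P : Torsor G S) {U V W : Over S} (k : V ⟶ U) (l : W ⟶ V)
    (p : P.carrier.obj (op U)) :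
    P.carrier.map l.op (P.carrier.map k.op p) = P.carrier.map (l ≫ k).op p := by
  rw [op_comp, Functor.map_comp_apply]

lemma Torsor.map_congr {S : E} (P : Torsor G S) {U V : Over S} (k l : V ⟶ U)
    (h : k.left = l.left) (p : P.carrier.obj (op U)) :
    P.carrier.map k.op p = P.carrier.map l.op p := by
  rw [Over.OverMorphism.ext h]

lemma TorsHom.ext' {X Y : TorsObj G} {m n : TorsHom X Y} (hb : m.base = n.base)
    (h : ∀ (V : Over X.base) (p : X.torsor.carrier.obj (op V)),
      Y.torsor.carrier.map (overEq (by rw [hb]) : (Over.map n.base).obj V ⟶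
        (Over.map m.base).obj V).op (m.map V p) = n.map V p) : m = n := by
  obtain ⟨b, m, _, _⟩ := m
  obtain ⟨b', n, _, _⟩ := n
  obtain rfl : b = b' := hb
  congr
  funext V p
  exact (Y.torsor.map_self _ (by ext; rfl) _).symm.trans (h V p)

lemma Torsor.act_map_overEq {S : E} (P : Torsor G S) {U : E} {s t : U ⟶ S} (h : s = t)
    (p : P.carrier.obj (op (Over.mk t))) (g : Sec G U) :
    P.carrier.map (overEq h).op (P.act (V := Over.mk t) p g) =
      P.act (V := Over.mk s) (P.carrier.map (overEq h).op p) g := by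
  rw [P.act_res]
  exact congrArg _ (res_id G g)

lemma Torsor.map_comp_congr {S : E} (P : Torsor G S) {U V W W' : Over S} (k : V ⟶ U) (l : W ⟶ V)
    (k' : W' ⟶ U) (l' : W ⟶ W') (h : l ≫ k = l' ≫ k') (p : P.carrier.obj (op U)) :
    P.carrier.map l.op (P.carrier.map k.op p) = P.carrier.map l'.op (P.carrier.map k'.op p) := by
  rw [← Functor.map_comp_apply, ← Functor.map_comp_apply, ← op_comp, ← op_comp, h]

/-- The identity of a torsor. -/
@[simps]
def TorsHom.id (X : TorsObj G) : TorsHom X X where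
  base := 𝟙 X.base
  map V p := X.torsor.carrier.map (overEq (by simp) : (Over.map (𝟙 X.base)).obj V ⟶ V).op p
  map_res k p := X.torsor.map_comp_congr _ _ _ _ (by ext; simp) p
  map_act p g := X.torsor.act_map_overEq _ p g

/-- The composition of morphisms of torsors; the restrictions along `f ≫ g` and along `g` then `f`
are identified. -/
@[simps]
def TorsHom.comp {X Y Z : TorsObj G} (m : TorsHom X Y) (n : TorsHom Y Z) : TorsHom X Z where
  base := m.base ≫ n.base
  map V p := Z.torsor.carrier.map (overEq (by simp) : (Over.map (m.base ≫ n.base)).obj V ⟶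
    (Over.map n.base).obj ((Over.map m.base).obj V)).op (n.map _ (m.map V p))
  map_res k p := by
    rw [m.map_res, n.map_res]
    exact Z.torsor.map_comp_congr _ _ _ _ (by ext; simp) _
  map_act {V} p g := by
    rw [m.map_act]
    have := n.map_act (V := (Over.map m.base).obj V) (m.map V p) g
    rw [this]
    exact Z.torsor.act_map_overEq _ _ g

/-- The category of torsors under `G` over the objects of `E`. -/
instance : Category (TorsObj G) where
  Hom X Y := TorsHom X Y
  id X := TorsHom.id X
  comp m n := TorsHom.comp m n
  id_comp {X Y} m := by
    refine TorsHom.ext' (Category.id_comp m.base) fun V p => ?_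
    refine (congrArg _ (congrArg _ (m.map_res _ p))).trans ?_
    refine (congrArg _ (Torsor.map_map _ _ _ _)).trans ((Torsor.map_map _ _ _ _).trans ?_)
    refine Torsor.map_self _ _ (Over.OverMorphism.ext ?_) _
    change (𝟙 V.left ≫ 𝟙 V.left ≫ 𝟙 V.left) = 𝟙 V.left
    simp
  comp_id {X Y} m := by
    refine TorsHom.ext' (Category.comp_id m.base) fun V p => ?_
    refine (congrArg _ (Torsor.map_map _ _ _ _)).trans ((Torsor.map_map _ _ _ _).trans ?_)
    refine Torsor.map_self _ _ (Over.OverMorphism.ext ?_) _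
    change (𝟙 V.left ≫ 𝟙 V.left ≫ 𝟙 V.left) = 𝟙 V.left
    simp
  assoc {X Y Z T} m n l := by
    refine TorsHom.ext' (Category.assoc m.base n.base l.base) fun V p => ?_
    refine (congrArg _ (congrArg _ (l.map_res _ _))).trans ?_
    refine (congrArg _ (Torsor.map_map _ _ _ _)).trans ((Torsor.map_map _ _ _ _).trans ?_)
    refine Eq.trans ?_ (Torsor.map_map _ _ _ _).symm
    refine Torsor.map_congr _ _ _ ?_ _
    change (𝟙 V.left ≫ 𝟙 V.left ≫ 𝟙 V.left) = 𝟙 V.left ≫ 𝟙 V.left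
    simp

lemma TorsHom.map_injective {X Y : TorsObj G} (m : TorsHom X Y) (V : Over X.base) :
    Function.Injective (m.map V) := by
  intro p p' h
  obtain ⟨g, rfl, -⟩ := X.torsor.simply_transitive p p'
  have e : g = 1 := by
    refine Y.torsor.act_injective (V := (Over.map m.base).obj V) (m.map V p) ?_
    rw [Y.torsor.act_one]
    exact (m.map_act p g).symm.trans h.symm
  rw [e, X.torsor.act_one]

lemma TorsHom.nonempty_of_target {X Y : TorsObj G} (m : TorsHom X Y) (V : Over X.base)
    (q : Y.torsor.carrier.obj (op ((Over.map m.base).obj V))) :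
    Nonempty (X.torsor.carrier.obj (op V)) := by
  have key : ∀ (W : Over X.base) (k : W ⟶ V), Nonempty (X.torsor.carrier.obj (op W)) →
      ∃ p, m.map W p = Y.torsor.carrier.map ((Over.map m.base).map k).op q := by
    rintro W k ⟨p⟩
    obtain ⟨g, hg, -⟩ := Y.torsor.simply_transitive (m.map W p)
      (Y.torsor.carrier.map ((Over.map m.base).map k).op q)
    exact ⟨X.torsor.act p g, (m.map_act p g).trans hg⟩
  choose z hz using key
  let y : Presieve.FamilyOfElements X.torsor.carrier (X.torsor.sectionSieve V : Presieve V) :=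
    fun W k hk => z W k ⟨hk.some⟩
  have hy : y.Compatible := by
    rw [Presieve.compatible_iff_sieveCompatible]
    intro W W' k l hk
    apply m.map_injective
    rw [m.map_res]
    refine (hz _ _ _).trans (Eq.trans ?_ (congrArg _ (hz _ _ _)).symm)
    rw [Torsor.map_map]
    exact Torsor.map_congr _ _ _ (by simp) _
  obtain ⟨p, -, -⟩ := X.torsor.isSheaf _ (X.torsor.sectionSieve_mem V) y hy
  exact ⟨p⟩

lemma TorsHom.map_bijective {X Y : TorsObj G} (m : TorsHom X Y) (V : Over X.base) :
    Function.Bijective (m.map V) := by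
  refine ⟨m.map_injective V, fun q => ?_⟩
  obtain ⟨p⟩ := m.nonempty_of_target V q
  obtain ⟨g, hg, -⟩ := Y.torsor.simply_transitive (m.map V p) q
  exact ⟨X.torsor.act p g, (m.map_act p g).trans hg⟩

/-- The inverse of a morphism of torsors on sections. -/
noncomputable def TorsHom.inv {X Y : TorsObj G} (m : TorsHom X Y) (V : Over X.base)
    (q : Y.torsor.carrier.obj (op ((Over.map m.base).obj V))) : X.torsor.carrier.obj (op V) :=
  ((m.map_bijective V).2 q).choose

lemma TorsHom.map_inv {X Y : TorsObj G} (m : TorsHom X Y) (V : Over X.base)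
    (q : Y.torsor.carrier.obj (op ((Over.map m.base).obj V))) : m.map V (m.inv V q) = q :=
  ((m.map_bijective V).2 q).choose_spec

lemma TorsHom.inv_map {X Y : TorsObj G} (m : TorsHom X Y) (V : Over X.base)
    (p : X.torsor.carrier.obj (op V)) : m.inv V (m.map V p) = p :=
  m.map_injective V (m.map_inv V _)

lemma TorsHom.inv_act {X Y : TorsObj G} (m : TorsHom X Y) (V : Over X.base)
    (q : Y.torsor.carrier.obj (op ((Over.map m.base).obj V))) (g : Sec G V.left) :
    m.inv V (Y.torsor.act (V := (Over.map m.base).obj V) q g) = X.torsor.act (m.inv V q) g := by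
  apply m.map_injective
  rw [m.map_inv, m.map_act, m.map_inv]

lemma TorsHom.inv_res {X Y : TorsObj G} (m : TorsHom X Y) {V W : Over X.base} (k : W ⟶ V)
    (q : Y.torsor.carrier.obj (op ((Over.map m.base).obj V))) :
    m.inv W (Y.torsor.carrier.map ((Over.map m.base).map k).op q) =
      X.torsor.carrier.map k.op (m.inv V q) := by
  apply m.map_injective
  rw [m.map_inv, m.map_res, m.map_inv]

section ExtensionFunctor

variable {Q : LeftObj G} {X Y Z : TorsObj G}

/-- An object of `E/T` over the image of an object of `E/S` comes from `E/S`. -/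
abbrev overLift {S T : E} {b : S ⟶ T} {V : Over S} {W : Over T} (k : W ⟶ (Over.map b).obj V) :
    Over S := Over.mk (k.left ≫ V.hom)

/-- The arrow from the object of `E/S` constructed in `overLift`. -/
abbrev overLiftHom {S T : E} {b : S ⟶ T} {V : Over S} {W : Over T} (k : W ⟶ (Over.map b).obj V) :
    overLift k ⟶ V := Over.homMk k.left rfl

/-- The object constructed in `overLift` has the expected image in `E/T`. -/
abbrev overLiftIso {S T : E} {b : S ⟶ T} {V : Over S} {W : Over T} (k : W ⟶ (Over.map b).obj V) :
    (Over.map b).obj (overLift k) ⟶ W :=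
  Over.homMk (𝟙 W.left) (by
    have := Over.w k
    simp only [Over.map_obj_hom] at this
    simp [this])

/-- The map induced by a morphism of torsors on contracted products: `[(p, q)] ↦ [(m p, q)]`. -/
noncomputable def contractedMap (m : TorsHom X Y) (V : Over X.base)
    (x : ContractedSection X.torsor Q V) :
    ContractedSection Y.torsor Q ((Over.map m.base).obj V) where
  toFun W k q := x.toFun (overLift k) (overLiftHom k)
    (m.inv _ (Y.torsor.carrier.map (overLiftIso k).op q))
  map_res {V' W} l k q := by
    have e : Y.torsor.carrier.map (overLiftIso (l ≫ k)).op (Y.torsor.carrier.map l.op q) =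
        Y.torsor.carrier.map ((Over.map m.base).map
          (Over.homMk l.left (by simp) : overLift (l ≫ k) ⟶ overLift k)).op
          (Y.torsor.carrier.map (overLiftIso k).op q) := by
      rw [Torsor.map_map, Torsor.map_map]
      exact Torsor.map_congr _ _ _ (by simp) _
    rw [e, m.inv_res]
    exact x.map_res' (Over.homMk l.left (by simp) : overLift (l ≫ k) ⟶ overLift k)
      (overLiftHom k) (overLiftHom (l ≫ k)) (by ext; simp) _
  map_act {V'} k q g := by
    have e : m.inv (overLift k) (Y.torsor.carrier.map (overLiftIso k).op (Y.torsor.act q g)) =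
        X.torsor.act (V := overLift k)
          (m.inv (overLift k) (Y.torsor.carrier.map (overLiftIso k).op q)) g := by
      rw [← m.inv_act, Y.torsor.act_res]
      exact congrArg _ (congrArg _ (res_id G g))
    exact (congrArg _ e).trans (x.map_act _ _ _)

lemma contractedMap_apply (m : TorsHom X Y) (V : Over X.base)
    (x : ContractedSection X.torsor Q V) {V' : Over X.base} (k : V' ⟶ V)
    (p : X.torsor.carrier.obj (op V')) :
    (contractedMap m V x).toFun ((Over.map m.base).obj V') ((Over.map m.base).map k)
      (m.map V' p) = x.toFun V' k p := by
  let c : overLift ((Over.map m.base).map k) ⟶ V' := Over.homMk (𝟙 V'.left) (by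
    have := Over.w k
    simp_all)
  have e : Y.torsor.carrier.map (overLiftIso ((Over.map m.base).map k)).op (m.map V' p) =
      Y.torsor.carrier.map ((Over.map m.base).map c).op (m.map V' p) :=
    Torsor.map_congr _ _ _ (by simp [c]) _
  refine (congrArg (fun t => x.toFun _ (overLiftHom ((Over.map m.base).map k)) (m.inv _ t))
    e).trans ?_
  refine (congrArg (fun t => x.toFun _ (overLiftHom ((Over.map m.base).map k)) t)
    ((m.inv_res c _).trans (congrArg _ (m.inv_map V' p)))).trans ?_
  refine (x.map_res' c k _ (by ext; simp [c]) p).trans ?_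
  exact Functor.map_id_apply _ _ _

lemma ContractedSection.ext_of_hom (m : TorsHom X Y) {V : Over X.base}
    {x y : ContractedSection Y.torsor Q ((Over.map m.base).obj V)}
    (h : ∀ (V' : Over X.base) (k : V' ⟶ V) (p : X.torsor.carrier.obj (op V')),
      x.toFun ((Over.map m.base).obj V') ((Over.map m.base).map k) (m.map V' p) =
        y.toFun ((Over.map m.base).obj V') ((Over.map m.base).map k) (m.map V' p)) : x = y := by
  ext W k q
  have key : ∀ z : ContractedSection Y.torsor Q ((Over.map m.base).obj V), z.toFun W k q =
      z.toFun ((Over.map m.base).obj (overLift k)) ((Over.map m.base).map (overLiftHom k))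
        (m.map (overLift k) (m.inv _ (Y.torsor.carrier.map (overLiftIso k).op q))) := by
    intro z
    rw [m.map_inv]
    refine Eq.trans ?_ (z.map_res' (overLiftIso k) k _ (by ext; simp) q).symm
    exact (Functor.map_id_apply Q.carrier (op W.left) _).symm
  rw [key, key, h]

/-- The morphism of `H`-torsors induced by a morphism of `G`-torsors. -/
noncomputable def TorsHom.extension (φ : G ⟶ H) (m : TorsHom X Y) :
    TorsHom (⟨X.base, X.torsor.extension φ⟩ : TorsObj H) ⟨Y.base, Y.torsor.extension φ⟩ where
  base := m.base
  map V x := contractedMap m V x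
  map_res {V W} k x := by
    refine ContractedSection.ext_of_hom m fun V' l p => ?_
    refine (contractedMap_apply m W _ l p).trans ?_
    refine (contractedMap_apply m V x (l ≫ k) p).symm.trans ?_
    exact congrArg (fun t => (contractedMap m V x).toFun _ t (m.map V' p)) (Functor.map_comp _ _ _)
  map_act {V} x h := by
    refine ContractedSection.ext_of_hom m fun V' l p => ?_
    refine (contractedMap_apply m V _ l p).trans ?_
    refine (congrArg (fun t : Sec H V'.left => t * res H l.left h)
      (contractedMap_apply m V x l p).symm)

/-- The extension of the structural group `TORSC(E; φ) : TORSC(E; G) ⥤ TORSC(E; H)`, as a functor: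
it sends `P` to `P ∧ H`. -/
noncomputable def torsExtension (φ : G ⟶ H) : TorsObj G ⥤ TorsObj H where
  obj X := ⟨X.base, X.torsor.extension φ⟩
  map m := TorsHom.extension φ m
  map_id X := by
    refine TorsHom.ext' rfl fun V x => ?_
    refine ContractedSection.ext_of_hom (TorsHom.id X) fun V' l p => ?_
    refine (congrArg (fun t => (contractedMap (TorsHom.id X) V x).toFun _ t
      ((TorsHom.id X).map V' p)) (Over.OverMorphism.ext (Category.comp_id l.left) :
        _ = (Over.map (TorsHom.id X).base).map l)).trans ?_
    refine (contractedMap_apply (TorsHom.id X) V x l p).trans ?_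
    refine Eq.trans ?_ (ContractedSection.map_res' (U := V) x
      (overEq (by simp) : (Over.map (𝟙 X.base)).obj V' ⟶ V') l _
      (Over.OverMorphism.ext ((Category.id_comp l.left).trans (Category.comp_id l.left).symm))
      p).symm
    exact (Functor.map_id_apply (translationObj φ).carrier (op V'.left) _).symm
  map_comp {X Y Z} m n := by
    refine TorsHom.ext' rfl fun V x => ?_
    refine ContractedSection.ext_of_hom (TorsHom.comp m n) fun V' l p => ?_
    refine (congrArg (fun t => (contractedMap (TorsHom.comp m n) V x).toFun _ t
      ((TorsHom.comp m n).map V' p)) (Over.OverMorphism.ext (Category.comp_id l.left) :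
        _ = (Over.map (TorsHom.comp m n).base).map l)).trans ?_
    refine (contractedMap_apply (TorsHom.comp m n) V x l p).trans ?_
    let y := contractedMap n _ (contractedMap m V x)
    have hy : y.toFun _ ((Over.map n.base).map ((Over.map m.base).map l))
        (n.map _ (m.map V' p)) = x.toFun V' l p :=
      (contractedMap_apply n _ (contractedMap m V x) ((Over.map m.base).map l) (m.map V' p)).trans
        (contractedMap_apply m V x l p)
    refine hy.symm.trans (Eq.trans ?_ (ContractedSection.map_res' y
      (overEq (by simp) : (Over.map (TorsHom.base m ≫ TorsHom.base n)).obj V' ⟶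
        (Over.map (TorsHom.base n)).obj ((Over.map (TorsHom.base m)).obj V')) ((Over.map n.base).map ((Over.map m.base).map l)) _
      (Over.OverMorphism.ext ((Category.id_comp l.left).trans (Category.comp_id l.left).symm))
      (n.map _ (m.map V' p))).symm)
    exact (Functor.map_id_apply (translationObj φ).carrier (op V'.left) _).symm

end ExtensionFunctor

/-- The stack `TORSC(E; G)` of `G`-torsors on `E`: the fiber over `S` consists of the `G`-torsors
over `S`, i.e. on `E/S`. -/
def torsStack (G : Sheaf J GrpCat.{w}) : BasedCategory.{_, _} E where
  obj := TorsObj G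
  p :=
    { obj := TorsObj.base
      map := fun m => TorsHom.base m
      map_id := fun _ => rfl
      map_comp := fun _ _ => rfl }

/-- The morphism of stacks `TORSC(E; φ)` given by extension of the structural group along `φ`. -/
noncomputable def torsStackMap (φ : G ⟶ H) : torsStack G ⥤ᵇ torsStack H where
  toFunctor := torsExtension φ
  w := rfl

variable {S : E} {P : Torsor G S} {Q : LeftObj G}

/-- `(p, q)`, given over `V ⟶ S`, is a local representative of the section `x` of the contracted
product over `S`: the class of `(p, q)` is the restriction of `x` to `V`. -/
def ContractedSection.IsLocalRep (x : ContractedSection P Q (Over.mk (𝟙 S))) (V : Over S)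
    (p : P.carrier.obj (op V)) (q : Q.carrier.obj (op V.left)) : Prop :=
  contractedClass P Q p q = (contractedProduct P Q).map (Over.mkIdTerminal.from V).op x

end Torsors

/-! ### Stacks and gerbes -/

section Gerbes

variable {E : Type u} [Category.{v} E]

/-- The property of a functor over `E` of being cartesian, i.e. of preserving cartesian arrows. -/
def IsCartesianFunctor {𝒳 : BasedCategory.{v₁, u₁} E} {𝒴 : BasedCategory.{v₂, u₂} E}
    (F : 𝒳 ⥤ᵇ 𝒴) : Prop :=
  ∀ ⦃R S : E⦄ (f : R ⟶ S) ⦃a b : 𝒳.obj⦄ (φ : a ⟶ b),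
    𝒳.p.IsCartesian f φ → 𝒴.p.IsCartesian f (F.map φ)

/-- The category `Cart_E(𝒳, 𝒴)` of cartesian functors. -/
abbrev CartCat (𝒳 : BasedCategory.{v₁, u₁} E) (𝒴 : BasedCategory.{v₂, u₂} E) :=
  ObjectProperty.FullSubcategory (fun F : 𝒳 ⥤ᵇ 𝒴 => IsCartesianFunctor F)

/-- `E/S` as a category over `E`. -/
def overBased (S : E) : BasedCategory E := BasedCategory.ofFunctor (Over.forget S)

/-- A sieve `R` of `S`, as a full subcategory of `E/S` and as a category over `E`. -/
def sieveBased {S : E} (R : Sieve S) : BasedCategory E :=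
  BasedCategory.ofFunctor
    ((ObjectProperty.ι (fun V : Over S => R V.hom)) ⋙ Over.forget S)

/-- The inclusion of a sieve. -/
def sieveInclusion {S : E} (R : Sieve S) : sieveBased R ⥤ᵇ overBased S where
  toFunctor := ObjectProperty.ι (fun V : Over S => R V.hom)
  w := rfl

lemma isCartesian_over_map {S : E} {a b : Over S} (φ : a ⟶ b) :
    (Over.forget S).IsCartesian ((Over.forget S).map φ) φ := by
  refine { universal_property := fun {a'} φ' h' => ?_ }
  have e : a'.left = _ := IsHomLift.domain_eq (Over.forget _) ((Over.forget _).map φ) φ'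
  have e' : φ'.left = eqToHom e ≫ φ.left := by
    have := IsHomLift.fac' (Over.forget _) ((Over.forget _).map φ) φ'
    simpa using this
  refine ⟨Over.homMk (eqToHom e) ?_, ⟨?_, ?_⟩, ?_⟩
  · rw [← Over.w φ', ← Over.w φ, e']
    exact (Category.assoc _ _ _).symm
  · apply IsHomLift.of_fac _ _ _ e rfl
    have key : ∀ {c d : E} (h : c = d), 𝟙 d = eqToHom h.symm ≫ eqToHom h ≫ eqToHom rfl := by
      rintro c _ rfl
      simp
    exact key e
  · ext
    exact e'.symm
  · rintro χ ⟨hχ, -⟩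
    ext
    have key : ∀ {U : E} (f : U ⟶ a.left), (Over.forget _).IsHomLift f χ →
        ∀ h : a'.left = U, χ.left = eqToHom h ≫ f := by
      rintro U f hf h
      exact (IsHomLift.fac' (Over.forget _) f χ).trans
        (congrArg _ (Category.comp_id f))
    exact (key _ hχ e).trans (Category.comp_id _)

lemma isCartesian_over {S : E} {R T : E} (f : R ⟶ T) {a b : Over S} (φ : a ⟶ b)
    (h : (Over.forget S).IsHomLift f φ) : (Over.forget S).IsCartesian f φ := by
  obtain ⟨φ⟩ := h
  exact isCartesian_over_map φ

lemma sieveInclusion_cartesian {S : E} (R : Sieve S) : IsCartesianFunctor (sieveInclusion R) := by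
  intro _ _ f a b φ h
  apply isCartesian_over
  have : (sieveBased R).p.IsHomLift f φ := h.toIsHomLift
  exact BasedFunctor.preserves_isHomLift (sieveInclusion R) f φ

lemma IsCartesianFunctor.comp {𝒳 : BasedCategory.{v₁, u₁} E} {𝒴 : BasedCategory.{v₂, u₂} E}
    {𝒵 : BasedCategory.{v₃, u₃} E} {F : 𝒵 ⥤ᵇ 𝒳} {G : 𝒳 ⥤ᵇ 𝒴}
    (hF : IsCartesianFunctor F) (hG : IsCartesianFunctor G) :
    IsCartesianFunctor (BasedFunctor.comp F G) := fun _ _ f _ _ φ h => hG f _ (hF f φ h)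


/-- The restriction functor `Cart_E(E/S, 𝒳) ⥤ Cart_E(R, 𝒳)` for a sieve `R` of `S`. -/
def restrictToSieve (𝒳 : BasedCategory.{v₁, u₁} E) {S : E} (R : Sieve S) :
    CartCat (overBased S) 𝒳 ⥤ CartCat (sieveBased R) 𝒳 where
  obj F := ⟨BasedFunctor.comp (sieveInclusion R) F.obj, (sieveInclusion_cartesian R).comp F.property⟩
  map α := ObjectProperty.homMk (BasedCategory.whiskerLeft (sieveInclusion R) α.hom)

/-- A stack: a fibered category `𝒳` over `E` such that for every covering sieve `R` of `S` the
restriction `Cart_E(E/S, 𝒳) ⥤ Cart_E(R, 𝒳)` is an equivalence. -/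
structure IsStack (J : GrothendieckTopology E) (𝒳 : BasedCategory.{v₁, u₁} E) : Prop where
  fibered : 𝒳.p.IsFibered
  restrict : ∀ (S : E), ∀ R ∈ J S, (restrictToSieve 𝒳 R).IsEquivalence

/-- A gerbe: a stack in groupoids which locally has objects and whose objects (over the same object
of `E`) are locally isomorphic. In `locally_nonempty`, `R` is a refinement of `E`, i.e. a set of
objects which contains the source of every arrow to one of its members and such that the arrows
to `S` whose source is in `R` form a covering sieve of `S`, for each `S`. -/
structure IsGerbe (J : GrothendieckTopology E) (𝒳 : BasedCategory.{v₁, u₁} E) : Prop where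
  stack : IsStack J 𝒳
  groupoids : ∀ (S : E) {x y : 𝒳.obj} (φ : x ⟶ y), 𝒳.p.IsHomLift (𝟙 S) φ → IsIso φ
  locally_nonempty : ∃ R : Set E, (∀ ⦃X Y : E⦄ (_ : X ⟶ Y), Y ∈ R → X ∈ R) ∧
    (∀ S : E, ∃ C ∈ J S, ∀ ⦃X : E⦄ (f : X ⟶ S), C f ↔ X ∈ R) ∧
    ∀ S ∈ R, ∃ x : 𝒳.obj, 𝒳.p.obj x = S
  locally_isomorphic : ∀ (S : E) (x y : 𝒳.obj), 𝒳.p.obj x = S → 𝒳.p.obj y = S →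
    ∃ R ∈ J S, ∀ ⦃T : E⦄ (f : T ⟶ S), R f →
      ∃ (x' y' : 𝒳.obj) (m : x' ⟶ x) (n : y' ⟶ y) (e : x' ≅ y'),
        𝒳.p.IsCartesian f m ∧ 𝒳.p.IsCartesian f n ∧ 𝒳.p.IsHomLift (𝟙 T) e.hom

/-- The group `Aut_S(x)` of automorphisms over the identity of `S` of an object `x` of the
fiber over `S`. -/
def VAut (𝒳 : BasedCategory.{v₁, u₁} E) (x : 𝒳.obj) : Subgroup (Aut x) where
  carrier := {σ | 𝒳.p.map σ.hom = 𝟙 _}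
  one_mem' := 𝒳.p.map_id x
  mul_mem' {σ τ} hσ hτ := by
    change 𝒳.p.map (τ.hom ≫ σ.hom) = 𝟙 _
    rw [Functor.map_comp, show 𝒳.p.map σ.hom = 𝟙 _ from hσ, show 𝒳.p.map τ.hom = 𝟙 _ from hτ,
      Category.comp_id]
  inv_mem' {σ} hσ := by
    change 𝒳.p.map σ.inv = 𝟙 _
    have h : 𝒳.p.map σ.inv ≫ 𝒳.p.map σ.hom = 𝟙 _ := by
      rw [← Functor.map_comp, σ.inv_hom_id, CategoryTheory.Functor.map_id]
    rwa [show 𝒳.p.map σ.hom = 𝟙 _ from hσ, Category.comp_id] at h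

lemma map_vertical {𝒳 : BasedCategory.{v₁, u₁} E} {𝒴 : BasedCategory.{v₂, u₂} E} (F : 𝒳 ⥤ᵇ 𝒴)
    {x : 𝒳.obj} (σ : VAut 𝒳 x) : 𝒴.p.map (F.map σ.1.hom) = 𝟙 _ := by
  have h := Functor.congr_hom F.w σ.1.hom
  rw [show 𝒳.p.map σ.1.hom = 𝟙 _ from σ.2] at h
  simpa using h

/-- The homomorphism `Aut_S(x) ⟶ Aut_S(F(x))` defined by a functor over `E`. -/
def vautMap {𝒳 : BasedCategory.{v₁, u₁} E} {𝒴 : BasedCategory.{v₂, u₂} E} (F : 𝒳 ⥤ᵇ 𝒴)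
    (x : 𝒳.obj) : VAut 𝒳 x →* VAut 𝒴 (F.obj x) where
  toFun σ := ⟨F.mapIso σ.1, map_vertical F σ⟩
  map_one' := Subtype.ext (F.mapIso_refl x)
  map_mul' σ τ := Subtype.ext (F.mapIso_trans τ.1 σ.1)

/-- A (cartesian) section of `𝒳`: a cartesian functor `E ⥤ 𝒳` over `E`. -/
structure CartesianSection (𝒳 : BasedCategory.{v₁, u₁} E) extends E ⥤ 𝒳.obj where
  w : Functor.comp toFunctor 𝒳.p = Functor.id E
  cartesian : ∀ {T S : E} (f : T ⟶ S), 𝒳.p.IsCartesian f (map f)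

/-! ### The gerbe of liftings of a section -/

variable {F : BasedCategory.{v₁, u₁} E} {H : BasedCategory.{v₂, u₂} E}

/-- An object of `K(s)` over `S`: an object `pt` of `F` over `S` and an isomorphism
`γ(pt) ⟶ s(S)` over the identity of `S`. -/
structure Lifting (γ : F ⥤ᵇ H) (s : CartesianSection H) where
  pt : F.obj
  iso : γ.obj pt ≅ s.obj (F.p.obj pt)
  vertical : H.p.IsHomLift (𝟙 (F.p.obj pt)) iso.hom

variable {γ : F ⥤ᵇ H} {s : CartesianSection H}

/-- A morphism of `K(s)` over `f : T ⟶ S`: a morphism `ψ` of `F` over `f` with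
`s(f) ∘ β = α ∘ γ(ψ)`. -/
@[ext]
structure LiftingHom (X Y : Lifting γ s) where
  hom : X.pt ⟶ Y.pt
  comm : X.iso.hom ≫ s.map (F.p.map hom) = γ.map hom ≫ Y.iso.hom

/-- The category `K(s)`. -/
instance : Category (Lifting γ s) where
  Hom X Y := LiftingHom X Y
  id X := ⟨𝟙 X.pt, by simp⟩
  comp m n := ⟨m.hom ≫ n.hom, by
    rw [Functor.map_comp, Functor.map_comp, Functor.map_comp, reassoc_of% m.comm, n.comm,
      Category.assoc]⟩
  id_comp m := LiftingHom.ext (Category.id_comp m.hom)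
  comp_id m := LiftingHom.ext (Category.comp_id m.hom)
  assoc m n l := LiftingHom.ext (Category.assoc m.hom n.hom l.hom)

variable (γ s) in
/-- The category `K(s)` of liftings of the section `s` of `H` to `F` along `γ : F ⟶ H`, over `E`. -/
def liftings : BasedCategory.{v₁, max u₁ v₂} E where
  obj := Lifting γ s
  p :=
    { obj := fun X => F.p.obj X.pt
      map := fun m => F.p.map (LiftingHom.hom m)
      map_id := fun X => F.p.map_id X.pt
      map_comp := fun m n => F.p.map_comp (LiftingHom.hom m) (LiftingHom.hom n) }

variable (γ s) in
/-- The functor `k(s) : K(s) ⟶ F`. -/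
def liftingsForget : liftings γ s ⥤ᵇ F where
  toFunctor :=
    { obj := fun X => Lifting.pt X
      map := fun m => LiftingHom.hom m
      map_id := fun _ => rfl
      map_comp := fun _ _ => rfl }
  w := rfl

end Gerbes

/-! ### Gerbes with a structure given by a sheaf of crossed groups -/

section Main

variable {E : Type u} [Category.{v} E] {J : GrothendieckTopology E}

lemma vautBase {G : Sheaf J GrpCat.{w}} {𝒢 : BasedCategory.{v₁, u₁} E} (μ : 𝒢 ⥤ᵇ torsStack G)
    {x : 𝒢.obj} (σ : VAut 𝒢 x) {U : E} (t : U ⟶ TorsObj.base (μ.obj x)) :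
    t = t ≫ TorsHom.base (μ.map σ.1.hom) :=
  (Category.comp_id t).symm.trans (congrArg (fun k => t ≫ k) (map_vertical μ σ).symm)

/-- The structure `(𝒢, μ, j)` of an `(A, Π)`-gerbe, for a sheaf of crossed groups `(A, Π)`: a
gerbe `𝒢`, a morphism of gerbes `μ` to the gerbe of `Π`-torsors and an isomorphism `j` of morphisms
of stacks from `x ↦ Aut(x)` to `x ↦ μ(x) ∧ A`.

The sections of the sheaf `Aut(x)` over an arrow `T ⟶ S` are the automorphisms of an inverse image
of `x` along this arrow. So `j` amounts to isomorphisms on global sections for all objects `x`,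
compatible with all arrows `m` of `𝒢` (both the ones exhibiting inverse images and the isomorphisms
in the fibers). -/
structure CrossedGerbeStructure (Φ : CrossedSheaf.{w} J) (𝒢 : BasedCategory.{v₁, u₁} E) where
  isGerbe : IsGerbe J 𝒢
  μ : 𝒢 ⥤ᵇ torsStack Φ.Pi
  μ_cartesian : IsCartesianFunctor μ
  j : ∀ x : 𝒢.obj, VAut 𝒢 x ≃*
    ContractedSection (TorsObj.torsor (μ.obj x)) Φ.leftObj (Over.mk (𝟙 (TorsObj.base (μ.obj x))))
  j_natural : ∀ ⦃y x : 𝒢.obj⦄ (m : y ⟶ x) (τ : VAut 𝒢 y) (σ : VAut 𝒢 x),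
    τ.1.hom ≫ m = m ≫ σ.1.hom → ∀ V p a, (j y τ).IsLocalRep V p a →
      (j x σ).IsLocalRep ((Over.map (TorsHom.base (μ.map m))).obj V)
        (TorsHom.map (μ.map m) V p) a
  /-- `μ(j⁻¹(a_x))(α) = α · ρ(a)` for every local representative `(α, a)` of `a_x`. -/
  condition : ∀ (x : 𝒢.obj) (σ : VAut 𝒢 x) (V : Over (TorsObj.base (μ.obj x))) (α)
    (a : Sec Φ.A V.left), (j x σ).IsLocalRep V α a →
      (TorsObj.torsor (μ.obj x)).carrier.map
        (overEq (vautBase μ σ V.hom) : V ⟶ (Over.map (TorsHom.base (μ.map σ.1.hom))).obj V).op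
        (TorsHom.map (μ.map σ.1.hom) V α) = (TorsObj.torsor (μ.obj x)).act α (app Φ.ρ V.left a)

variable {Φ Φ' : CrossedSheaf.{w} J}

/-- `L : 𝒢 ⟶ 𝒢'` is a `(f, φ)`-morphism: it is a morphism of gerbes and there is an isomorphism
`i` from `TORSC(E; φ) ∘ μ` to `μ' ∘ L` such that `j'_{L x} ∘ Aut(L)_x = ω_x ∘ j_x` for all `x`.
Here `ω_x = (i_x ∧ A') ∘ (p_x ∧ f)`, which sends the class of `(p, a)` to the class of
`(i_x (p_x p), f a)`, and `p_x : μ(x) ⟶ μ(x) ∧ Π'` is `Torsor.toExtension`. -/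
structure IsCrossedMorphism (θ : CrossedHom Φ Φ') {𝒢 : BasedCategory.{v₁, u₁} E}
    {𝒢' : BasedCategory.{v₂, u₂} E} (X : CrossedGerbeStructure Φ 𝒢)
    (X' : CrossedGerbeStructure Φ' 𝒢') (L : 𝒢 ⥤ᵇ 𝒢') : Prop where
  cartesian : IsCartesianFunctor L
  exists_iso : ∃ i : BasedFunctor.comp X.μ (torsStackMap θ.φ) ≅ BasedFunctor.comp L X'.μ,
    ∀ (x : 𝒢.obj) (σ : VAut 𝒢 x) (V : Over (TorsObj.base (X.μ.obj x))) (p) (a : Sec Φ.A V.left),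
      (X.j x σ).IsLocalRep V p a →
        (X'.j (L.obj x) (vautMap L x σ)).IsLocalRep
          ((Over.map (TorsHom.base (i.hom.app x))).obj V)
          (TorsHom.map (i.hom.app x) V ((TorsObj.torsor (X.μ.obj x)).toExtension θ.φ p))
          (app θ.f V.left a)

set_option linter.checkUnivs false in
/-- An `(A, Π)`-gerbe. -/
structure CrossedGerbe (Φ : CrossedSheaf.{w} J) where
  gerbe : BasedCategory.{v₁, u₁} E
  str : CrossedGerbeStructure Φ gerbe

set_option linter.checkUnivs false in
/-- The set `H²(E; Φ)` of classes of `(A, Π)`-gerbes, two `(A, Π)`-gerbes being equivalent when there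
is an `id`-morphism between them. -/
def H2 (Φ : CrossedSheaf.{w} J) :=
  Quot (fun X Y : CrossedGerbe.{w, v₁, u₁} Φ =>
    ∃ L : X.gerbe ⥤ᵇ Y.gerbe, IsCrossedMorphism (CrossedHom.id Φ) X.str Y.str L)

/-- A neutral class: the class of an `(A, Π)`-gerbe which has a section. -/
def H2.IsNeutral (y : H2.{w, v₁, u₁} Φ) : Prop :=
  ∃ X : CrossedGerbe.{w, v₁, u₁} Φ, Quot.mk _ X = y ∧ Nonempty (CartesianSection X.gerbe)

/-- The relation `y = (f, φ)⁽²⁾(x)`: there is an `(f, φ)`-morphism from a gerbe of class `x` to a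
gerbe of class `y`. -/
def H2.MapsTo (θ : CrossedHom Φ Φ') (x : H2.{w, v₁, u₁} Φ) (y : H2.{w, v₁, u₁} Φ') : Prop :=
  ∃ (X : CrossedGerbe.{w, v₁, u₁} Φ) (Y : CrossedGerbe.{w, v₁, u₁} Φ'),
    Quot.mk _ X = x ∧ Quot.mk _ Y = y ∧
      ∃ L : X.gerbe ⥤ᵇ Y.gerbe, IsCrossedMorphism θ X.str Y.str L

end Main
end CrossedGerbes

/-!
The proof is written in terms of values. For a section `p` of the torsor `μ(x)` and an automorphism
`σ` of `x`, the value of `σ` at `p` is the section `a` of `A` with `j(σ) = [(p, a)]`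
(`CrossedGerbeStructure.val`). An `η`-morphism `γ`, for `η : (A', Π') ⟶ (A'', Π'')`, acts on values
by `A' ⟶ A''`. Hence the kernel of `Aut(z) ⟶ Aut(γ(z))` consists of the automorphisms with values in
the kernel of `A' ⟶ A''` (`IsCrossedMorphism.vautMap_eq_one_iff`), and if `A' ⟶ A''` is an
epimorphism, then `γ` is locally full (`IsCrossedMorphism.locally_full`).

*The gerbe of liftings.* `K(s)` is a stack, because objects and arrows descend in `F` and the
identifications `γ(z) ≅ s(S)` descend in `H` (`liftings_isStack`). Local objects exist since `γ(x)`
is locally isomorphic to `s(S)`, and two liftings are locally isomorphic since `γ` is locally full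
(`liftings_isGerbe`). The automorphisms of a lifting `(z, α)` are the kernel of
`Aut(z) ⟶ Aut(γ(z))`, which by exactness is `P ∧ A` for `P = μ(z)`; this is the isomorphism `j` of
`K(s)` (`liftingsJ`). Here `P` is regarded as a torsor under `Π` by means of the isomorphism `φ : Π ⟶ Π'`,
and this restriction of the structural group is inverse to the extension `P ↦ P ∧ Π'`
(`exists_restrictExtensionIso`), so that the projection `K(s) ⟶ F` is an `(f, φ)`-morphism
(`liftingsForget_isCrossedMorphism`).

*Exactness.* The classes in `H²` are those of the equivalence relation generated by `id`-morphisms,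
and the argument uses a property of gerbes which is invariant under `id`-morphisms in both
directions. A gerbe reduces to the kernel of `η : (A, Π) ⟶ (A', Π')` if it has an atlas, that is, a
family of objects and distinguished arrows which exist locally and connect the objects locally, in
which any two parallel distinguished arrows over the same arrow of `E` differ by an automorphism
with values in this kernel (`CrossedGerbeStructure.Reduces`). It may be thought of as a subgerbe
bound by the kernel, without descent conditions. Atlases have images under morphisms, and inverse
images under morphisms which are epimorphisms on `A` (`Reduces.image`, `Reduces.preimage`), so that
the property depends only on the class (`H2.Reduces`).

For `η = id` the atlas is rigid, and descent yields a section from it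
(`Atlas.nonempty_cartesianSection`); conversely, the values of a section form an atlas. So a class
is neutral if and only if it reduces to the trivial group (`H2.isNeutral_iff`). If `x` is the image
of `z` under `(f, φ)`, then a gerbe of class `z` reduces to the kernel of the composite `A ⟶ A''`,
which is everything (`reduces_of_eq_one`). Its image of class `x` reduces to the kernel of
`A' ⟶ A''`, and the image of class `y` reduces to the trivial group. If `y` is neutral, then the gerbe `H`
itself has a section `s`, and `K(s)` is a gerbe whose class maps to `x`.
-/

universe t

namespace CrossedGerbes

/-! ### Categories fibered in groupoids -/

section GroupoidFibrations

variable {E : Type u} [Category.{v} E]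

/-- A category fibered in groupoids over `E`. -/
structure IsFiberedInGroupoids (𝒳 : BasedCategory.{v₁, u₁} E) : Prop where
  fibered : 𝒳.p.IsFibered
  groupoids : ∀ (S : E) {x y : 𝒳.obj} (φ : x ⟶ y), 𝒳.p.IsHomLift (𝟙 S) φ → IsIso φ

/-- An arrow is strongly cartesian if arrows lift uniquely along it. Here the arrows of `E` are
literally the images under `𝒳.p`, so that no transport along equalities of objects occurs. -/
lemma isStronglyCartesian_of_lift {𝒳 : BasedCategory.{v₁, u₁} E} {y z : 𝒳.obj} (ψ : y ⟶ z)
    (lift : ∀ {x : 𝒳.obj} (φ : x ⟶ z) (g : 𝒳.p.obj x ⟶ 𝒳.p.obj y),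
      𝒳.p.map φ = g ≫ 𝒳.p.map ψ → ∃! χ : x ⟶ y, 𝒳.p.map χ = g ∧ χ ≫ ψ = φ)
    {R S : E} (f : R ⟶ S) (h : 𝒳.p.IsHomLift f ψ) : 𝒳.p.IsStronglyCartesian f ψ := by
  obtain ⟨⟩ := h
  refine { universal_property' := fun {x} g φ hφ => ?_ }
  obtain ⟨χ, ⟨h₁, h₂⟩, h₃⟩ := lift φ g (IsHomLift.eq_of_isHomLift _ _ _).symm
  refine ⟨χ, ⟨h₁ ▸ inferInstance, h₂⟩, fun χ' hχ' => h₃ χ' ⟨?_, hχ'.2⟩⟩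
  have := hχ'.1
  exact (IsHomLift.eq_of_isHomLift _ _ _).symm

namespace IsFiberedInGroupoids

variable {𝒳 : BasedCategory.{v₁, u₁} E}

/-- The criterion by which `IsFiberedInGroupoids` is checked: inverse images exist, and every arrow
has the lifting property of a strongly cartesian arrow. -/
lemma of_lifts
    (pull : ∀ (y : 𝒳.obj) {T : E} (f : T ⟶ 𝒳.p.obj y), ∃ (x : 𝒳.obj) (m : x ⟶ y),
      𝒳.p.IsHomLift f m)
    (lift : ∀ {x y z : 𝒳.obj} (ψ : y ⟶ z) (φ : x ⟶ z) (g : 𝒳.p.obj x ⟶ 𝒳.p.obj y),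
      𝒳.p.map φ = g ≫ 𝒳.p.map ψ → ∃! χ : x ⟶ y, 𝒳.p.map χ = g ∧ χ ≫ ψ = φ) :
    IsFiberedInGroupoids 𝒳 := by
  refine ⟨Functor.IsFibered.of_exists_isStronglyCartesian fun a R f => ?_, fun S x y φ h => ?_⟩
  · obtain ⟨x, m, h⟩ := pull a f
    exact ⟨x, m, isStronglyCartesian_of_lift m (lift m) f h⟩
  · have := isStronglyCartesian_of_lift φ (lift φ) (𝟙 S) h
    exact Functor.IsStronglyCartesian.isIso_of_base_isIso 𝒳.p (𝟙 S) φ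

variable (h𝒳 : IsFiberedInGroupoids 𝒳)
include h𝒳

/-- In a category fibered in groupoids every arrow is strongly cartesian: it differs from a
cartesian arrow by a vertical arrow, which is an isomorphism. -/
lemma isStronglyCartesian {R S : E} (f : R ⟶ S) {y z : 𝒳.obj} (ψ : y ⟶ z)
    (hψ : 𝒳.p.IsHomLift f ψ) : 𝒳.p.IsStronglyCartesian f ψ := by
  have := h𝒳.fibered
  obtain ⟨x, m, hm⟩ := IsPreFibered.exists_isCartesian 𝒳.p
    (IsHomLift.codomain_eq 𝒳.p f ψ) f
  let χ := Functor.IsCartesian.map 𝒳.p f m ψ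
  have hχ : 𝒳.p.IsHomLift (𝟙 R) χ := inferInstance
  have := h𝒳.groupoids R χ hχ
  have : 𝒳.p.IsHomLift (𝟙 R) (asIso χ).hom := hχ
  have : 𝒳.p.IsCartesian f ((asIso χ).hom ≫ m) := inferInstance
  rw [asIso_hom, Functor.IsCartesian.fac] at this
  infer_instance

lemma isCartesian {R S : E} (f : R ⟶ S) {y z : 𝒳.obj} (ψ : y ⟶ z)
    (hψ : 𝒳.p.IsHomLift f ψ) : 𝒳.p.IsCartesian f ψ :=
  have := h𝒳.isStronglyCartesian f ψ hψ
  inferInstance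

lemma exists_pull {S : E} (y : 𝒳.obj) (hy : 𝒳.p.obj y = S) {T : E} (f : T ⟶ S) :
    ∃ (x : 𝒳.obj) (m : x ⟶ y), 𝒳.p.IsHomLift f m := by
  have := h𝒳.fibered
  obtain ⟨x, m, hm⟩ := IsPreFibered.exists_isCartesian 𝒳.p hy f
  exact ⟨x, m, inferInstance⟩

lemma exists_lift {R S T : E} {x y z : 𝒳.obj} (f : R ⟶ S) (ψ : y ⟶ z) (hψ : 𝒳.p.IsHomLift f ψ)
    (g : T ⟶ R) (φ : x ⟶ z) (hφ : 𝒳.p.IsHomLift (g ≫ f) φ) :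
    ∃ χ : x ⟶ y, 𝒳.p.IsHomLift g χ ∧ χ ≫ ψ = φ :=
  have := h𝒳.isStronglyCartesian f ψ hψ
  (Functor.IsStronglyCartesian.universal_property 𝒳.p f ψ g _ rfl φ).exists

/-- Two morphisms over the same arrow agree as soon as their composites with some arrow do. -/
lemma cancel {R T : E} {x y z : 𝒳.obj} (ψ : y ⟶ z) {g : T ⟶ R} {χ χ' : x ⟶ y}
    (h₁ : 𝒳.p.IsHomLift g χ) (h₂ : 𝒳.p.IsHomLift g χ') (h : χ ≫ ψ = χ' ≫ ψ) : χ = χ' := by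
  obtain rfl := IsHomLift.codomain_eq 𝒳.p g χ
  have := h𝒳.isStronglyCartesian (𝒳.p.map ψ) ψ inferInstance
  exact Functor.IsStronglyCartesian.ext 𝒳.p (𝒳.p.map ψ) ψ g h

/-- A form of `cancel` in which the common image in `E` is not named. -/
lemma cancel' {x y z : 𝒳.obj} (ψ : y ⟶ z) {χ χ' : x ⟶ y}
    (h₁ : 𝒳.p.map χ = 𝒳.p.map χ') (h : χ ≫ ψ = χ' ≫ ψ) : χ = χ' :=
  h𝒳.cancel ψ (g := 𝒳.p.map χ) inferInstance (h₁ ▸ inferInstance) h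

/-- Two morphisms with the same target over the same arrow differ by a vertical isomorphism. -/
lemma exists_iso {R S : E} {x y z : 𝒳.obj} (f : R ⟶ S) (ψ : y ⟶ z) (hψ : 𝒳.p.IsHomLift f ψ)
    (φ : x ⟶ z) (hφ : 𝒳.p.IsHomLift f φ) :
    ∃ e : x ≅ y, 𝒳.p.IsHomLift (𝟙 R) e.hom ∧ e.hom ≫ ψ = φ := by
  obtain ⟨χ, h₁, h₂⟩ := h𝒳.exists_lift f ψ hψ (𝟙 R) φ (by simpa using hφ)
  have := h𝒳.groupoids R χ h₁
  exact ⟨asIso χ, h₁, h₂⟩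

/-- A functor over `E` with values in a category fibered in groupoids is cartesian. -/
lemma isCartesianFunctor {𝒵 : BasedCategory.{v₂, u₂} E} (F : 𝒵 ⥤ᵇ 𝒳) : IsCartesianFunctor F := by
  intro R S f a b φ hφ
  have : 𝒵.p.IsHomLift f φ := hφ.toIsHomLift
  exact h𝒳.isCartesian f _ (BasedFunctor.preserves_isHomLift F f φ)

section Pull

variable (y : 𝒳.obj) {S : E} (hy : 𝒳.p.obj y = S)

/-- A choice of an inverse image of `y` along an arrow. -/
noncomputable def pullObj (V : Over S) : 𝒳.obj := (h𝒳.exists_pull y hy V.hom).choose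

/-- The arrow from the chosen inverse image of `y`. -/
noncomputable def pullHom (V : Over S) : h𝒳.pullObj y hy V ⟶ y :=
  (h𝒳.exists_pull y hy V.hom).choose_spec.choose

lemma pullHom_lift (V : Over S) : 𝒳.p.IsHomLift V.hom (h𝒳.pullHom y hy V) :=
  (h𝒳.exists_pull y hy V.hom).choose_spec.choose_spec

lemma pullMap_exists {V W : Over S} (k : V ⟶ W) :
    ∃ χ : h𝒳.pullObj y hy V ⟶ h𝒳.pullObj y hy W,
      𝒳.p.IsHomLift k.left χ ∧ χ ≫ h𝒳.pullHom y hy W = h𝒳.pullHom y hy V :=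
  h𝒳.exists_lift W.hom _ (h𝒳.pullHom_lift y hy W) k.left _ (by
    rw [Over.w k]; exact h𝒳.pullHom_lift y hy V)

/-- The arrow between chosen inverse images of `y` over an arrow of `E/S`. -/
noncomputable def pullMap {V W : Over S} (k : V ⟶ W) :
    h𝒳.pullObj y hy V ⟶ h𝒳.pullObj y hy W := (h𝒳.pullMap_exists y hy k).choose

lemma pullMap_lift {V W : Over S} (k : V ⟶ W) : 𝒳.p.IsHomLift k.left (h𝒳.pullMap y hy k) :=
  (h𝒳.pullMap_exists y hy k).choose_spec.1

lemma pullMap_comp_pullHom {V W : Over S} (k : V ⟶ W) :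
    h𝒳.pullMap y hy k ≫ h𝒳.pullHom y hy W = h𝒳.pullHom y hy V :=
  (h𝒳.pullMap_exists y hy k).choose_spec.2

lemma pullMap_id (V : Over S) : h𝒳.pullMap y hy (𝟙 V) = 𝟙 (h𝒳.pullObj y hy V) := by
  have := h𝒳.pullHom_lift y hy V
  refine h𝒳.cancel (h𝒳.pullHom y hy V) (h𝒳.pullMap_lift y hy (𝟙 V))
    (IsHomLift.id (IsHomLift.domain_eq 𝒳.p V.hom (h𝒳.pullHom y hy V))) ?_
  rw [pullMap_comp_pullHom, Category.id_comp]

lemma pullMap_comp {U V W : Over S} (k : U ⟶ V) (l : V ⟶ W) :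
    h𝒳.pullMap y hy (k ≫ l) = h𝒳.pullMap y hy k ≫ h𝒳.pullMap y hy l := by
  have := h𝒳.pullMap_lift y hy k
  have := h𝒳.pullMap_lift y hy l
  refine h𝒳.cancel (h𝒳.pullHom y hy W) (h𝒳.pullMap_lift y hy (k ≫ l))
    (IsHomLift.comp 𝒳.p k.left l.left _ _) ?_
  rw [Category.assoc, pullMap_comp_pullHom, pullMap_comp_pullHom, pullMap_comp_pullHom]

lemma pullObj_base (V : Over S) : 𝒳.p.obj (h𝒳.pullObj y hy V) = V.left :=
  have := h𝒳.pullHom_lift y hy V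
  IsHomLift.domain_eq 𝒳.p V.hom (h𝒳.pullHom y hy V)

lemma map_pullMap {U V : Over S} (k : U ⟶ V) : 𝒳.p.map (h𝒳.pullMap y hy k) =
    eqToHom (h𝒳.pullObj_base y hy U) ≫ k.left ≫ eqToHom (h𝒳.pullObj_base y hy V).symm :=
  have := h𝒳.pullMap_lift y hy k
  IsHomLift.fac' 𝒳.p k.left (h𝒳.pullMap y hy k)

/-- The functor `E/S ⟶ 𝒳` formed by the inverse images of an object `y` over `S`. -/
noncomputable def pullFunctor : overBased S ⥤ᵇ 𝒳 where
  obj V := h𝒳.pullObj y hy V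
  map k := h𝒳.pullMap y hy k
  map_id V := h𝒳.pullMap_id y hy V
  map_comp k l := h𝒳.pullMap_comp y hy k l
  w := CategoryTheory.Functor.ext (h𝒳.pullObj_base y hy) (fun _ _ k => h𝒳.map_pullMap y hy k)

end Pull

end IsFiberedInGroupoids

end GroupoidFibrations

/-! ### The stack condition as extension along covering sieves -/

section Stacks

variable {E : Type u} [Category.{v} E] {J : GrothendieckTopology E}
  {𝒳 : BasedCategory.{v₁, u₁} E}

/-- An object of a sieve, regarded as a category. -/
abbrev sieveObj {S : E} {R : Sieve S} (V : Over S) (hV : R V.hom) : (sieveBased R).obj := ⟨V, hV⟩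

/-- An arrow between objects of a sieve, regarded as a category. -/
abbrev sieveHom {S : E} {R : Sieve S} {V W : Over S} (hV : R V.hom) (hW : R W.hom) (k : V ⟶ W) :
    sieveObj V hV ⟶ sieveObj W hW := ObjectProperty.homMk k

/-- Fullness of the restriction to a covering sieve: natural transformations extend from a covering
sieve of `S` to `E/S`. -/
lemma IsStack.exists_extend_hom (h : IsStack J 𝒳) {S : E} {R : Sieve S} (hR : R ∈ J S)
    {G G' : overBased S ⥤ᵇ 𝒳} (hG : IsCartesianFunctor G) (hG' : IsCartesianFunctor G')
    (β : BasedFunctor.comp (sieveInclusion R) G ⟶ BasedFunctor.comp (sieveInclusion R) G') :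
    ∃ γ : G ⟶ G', ∀ (V : Over S) (hV : R V.hom), γ.app V = β.app (sieveObj V hV) := by
  have := h.restrict S R hR
  let X : CartCat (overBased S) 𝒳 := ⟨G, hG⟩
  let X' : CartCat (overBased S) 𝒳 := ⟨G', hG'⟩
  obtain ⟨γ, hγ⟩ := (restrictToSieve 𝒳 R).map_surjective
    (ObjectProperty.homMk β : (restrictToSieve 𝒳 R).obj X ⟶ (restrictToSieve 𝒳 R).obj X')
  refine ⟨γ.hom, fun V hV => ?_⟩
  have e : BasedCategory.whiskerLeft (sieveInclusion R) γ.hom = β :=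
    congrArg (fun t : (restrictToSieve 𝒳 R).obj X ⟶ (restrictToSieve 𝒳 R).obj X' =>
      InducedCategory.Hom.hom t) hγ
  rw [← e]
  rfl

/-- Faithfulness of the restriction to a covering sieve: natural transformations are determined by
their components on the sieve. -/
lemma IsStack.hom_ext_of_sieve (h : IsStack J 𝒳) {S : E} {R : Sieve S} (hR : R ∈ J S)
    {G G' : overBased S ⥤ᵇ 𝒳} (hG : IsCartesianFunctor G) (hG' : IsCartesianFunctor G')
    (γ γ' : G ⟶ G') (e : ∀ (V : Over S), R V.hom → γ.app V = γ'.app V) : γ = γ' := by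
  have := h.restrict S R hR
  let X : CartCat (overBased S) 𝒳 := ⟨G, hG⟩
  let X' : CartCat (overBased S) 𝒳 := ⟨G', hG'⟩
  have key : (ObjectProperty.homMk γ : X ⟶ X') = ObjectProperty.homMk γ' := by
    apply (restrictToSieve 𝒳 R).map_injective
    apply InducedCategory.hom_ext
    apply BasedNatTrans.homCategory.ext
    ext V
    exact e V.1 V.2
  exact congrArg (fun t => InducedCategory.Hom.hom t) key

/-- Essential surjectivity of the restriction to a covering sieve: descent data extend, up to
isomorphism, from a covering sieve of `S` to `E/S`. -/
lemma IsStack.exists_extend_obj (h : IsStack J 𝒳) {S : E} {R : Sieve S} (hR : R ∈ J S)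
    (D : sieveBased R ⥤ᵇ 𝒳) (hD : IsCartesianFunctor D) :
    ∃ G : overBased S ⥤ᵇ 𝒳, IsCartesianFunctor G ∧
      Nonempty (BasedFunctor.comp (sieveInclusion R) G ≅ D) := by
  have := h.restrict S R hR
  let Y : CartCat (sieveBased R) 𝒳 := ⟨D, hD⟩
  let e := (restrictToSieve 𝒳 R).objObjPreimageIso Y
  exact ⟨((restrictToSieve 𝒳 R).objPreimage Y).obj, ((restrictToSieve 𝒳 R).objPreimage Y).property,
    ⟨(ObjectProperty.ι _).mapIso e⟩⟩

/-- The converse of `IsStack.exists_extend_hom`, `IsStack.hom_ext_of_sieve` and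
`IsStack.exists_extend_obj`, for categories fibered in groupoids. -/
lemma IsStack.of_extend (hf : IsFiberedInGroupoids 𝒳)
    (h₁ : ∀ {S : E} {R : Sieve S}, R ∈ J S → ∀ {G G' : overBased S ⥤ᵇ 𝒳}
      (β : BasedFunctor.comp (sieveInclusion R) G ⟶ BasedFunctor.comp (sieveInclusion R) G'),
      ∃ γ : G ⟶ G', ∀ (V : Over S) (hV : R V.hom), γ.app V = β.app (sieveObj V hV))
    (h₂ : ∀ {S : E} {R : Sieve S}, R ∈ J S → ∀ {G G' : overBased S ⥤ᵇ 𝒳} (γ γ' : G ⟶ G'),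
      (∀ (V : Over S), R V.hom → γ.app V = γ'.app V) → γ = γ')
    (h₃ : ∀ {S : E} {R : Sieve S}, R ∈ J S → ∀ (D : sieveBased R ⥤ᵇ 𝒳),
      ∃ G : overBased S ⥤ᵇ 𝒳, Nonempty (BasedFunctor.comp (sieveInclusion R) G ≅ D)) :
    IsStack J 𝒳 where
  fibered := hf.fibered
  restrict S R hR :=
    { faithful := ⟨fun {X Y} γ γ' e => by
        apply InducedCategory.hom_ext
        refine h₂ hR γ.hom γ'.hom fun V hV => ?_
        exact congrArg (fun t : (restrictToSieve 𝒳 R).obj X ⟶ (restrictToSieve 𝒳 R).obj Y =>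
          (InducedCategory.Hom.hom t).app (sieveObj V hV)) e⟩
      full := ⟨fun {X Y} β => by
        obtain ⟨γ, hγ⟩ := h₁ hR (G := X.obj) (G' := Y.obj) ((ObjectProperty.ι _).map β)
        refine ⟨ObjectProperty.homMk γ, ?_⟩
        apply InducedCategory.hom_ext
        apply BasedNatTrans.homCategory.ext
        ext V
        exact hγ V.1 V.2⟩
      essSurj := ⟨fun D => by
        obtain ⟨G, ⟨e⟩⟩ := h₃ hR D.obj
        exact ⟨⟨G, hf.isCartesianFunctor G⟩, ⟨ObjectProperty.isoMk _ e⟩⟩⟩ }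

lemma IsGerbe.isFiberedInGroupoids (h : IsGerbe J 𝒳) : IsFiberedInGroupoids 𝒳 :=
  ⟨h.stack.fibered, h.groupoids⟩

end Stacks

/-! ### Descent of arrows and objects in a stack -/

section Gluing

variable {E : Type u} [Category.{v} E] {J : GrothendieckTopology E}
  {𝒳 : BasedCategory.{v₁, u₁} E}

/-- Lying over an arrow `g` whose target is literally the image of an object: only the source has to
be transported. -/
lemma isHomLift_iff_map_eq {x y : 𝒳.obj} {W : E} {g : W ⟶ 𝒳.p.obj y} {a : x ⟶ y} :
    𝒳.p.IsHomLift g a ↔ ∃ h : 𝒳.p.obj x = W, 𝒳.p.map a = eqToHom h ≫ g := by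
  constructor
  · intro ha
    exact ⟨IsHomLift.domain_eq 𝒳.p g a, by simpa using IsHomLift.fac' 𝒳.p g a⟩
  · rintro ⟨rfl, h⟩
    rw [eqToHom_refl, Category.id_comp] at h
    exact h ▸ inferInstance

lemma isHomLift_of_map_eq {x y z : 𝒳.obj} {W : E} {g : W ⟶ 𝒳.p.obj y} {a : x ⟶ y} {b : x ⟶ z}
    {f : 𝒳.p.obj y ⟶ 𝒳.p.obj z} (ha : 𝒳.p.IsHomLift g a) (h : 𝒳.p.map b = 𝒳.p.map a ≫ f) :
    𝒳.p.IsHomLift (g ≫ f) b := by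
  rw [isHomLift_iff_map_eq] at ha ⊢
  obtain ⟨h₁, h₂⟩ := ha
  exact ⟨h₁, by rw [h, h₂, Category.assoc]⟩

/-- Two arrows of a stack over the same arrow of `E` are equal if they are so locally. -/
theorem IsStack.hom_ext (h : IsStack J 𝒳) (hf : IsFiberedInGroupoids 𝒳) {y y' : 𝒳.obj}
    {φ φ' : y ⟶ y'} (hφ : 𝒳.p.map φ = 𝒳.p.map φ') {R : Sieve (𝒳.p.obj y)}
    (hR : R ∈ J (𝒳.p.obj y))
    (e : ∀ ⦃W : E⦄ (g : W ⟶ 𝒳.p.obj y), R g →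
      ∃ (v : 𝒳.obj) (a : v ⟶ y), 𝒳.p.IsHomLift g a ∧ a ≫ φ = a ≫ φ') : φ = φ' := by
  -- It suffices to treat the case of an endomorphism over the identity.
  obtain ⟨τ, hτ, rfl⟩ := hf.exists_iso (𝒳.p.map φ') φ' inferInstance φ (hφ ▸ inferInstance)
  let G := hf.pullFunctor y rfl
  -- The restrictions of `τ` to the inverse images of `y` form an endomorphism of `E/S ⟶ 𝒳`.
  have key : ∀ V : Over (𝒳.p.obj y), ∃ χ : hf.pullObj y rfl V ⟶ hf.pullObj y rfl V,
      𝒳.p.IsHomLift (𝟙 V.left) χ ∧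
        χ ≫ hf.pullHom y rfl V = hf.pullHom y rfl V ≫ τ.hom := fun V =>
    hf.exists_lift V.hom _ (hf.pullHom_lift y rfl V) (𝟙 _) _ (by
      have := hf.pullHom_lift y rfl V
      rw [Category.id_comp]; infer_instance)
  choose χ hχ hχ' using key
  have nat : ∀ {V W : Over (𝒳.p.obj y)} (k : V ⟶ W),
      hf.pullMap y rfl k ≫ χ W = χ V ≫ hf.pullMap y rfl k := by
    intro V W k
    have := hf.pullMap_lift y rfl k
    have := hχ V
    have := hχ W
    refine hf.cancel (hf.pullHom y rfl W) (g := k.left) inferInstance inferInstance ?_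
    rw [Category.assoc, hχ', Category.assoc, hf.pullMap_comp_pullHom, hχ', ← Category.assoc,
      hf.pullMap_comp_pullHom]
  let γ : G ⟶ G :=
    { app := fun V => χ V
      naturality := fun V W k => nat k
      isHomLift' := fun V => hχ V }
  have hγ : γ = 𝟙 G := by
    refine h.hom_ext_of_sieve hR (hf.isCartesianFunctor G) (hf.isCartesianFunctor G) _ _
      fun V hV => ?_
    obtain ⟨v, a, ha, e'⟩ := e V.hom hV
    rw [← Category.assoc] at e'
    have e'' : a ≫ τ.hom = a := hf.cancel φ' (g := V.hom) inferInstance ha e'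
    obtain ⟨i, hi, hi'⟩ := hf.exists_iso V.hom a ha _ (hf.pullHom_lift y rfl V)
    have := hχ V
    refine hf.cancel (hf.pullHom y rfl V) (g := 𝟙 V.left) (χ := χ V)
      (χ' := 𝟙 (hf.pullObj y rfl V)) (hχ V) (IsHomLift.id (hf.pullObj_base y rfl V)) ?_
    rw [hχ', ← hi', Category.assoc, e'', Category.id_comp]
  -- Evaluate at the terminal object of `E/S`, where the inverse image of `y` is isomorphic to `y`.
  have h1 : χ (Over.mk (𝟙 _)) = 𝟙 _ := congrArg (fun t : G ⟶ G => t.app (Over.mk (𝟙 _))) hγ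
  have h2 := hχ' (Over.mk (𝟙 _))
  have h3 : 𝒳.p.IsHomLift (𝟙 (𝒳.p.obj y)) (hf.pullHom y rfl (Over.mk (𝟙 _))) :=
    hf.pullHom_lift y rfl (Over.mk (𝟙 _))
  have := hf.groupoids _ _ h3
  rw [h1, Category.id_comp] at h2
  have h4 : τ.hom = 𝟙 y := by
    rw [← cancel_epi (hf.pullHom y rfl (Over.mk (𝟙 _))), ← h2, Category.comp_id]
  rw [h4, Category.id_comp]

/-- Descent of arrows: a family `Ψ` of pairs of arrows `(a, b)` with the same source and with
targets `y` and `y'`, in which `b` is determined by `a`, comes from an arrow `y ⟶ y'` if the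
arrows `a` cover `y`. -/
theorem IsStack.exists_glue_hom (h : IsStack J 𝒳) (hf : IsFiberedInGroupoids 𝒳) {y y' : 𝒳.obj}
    (f : 𝒳.p.obj y ⟶ 𝒳.p.obj y') (Ψ : ∀ v : 𝒳.obj, (v ⟶ y) → (v ⟶ y') → Prop)
    (base : ∀ ⦃v : 𝒳.obj⦄ ⦃a : v ⟶ y⦄ ⦃b : v ⟶ y'⦄, Ψ v a b → 𝒳.p.map b = 𝒳.p.map a ≫ f)
    (precomp : ∀ ⦃v : 𝒳.obj⦄ ⦃a : v ⟶ y⦄ ⦃b : v ⟶ y'⦄, Ψ v a b → ∀ ⦃u⦄ (k : u ⟶ v),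
      Ψ u (k ≫ a) (k ≫ b))
    (uniq : ∀ ⦃v : 𝒳.obj⦄ ⦃a : v ⟶ y⦄ ⦃b b' : v ⟶ y'⦄, Ψ v a b → Ψ v a b' → b = b')
    (cov : ∃ R ∈ J (𝒳.p.obj y), ∀ ⦃W : E⦄ (g : W ⟶ 𝒳.p.obj y), R g →
      ∃ (v : 𝒳.obj) (a : v ⟶ y) (b : v ⟶ y'), Ψ v a b ∧ 𝒳.p.IsHomLift g a) :
    ∃ φ : y ⟶ y', 𝒳.p.map φ = f ∧
      ∀ ⦃v : 𝒳.obj⦄ ⦃a : v ⟶ y⦄ ⦃b : v ⟶ y'⦄, Ψ v a b → a ≫ φ = b := by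
  obtain ⟨R₀, hR₀, hc⟩ := cov
  let R : Sieve (𝒳.p.obj y) :=
    { arrows := fun W g => ∃ (v : 𝒳.obj) (a : v ⟶ y) (b : v ⟶ y'), Ψ v a b ∧ 𝒳.p.IsHomLift g a
      downward_closed := by
        rintro W W' g ⟨v, a, b, hab, ha⟩ k
        obtain ⟨v', m, hm⟩ := hf.exists_pull v (IsHomLift.domain_eq 𝒳.p g a) k
        exact ⟨v', _, _, precomp hab m, inferInstance⟩ }
  have hR : R ∈ J (𝒳.p.obj y) := J.superset_covering hc hR₀
  -- Replace `y'` by its inverse image along `f`, so that only vertical arrows have to be glued.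
  obtain ⟨y'', m, hm⟩ := hf.exists_pull y' rfl f
  have hy'' : 𝒳.p.obj y'' = 𝒳.p.obj y := IsHomLift.domain_eq 𝒳.p f m
  let G := hf.pullFunctor y rfl
  let G' := hf.pullFunctor y'' hy''
  have key : ∀ V : Over (𝒳.p.obj y), R V.hom →
      ∃ χ : hf.pullObj y rfl V ⟶ hf.pullObj y'' hy'' V, 𝒳.p.IsHomLift (𝟙 V.left) χ ∧
        Ψ _ (hf.pullHom y rfl V) (χ ≫ hf.pullHom y'' hy'' V ≫ m) := by
    rintro V ⟨v, a, b, hab, ha⟩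
    obtain ⟨i, hi, hi'⟩ := hf.exists_iso V.hom a ha _ (hf.pullHom_lift y rfl V)
    have hab' := precomp hab i.hom
    rw [hi'] at hab'
    have := hf.pullHom_lift y'' hy'' V
    obtain ⟨χ, h₁, h₂⟩ := hf.exists_lift (V.hom ≫ f) (hf.pullHom y'' hy'' V ≫ m) inferInstance
      (𝟙 V.left) (i.hom ≫ b) (by
        rw [Category.id_comp]
        exact isHomLift_of_map_eq (hf.pullHom_lift y rfl V) (base hab'))
    exact ⟨χ, h₁, by rw [h₂]; exact hab'⟩
  choose χ hχ hχ' using key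
  have nat : ∀ {V W : Over (𝒳.p.obj y)} (hV : R V.hom) (hW : R W.hom) (k : V ⟶ W),
      hf.pullMap y rfl k ≫ χ W hW = χ V hV ≫ hf.pullMap y'' hy'' k := by
    intro V W hV hW k
    have := hf.pullMap_lift y rfl k
    have := hf.pullMap_lift y'' hy'' k
    have := hχ V hV
    have := hχ W hW
    refine hf.cancel (hf.pullHom y'' hy'' W ≫ m) (g := k.left) inferInstance inferInstance ?_
    have h₁ := precomp (hχ' W hW) (hf.pullMap y rfl k)
    rw [← Category.assoc, hf.pullMap_comp_pullHom] at h₁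
    rw [uniq h₁ (hχ' V hV), Category.assoc,
      ← Category.assoc (hf.pullMap y'' hy'' k), hf.pullMap_comp_pullHom]
  let β : BasedFunctor.comp (sieveInclusion R) G ⟶ BasedFunctor.comp (sieveInclusion R) G' :=
    { app := fun V => χ V.1 V.2
      naturality := fun V W k => nat V.2 W.2 k.hom
      isHomLift' := fun V => hχ V.1 V.2 }
  obtain ⟨γ, hγ⟩ := h.exists_extend_hom hR (hf.isCartesianFunctor G) (hf.isCartesianFunctor G') β
  -- The glued arrow is the component of `γ` at the terminal object of `E/S`.
  let V₁ : Over (𝒳.p.obj y) := Over.mk (𝟙 _)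
  have h₁ : 𝒳.p.IsHomLift (𝟙 (𝒳.p.obj y)) (hf.pullHom y rfl V₁) := hf.pullHom_lift y rfl V₁
  have h₂ : 𝒳.p.IsHomLift (𝟙 (𝒳.p.obj y)) (hf.pullHom y'' hy'' V₁) :=
    hf.pullHom_lift y'' hy'' V₁
  have h₃ : 𝒳.p.IsHomLift (𝟙 (𝒳.p.obj y)) (γ.app V₁) := γ.isHomLift' V₁
  have := hf.groupoids _ _ h₁
  let γ₁ : hf.pullObj y rfl V₁ ⟶ hf.pullObj y'' hy'' V₁ := γ.app V₁
  have h₃' : 𝒳.p.IsHomLift (𝟙 (𝒳.p.obj y)) γ₁ := h₃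
  let φ : y ⟶ y' := inv (hf.pullHom y rfl V₁) ≫ γ₁ ≫ hf.pullHom y'' hy'' V₁ ≫ m
  have hφ : 𝒳.p.IsHomLift f φ := inferInstance
  refine ⟨φ, (IsHomLift.eq_of_isHomLift _ _ _).symm, fun v a b hab => ?_⟩
  let V : Over (𝒳.p.obj y) := Over.mk (𝒳.p.map a)
  have hV : R V.hom := ⟨v, a, b, hab, inferInstanceAs (𝒳.p.IsHomLift (𝒳.p.map a) a)⟩
  obtain ⟨i, hi, hi'⟩ := hf.exists_iso V.hom _ (hf.pullHom_lift y rfl V) a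
    (inferInstanceAs (𝒳.p.IsHomLift (𝒳.p.map a) a))
  let k : V ⟶ V₁ := Over.homMk V.hom
  have e₁ : hf.pullMap y rfl k ≫ γ₁ = χ V hV ≫ hf.pullMap y'' hy'' k :=
    (γ.naturality (X := V) (Y := V₁) k).trans (congrArg (fun t => t ≫ G'.map k) (hγ V hV))
  have e₂ : hf.pullHom y rfl V ≫ φ = χ V hV ≫ hf.pullHom y'' hy'' V ≫ m := by
    rw [← hf.pullMap_comp_pullHom y rfl k, Category.assoc, IsIso.hom_inv_id_assoc,
      ← Category.assoc, e₁, Category.assoc, ← Category.assoc (hf.pullMap _ _ _),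
      hf.pullMap_comp_pullHom]
  rw [← hi', Category.assoc, e₂]
  have e₃ := precomp (hχ' V hV) i.hom
  rw [hi'] at e₃
  exact uniq e₃ hab

/-- A form of `IsStack.hom_ext` in which the arrow of `E` is given separately. -/
theorem IsStack.hom_ext' (h : IsStack J 𝒳) (hf : IsFiberedInGroupoids 𝒳) {S S' : E} (f : S ⟶ S')
    {y y' : 𝒳.obj} {φ φ' : y ⟶ y'} (hφ : 𝒳.p.IsHomLift f φ) (hφ' : 𝒳.p.IsHomLift f φ')
    {R : Sieve S} (hR : R ∈ J S)
    (e : ∀ ⦃W : E⦄ (g : W ⟶ S), R g →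
      ∃ (v : 𝒳.obj) (a : v ⟶ y), 𝒳.p.IsHomLift g a ∧ a ≫ φ = a ≫ φ') : φ = φ' := by
  obtain ⟨⟩ := hφ
  exact h.hom_ext hf (IsHomLift.eq_of_isHomLift _ _ _) hR e

/-- A form of `IsStack.exists_glue_hom` in which the arrow of `E` is given separately. -/
theorem IsStack.exists_glue_hom' (h : IsStack J 𝒳) (hf : IsFiberedInGroupoids 𝒳) {S S' : E}
    (f : S ⟶ S') {y y' : 𝒳.obj} (hy : 𝒳.p.obj y = S) (hy' : 𝒳.p.obj y' = S')
    (Ψ : ∀ v : 𝒳.obj, (v ⟶ y) → (v ⟶ y') → Prop)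
    (base : ∀ ⦃v : 𝒳.obj⦄ ⦃a : v ⟶ y⦄ ⦃b : v ⟶ y'⦄, Ψ v a b →
      ∃ g : 𝒳.p.obj v ⟶ S, 𝒳.p.IsHomLift g a ∧ 𝒳.p.IsHomLift (g ≫ f) b)
    (precomp : ∀ ⦃v : 𝒳.obj⦄ ⦃a : v ⟶ y⦄ ⦃b : v ⟶ y'⦄, Ψ v a b → ∀ ⦃u⦄ (k : u ⟶ v),
      Ψ u (k ≫ a) (k ≫ b))
    (uniq : ∀ ⦃v : 𝒳.obj⦄ ⦃a : v ⟶ y⦄ ⦃b b' : v ⟶ y'⦄, Ψ v a b → Ψ v a b' → b = b')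
    (cov : ∃ R ∈ J S, ∀ ⦃W : E⦄ (g : W ⟶ S), R g →
      ∃ (v : 𝒳.obj) (a : v ⟶ y) (b : v ⟶ y'), Ψ v a b ∧ 𝒳.p.IsHomLift g a) :
    ∃ φ : y ⟶ y', 𝒳.p.IsHomLift f φ ∧
      ∀ ⦃v : 𝒳.obj⦄ ⦃a : v ⟶ y⦄ ⦃b : v ⟶ y'⦄, Ψ v a b → a ≫ φ = b := by
  subst hy hy'
  obtain ⟨φ, h₁, h₂⟩ := h.exists_glue_hom hf f Ψ (fun v a b hab => by
    obtain ⟨g, h₁, h₂⟩ := base hab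
    rw [← IsHomLift.eq_of_isHomLift _ (g ≫ f) b, ← IsHomLift.eq_of_isHomLift _ g a])
    precomp uniq cov
  exact ⟨φ, h₁ ▸ inferInstance, h₂⟩

/-- Descent of objects along a covering sieve: the object is the value at the terminal object of
`E/S` of an extension of the descent datum. -/
theorem IsStack.exists_glue_obj (h : IsStack J 𝒳) (hf : IsFiberedInGroupoids 𝒳) {S : E}
    {R : Sieve S} (hR : R ∈ J S) (D : sieveBased R ⥤ᵇ 𝒳) :
    ∃ (y : 𝒳.obj) (τ : ∀ (V : Over S) (hV : R V.hom), D.obj (sieveObj V hV) ⟶ y),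
      𝒳.p.obj y = S ∧ (∀ V hV, 𝒳.p.IsHomLift V.hom (τ V hV)) ∧
        ∀ V W hV hW (k : V ⟶ W), D.map (sieveHom hV hW k) ≫ τ W hW = τ V hV := by
  obtain ⟨G, -, ⟨e⟩⟩ := h.exists_extend_obj hR D (hf.isCartesianFunctor D)
  let V₁ : Over S := Over.mk (𝟙 S)
  let q (V : Over S) : V ⟶ V₁ := Over.homMk V.hom
  have hq : ∀ V : Over S, 𝒳.p.IsHomLift V.hom (G.map (q V)) := fun V => by
    have h' : (overBased S).p.IsHomLift V.hom (q V) :=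
      Functor.IsHomLift.map (p := (overBased S).p) (q V)
    exact BasedFunctor.preserves_isHomLift G _ _
  obtain ⟨ι, he, hn⟩ : ∃ ι : ∀ (V : Over S) (hV : R V.hom), D.obj (sieveObj V hV) ⟶ G.obj V,
      (∀ V hV, 𝒳.p.IsHomLift (𝟙 V.left) (ι V hV)) ∧
        ∀ (V W : Over S) (hV : R V.hom) (hW : R W.hom) (k : V ⟶ W),
          D.map (sieveHom hV hW k) ≫ ι W hW = ι V hV ≫ G.map k :=
    ⟨fun V hV => e.inv.app (sieveObj V hV), fun V hV => e.inv.isHomLift' (sieveObj V hV),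
      fun V W hV hW k => e.inv.naturality (sieveHom hV hW k)⟩
  have hc : ∀ (V W : Over S) (k : V ⟶ W), G.map k ≫ G.map (q W) = G.map (q V) := fun V W k =>
    (G.map_comp k (q W)).symm.trans (congrArg G.map (Over.OverMorphism.ext (Over.w k)))
  refine ⟨G.obj V₁, fun V hV => ι V hV ≫ G.map (q V), G.w_obj V₁,
    fun V hV => ?_, fun V W hV hW k => ?_⟩
  · have := he V hV
    have := hq V
    exact IsHomLift.comp_lift_id_left 𝒳.p V.hom (G.map (q V)) (ι V hV)
  · refine (Category.assoc _ _ _).symm.trans ?_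
    refine (congrArg (fun t => t ≫ G.map (q W)) (hn V W hV hW k)).trans ?_
    exact (Category.assoc _ _ _).trans (congrArg _ (hc V W k))

end Gluing

/-! ### Atlases of a stack, and the section given by a rigid atlas -/

section Atlas

variable {E : Type u} [Category.{v} E] {J : GrothendieckTopology E}
  {𝒳 : BasedCategory.{v₁, u₁} E}

variable (J 𝒳) in
/-- A subgerbe of `𝒳`, neither full nor stable under isomorphisms and without descent conditions: a
family of objects of `𝒳` and sets of distinguished arrows between them, such that restrictions exist
and such that the objects exist locally and are locally connected by distinguished arrows. The
image of a gerbe under a functor is of this kind. -/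
structure Atlas where
  ι : Type t
  obj : ι → 𝒳.obj
  hom : ∀ i j, Set (obj i ⟶ obj j)
  comp : ∀ {i j k} {m : obj i ⟶ obj j} {n : obj j ⟶ obj k}, m ∈ hom i j → n ∈ hom j k →
    m ≫ n ∈ hom i k
  restrict : ∀ (i) {S T : E}, 𝒳.p.obj (obj i) = S → ∀ g : T ⟶ S,
    ∃ k, ∃ m ∈ hom k i, 𝒳.p.IsHomLift g m
  cover : ∀ S : E, ∃ R ∈ J S, ∀ ⦃V : E⦄ (f : V ⟶ S), R f → ∃ i, 𝒳.p.obj (obj i) = V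
  connect : ∀ (S : E) (i j), 𝒳.p.obj (obj i) = S → 𝒳.p.obj (obj j) = S →
    ∃ R ∈ J S, ∀ ⦃T : E⦄ (g : T ⟶ S), R g →
      ∃ k, ∃ m ∈ hom k i, ∃ n ∈ hom k j, 𝒳.p.IsHomLift g m ∧ 𝒳.p.IsHomLift g n

namespace Atlas

variable (𝒜 : Atlas J 𝒳)

/-- An atlas is rigid when there is at most one distinguished arrow over each arrow of `E`. -/
def IsRigid : Prop := ∀ ⦃i j⦄ ⦃m n : 𝒜.obj i ⟶ 𝒜.obj j⦄, m ∈ 𝒜.hom i j → n ∈ 𝒜.hom i j →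
  𝒳.p.map m = 𝒳.p.map n → m = n

/-- The base of an object of an atlas. -/
abbrev base (i : 𝒜.ι) : E := 𝒳.p.obj (𝒜.obj i)

/-- Any two objects of an atlas over the source and the target of an arrow `f` are locally connected
by a distinguished arrow over `f`. -/
lemma exists_span {i j : 𝒜.ι} (f : 𝒜.base i ⟶ 𝒜.base j) :
    ∃ R ∈ J (𝒜.base i), ∀ ⦃T : E⦄ (g : T ⟶ 𝒜.base i), R g →
      ∃ k, ∃ m ∈ 𝒜.hom k i, ∃ n ∈ 𝒜.hom k j, 𝒳.p.IsHomLift g m ∧ 𝒳.p.IsHomLift (g ≫ f) n := by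
  obtain ⟨j', m', hm', h'⟩ := 𝒜.restrict j rfl f
  obtain ⟨R, hR, h⟩ := 𝒜.connect _ i j' rfl (IsHomLift.domain_eq 𝒳.p f m')
  refine ⟨R, hR, fun T g hg => ?_⟩
  obtain ⟨k, m, hm, n, hn, h₁, h₂⟩ := h g hg
  exact ⟨k, m, hm, n ≫ m', 𝒜.comp hn hm', h₁, inferInstance⟩

variable (h𝒳 : IsStack J 𝒳) (hf : IsFiberedInGroupoids 𝒳) (h𝒜 : 𝒜.IsRigid)

include h𝒳 hf in
/-- Two arrows from an object of an atlas are equal if their composites agree with all distinguished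
arrows which extend to a span over a given arrow `q`. -/
lemma hom_ext {i : 𝒜.ι} {y : 𝒳.obj} {S : E} (f : 𝒜.base i ⟶ S) {φ φ' : 𝒜.obj i ⟶ y}
    (hφ : 𝒳.p.IsHomLift f φ) (hφ' : 𝒳.p.IsHomLift f φ') (j : 𝒜.ι) (q : 𝒜.base i ⟶ 𝒜.base j)
    (e : ∀ ⦃k⦄ ⦃m⦄, m ∈ 𝒜.hom k i → ∀ ⦃n⦄, n ∈ 𝒜.hom k j → 𝒳.p.map n = 𝒳.p.map m ≫ q →
      m ≫ φ = m ≫ φ') : φ = φ' := by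
  obtain ⟨R, hR, h⟩ := 𝒜.exists_span q
  refine h𝒳.hom_ext' hf f hφ hφ' hR fun W g hg => ?_
  obtain ⟨k, m, hm, n, hn, h₁, h₂⟩ := h g hg
  refine ⟨_, m, h₁, e hm hn ?_⟩
  rw [isHomLift_iff_map_eq] at h₁ h₂
  obtain ⟨_, e₁⟩ := h₁
  obtain ⟨_, e₂⟩ := h₂
  rw [e₁, e₂, Category.assoc]

include h𝒳 hf h𝒜 in
/-- In a rigid atlas, there is a canonical arrow between objects over each arrow of `E`. -/
lemma exists_transition (i j : 𝒜.ι) (f : 𝒜.base i ⟶ 𝒜.base j) :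
    ∃ φ : 𝒜.obj i ⟶ 𝒜.obj j, 𝒳.p.map φ = f ∧
      ∀ ⦃k⦄ ⦃m⦄, m ∈ 𝒜.hom k i → ∀ ⦃n⦄, n ∈ 𝒜.hom k j → 𝒳.p.map n = 𝒳.p.map m ≫ f →
        m ≫ φ = n := by
  -- Glue along the spans `i ← k → j` of distinguished arrows, precomposed with arbitrary arrows.
  refine Exists.imp (fun φ h => ⟨h.1, fun k m hm n hn e =>
      h.2 ⟨k, 𝟙 _, m, n, hm, hn, e, by simp, by simp⟩⟩) (h𝒳.exists_glue_hom hf f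
    (fun v a b => ∃ (k : 𝒜.ι) (c : v ⟶ 𝒜.obj k) (m : 𝒜.obj k ⟶ 𝒜.obj i)
      (n : 𝒜.obj k ⟶ 𝒜.obj j), m ∈ 𝒜.hom k i ∧ n ∈ 𝒜.hom k j ∧ 𝒳.p.map n = 𝒳.p.map m ≫ f ∧
        a = c ≫ m ∧ b = c ≫ n) ?_ ?_ ?_ ?_)
  · rintro v a b ⟨k, c, m, n, -, -, e, rfl, rfl⟩
    rw [Functor.map_comp, e, Functor.map_comp, Category.assoc]
  · rintro v a b ⟨k, c, m, n, hm, hn, e, rfl, rfl⟩ u l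
    exact ⟨k, l ≫ c, m, n, hm, hn, e, by simp, by simp⟩
  · rintro v a b b' ⟨k, c, m, n, hm, hn, e, rfl, rfl⟩ ⟨k', c', m', n', hm', hn', e', h, rfl⟩
    have hb : 𝒳.p.map (c ≫ n) = 𝒳.p.map (c' ≫ n') := by
      rw [Functor.map_comp, Functor.map_comp, e, e', ← Category.assoc, ← Category.assoc,
        ← Functor.map_comp, ← Functor.map_comp, h]
    obtain ⟨k₁, m₁, hm₁, hl₁⟩ := 𝒜.restrict k rfl (𝒳.p.map c)
    obtain ⟨k₁', m₁', hm₁', hl₁'⟩ := 𝒜.restrict k' rfl (𝒳.p.map c')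
    obtain ⟨ε, hε, hc⟩ := hf.exists_iso (𝒳.p.map c) c inferInstance m₁ hl₁
    obtain ⟨ε', hε', hc'⟩ := hf.exists_iso (𝒳.p.map c') c' inferInstance m₁' hl₁'
    obtain ⟨R, hR, hs⟩ := 𝒜.connect _ k₁ k₁' (IsHomLift.domain_eq 𝒳.p (𝒳.p.map c) m₁)
      (IsHomLift.domain_eq 𝒳.p (𝒳.p.map c') m₁')
    refine h𝒳.hom_ext hf hb hR fun W g hg => ?_
    obtain ⟨k₂, r, hr, r', hr', hg₁, hg₂⟩ := hs g hg
    have hrε : 𝒳.p.IsHomLift g (r ≫ ε.hom) := inferInstance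
    have hrε' : 𝒳.p.IsHomLift g (r' ≫ ε'.hom) := inferInstance
    obtain ⟨d₁, h₁⟩ := isHomLift_iff_map_eq.1 hrε
    obtain ⟨d₂, h₂⟩ := isHomLift_iff_map_eq.1 hrε'
    -- Both composites from the common refinement to `i`, resp. to `j`, are distinguished.
    have E₁ : r ≫ m₁ ≫ m = r' ≫ m₁' ≫ m' := by
      refine h𝒜 (𝒜.comp hr (𝒜.comp hm₁ hm)) (𝒜.comp hr' (𝒜.comp hm₁' hm')) ?_
      rw [← hc, ← hc', Category.assoc, Category.assoc, ← h, ← Category.assoc, ← Category.assoc r',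
        Functor.map_comp, Functor.map_comp _ (r' ≫ _), h₁, h₂]
    have E₂ : r ≫ m₁ ≫ n = r' ≫ m₁' ≫ n' := by
      refine h𝒜 (𝒜.comp hr (𝒜.comp hm₁ hn)) (𝒜.comp hr' (𝒜.comp hm₁' hn')) ?_
      rw [← hc, ← hc', Category.assoc, Category.assoc, ← Category.assoc, ← Category.assoc r',
        Functor.map_comp, Functor.map_comp _ (r' ≫ _), h₁, h₂, hb]
    have E₃ : r ≫ ε.hom = r' ≫ ε'.hom := by
      refine hf.cancel (c ≫ m) hrε hrε' ?_
      conv_rhs => rw [h]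
      rw [Category.assoc, Category.assoc, ← Category.assoc ε.hom, ← Category.assoc ε'.hom, hc, hc',
        E₁]
    refine ⟨_, r ≫ ε.hom, hrε, ?_⟩
    conv_rhs => rw [E₃]
    rw [Category.assoc, Category.assoc, ← Category.assoc ε.hom, ← Category.assoc ε'.hom, hc, hc',
      E₂]
  · obtain ⟨R, hR, hs⟩ := 𝒜.exists_span f
    refine ⟨R, hR, fun W g hg => ?_⟩
    obtain ⟨k, m, hm, n, hn, h₁, h₂⟩ := hs g hg
    refine ⟨_, m, n, ⟨k, 𝟙 _, m, n, hm, hn, ?_, by simp, by simp⟩, h₁⟩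
    obtain ⟨_, e₁⟩ := isHomLift_iff_map_eq.1 h₁
    obtain ⟨_, e₂⟩ := isHomLift_iff_map_eq.1 h₂
    rw [e₁, e₂, Category.assoc]

/-- The canonical arrow between two objects of a rigid atlas over an arrow of `E`. -/
noncomputable def transition {i j : 𝒜.ι} (f : 𝒜.base i ⟶ 𝒜.base j) : 𝒜.obj i ⟶ 𝒜.obj j :=
  (𝒜.exists_transition h𝒳 hf h𝒜 i j f).choose

@[simp]
lemma map_transition {i j : 𝒜.ι} (f : 𝒜.base i ⟶ 𝒜.base j) :
    𝒳.p.map (𝒜.transition h𝒳 hf h𝒜 f) = f :=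
  (𝒜.exists_transition h𝒳 hf h𝒜 i j f).choose_spec.1

lemma transition_lift {i j : 𝒜.ι} (f : 𝒜.base i ⟶ 𝒜.base j) :
    𝒳.p.IsHomLift f (𝒜.transition h𝒳 hf h𝒜 f) :=
  isHomLift_iff_map_eq.2 ⟨rfl, by simp⟩

lemma comp_transition {i j k : 𝒜.ι} (f : 𝒜.base i ⟶ 𝒜.base j) {m : 𝒜.obj k ⟶ 𝒜.obj i}
    (hm : m ∈ 𝒜.hom k i) {n : 𝒜.obj k ⟶ 𝒜.obj j} (hn : n ∈ 𝒜.hom k j)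
    (e : 𝒳.p.map n = 𝒳.p.map m ≫ f) : m ≫ 𝒜.transition h𝒳 hf h𝒜 f = n :=
  (𝒜.exists_transition h𝒳 hf h𝒜 i j f).choose_spec.2 hm hn e

/-- The canonical arrow is characterized by its composites with distinguished arrows. -/
lemma transition_unique {i j : 𝒜.ι} (f : 𝒜.base i ⟶ 𝒜.base j) {φ : 𝒜.obj i ⟶ 𝒜.obj j}
    (hφ : 𝒳.p.map φ = f)
    (h : ∀ ⦃k⦄ ⦃m⦄, m ∈ 𝒜.hom k i → ∀ ⦃n⦄, n ∈ 𝒜.hom k j → 𝒳.p.map n = 𝒳.p.map m ≫ f →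
      m ≫ φ = n) : φ = 𝒜.transition h𝒳 hf h𝒜 f :=
  𝒜.hom_ext h𝒳 hf f (isHomLift_iff_map_eq.2 ⟨rfl, by simp [hφ]⟩)
    (𝒜.transition_lift h𝒳 hf h𝒜 f) j f fun k m hm n hn e => by
      rw [h hm hn e, 𝒜.comp_transition h𝒳 hf h𝒜 f hm hn e]

lemma comp_transition' {i j k : 𝒜.ι} (f : 𝒜.base i ⟶ 𝒜.base j) {m : 𝒜.obj k ⟶ 𝒜.obj i}
    (hm : m ∈ 𝒜.hom k i) :
    m ≫ 𝒜.transition h𝒳 hf h𝒜 f = 𝒜.transition h𝒳 hf h𝒜 (𝒳.p.map m ≫ f) := by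
  refine 𝒜.transition_unique h𝒳 hf h𝒜 _ (by simp) fun l n hn q hq e => ?_
  rw [← Category.assoc]
  exact 𝒜.comp_transition h𝒳 hf h𝒜 f (𝒜.comp hn hm) hq (by simp [e])

/-- An object over `S`, with compatible arrows to it from all objects of the atlas over arrows to
`S`. -/
structure Cocone (S : E) where
  pt : 𝒳.obj
  pt_base : 𝒳.p.obj pt = S
  arrow : ∀ (i : 𝒜.ι) (_ : 𝒜.base i ⟶ S), 𝒜.obj i ⟶ pt
  arrow_lift : ∀ (i : 𝒜.ι) (f : 𝒜.base i ⟶ S), 𝒳.p.IsHomLift f (arrow i f)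
  comp_arrow : ∀ {i j : 𝒜.ι} {m : 𝒜.obj i ⟶ 𝒜.obj j}, m ∈ 𝒜.hom i j → ∀ (f : 𝒜.base j ⟶ S),
    m ≫ arrow j f = arrow i (𝒳.p.map m ≫ f)

lemma transition_comp_arrow {S : E} (C : 𝒜.Cocone S) {i j : 𝒜.ι} (f : 𝒜.base i ⟶ 𝒜.base j)
    (g : 𝒜.base j ⟶ S) : 𝒜.transition h𝒳 hf h𝒜 f ≫ C.arrow j g = C.arrow i (f ≫ g) := by
  have h₁ := C.arrow_lift j g
  have h₂ := 𝒜.transition_lift h𝒳 hf h𝒜 f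
  refine 𝒜.hom_ext h𝒳 hf (f ≫ g) inferInstance (C.arrow_lift i _) j f fun k m hm n hn e => ?_
  rw [← Category.assoc, 𝒜.comp_transition h𝒳 hf h𝒜 f hm hn e, C.comp_arrow hn, C.comp_arrow hm, e,
    Category.assoc]

/-- The objects of a rigid atlas themselves carry a cocone, consisting of the canonical arrows. -/
noncomputable def coconeSelf (j : 𝒜.ι) : 𝒜.Cocone (𝒜.base j) where
  pt := 𝒜.obj j
  pt_base := rfl
  arrow _ f := 𝒜.transition h𝒳 hf h𝒜 f
  arrow_lift _ f := 𝒜.transition_lift h𝒳 hf h𝒜 f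
  comp_arrow hm f := 𝒜.comp_transition' h𝒳 hf h𝒜 f hm

lemma transition_comp_transition {i j k : 𝒜.ι} (f : 𝒜.base i ⟶ 𝒜.base j)
    (g : 𝒜.base j ⟶ 𝒜.base k) :
    𝒜.transition h𝒳 hf h𝒜 f ≫ 𝒜.transition h𝒳 hf h𝒜 g = 𝒜.transition h𝒳 hf h𝒜 (f ≫ g) :=
  𝒜.transition_comp_arrow h𝒳 hf h𝒜 (𝒜.coconeSelf h𝒳 hf h𝒜 k) f g

lemma transition_id (i : 𝒜.ι) : 𝒜.transition h𝒳 hf h𝒜 (𝟙 (𝒜.base i)) = 𝟙 _ :=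
  (𝒜.transition_unique h𝒳 hf h𝒜 _ (by simp) fun k m hm n hn e => by
    rw [Category.comp_id]
    exact h𝒜 hm hn (by simpa using e.symm)).symm

include h𝒳 hf in
/-- The arrows of a cocone are jointly epimorphic, because they cover its vertex. -/
lemma Cocone.hom_ext {S S' : E} (C : 𝒜.Cocone S) {f : S ⟶ S'} {y : 𝒳.obj} {φ φ' : C.pt ⟶ y}
    (hφ : 𝒳.p.IsHomLift f φ) (hφ' : 𝒳.p.IsHomLift f φ')
    (h : ∀ i (g : 𝒜.base i ⟶ S), C.arrow i g ≫ φ = C.arrow i g ≫ φ') : φ = φ' := by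
  obtain ⟨R, hR, hc⟩ := 𝒜.cover S
  refine h𝒳.hom_ext' hf f hφ hφ' hR fun W g hg => ?_
  obtain ⟨i, rfl⟩ := hc g hg
  exact ⟨_, _, C.arrow_lift i g, h i g⟩

include h𝒳 hf h𝒜 in
/-- Cocones over the source and the target of an arrow of `E` are connected by an arrow over it,
unique by `Cocone.hom_ext`. -/
lemma Cocone.exists_hom {S S' : E} (C : 𝒜.Cocone S) (C' : 𝒜.Cocone S') (f : S ⟶ S') :
    ∃ φ : C.pt ⟶ C'.pt, 𝒳.p.IsHomLift f φ ∧
      ∀ i (g : 𝒜.base i ⟶ S), C.arrow i g ≫ φ = C'.arrow i (g ≫ f) := by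
  refine Exists.imp (fun φ h => ⟨h.1, fun i g => h.2 ⟨i, Iso.refl _, g, by simp, by simp⟩⟩)
    (h𝒳.exists_glue_hom' hf f C.pt_base C'.pt_base (fun v a b =>
      ∃ (i : 𝒜.ι) (c : v ≅ 𝒜.obj i) (g : 𝒜.base i ⟶ S),
        a = c.hom ≫ C.arrow i g ∧ b = c.hom ≫ C'.arrow i (g ≫ f)) ?_ ?_ ?_ ?_)
  · rintro v a b ⟨i, c, g, rfl, rfl⟩
    have := C.arrow_lift i g
    have := C'.arrow_lift i (g ≫ f)
    refine ⟨𝒳.p.map c.hom ≫ g, inferInstance, ?_⟩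
    rw [Category.assoc]
    infer_instance
  · rintro v a b ⟨i, c, g, rfl, rfl⟩ u k
    obtain ⟨i', m, hm, hl⟩ := 𝒜.restrict i rfl (𝒳.p.map (k ≫ c.hom))
    obtain ⟨ε, hε, e⟩ := hf.exists_iso (𝒳.p.map (k ≫ c.hom)) m hl (k ≫ c.hom) inferInstance
    refine ⟨i', ε, 𝒳.p.map m ≫ g, ?_, ?_⟩
    · rw [← C.comp_arrow hm, ← Category.assoc, ← Category.assoc, e]
    · rw [Category.assoc, ← C'.comp_arrow hm, ← Category.assoc, ← Category.assoc, e]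
  · rintro v a b b' ⟨i, c, g, rfl, rfl⟩ ⟨i', c', g', h, rfl⟩
    -- The two trivializations of `v` differ by a canonical arrow.
    have h₁ := C.arrow_lift i g
    have h₂ := C.arrow_lift i' g'
    have hb : 𝒳.p.map c.hom ≫ g = 𝒳.p.map c'.hom ≫ g' := by
      have e₁ : 𝒳.p.IsHomLift (𝒳.p.map c.hom ≫ g) (c.hom ≫ C.arrow i g) := inferInstance
      have e₂ : 𝒳.p.IsHomLift (𝒳.p.map c'.hom ≫ g') (c.hom ≫ C.arrow i g) :=
        h ▸ inferInstance
      have := IsHomLift.fac 𝒳.p (𝒳.p.map c.hom ≫ g) (c.hom ≫ C.arrow i g)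
      rw [this, ← IsHomLift.fac 𝒳.p (𝒳.p.map c'.hom ≫ g') (c.hom ≫ C.arrow i g)]
    have hb' : 𝒳.p.map (c.inv ≫ c'.hom) ≫ g' = g := by
      rw [Functor.map_comp, Category.assoc, ← hb, ← Category.assoc, ← Functor.map_comp,
        c.inv_hom_id, CategoryTheory.Functor.map_id, Category.id_comp]
    have key : c.inv ≫ c'.hom = 𝒜.transition h𝒳 hf h𝒜 (𝒳.p.map (c.inv ≫ c'.hom)) := by
      refine hf.cancel' (C.arrow i' g') (by simp) ?_
      rw [𝒜.transition_comp_arrow, hb', Category.assoc, ← h, c.inv_hom_id_assoc]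
    have key' : c'.hom = c.hom ≫ 𝒜.transition h𝒳 hf h𝒜 (𝒳.p.map (c.inv ≫ c'.hom)) := by
      rw [← key, c.hom_inv_id_assoc]
    conv_rhs => rw [key']
    rw [Category.assoc, 𝒜.transition_comp_arrow, ← Category.assoc _ g', hb']
  · obtain ⟨R, hR, hc⟩ := 𝒜.cover S
    refine ⟨R, hR, fun W g hg => ?_⟩
    obtain ⟨i, rfl⟩ := hc g hg
    exact ⟨_, _, _, ⟨i, Iso.refl _, g, rfl, rfl⟩, by
      simpa using C.arrow_lift i g⟩

include h𝒳 hf h𝒜 in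
/-- Descent: for a rigid atlas there are cocones over all objects of `E`. -/
lemma exists_cocone (S : E) : Nonempty (𝒜.Cocone S) := by
  obtain ⟨R₀, hR₀, hc⟩ := 𝒜.cover S
  let R : Sieve S :=
    { arrows := fun V _ => ∃ i, 𝒜.base i = V
      downward_closed := by
        rintro V W _ ⟨i, hi⟩ g
        obtain ⟨k, m, -, hm⟩ := 𝒜.restrict i hi g
        exact ⟨k, IsHomLift.domain_eq 𝒳.p g m⟩ }
  have hR : R ∈ J S := J.superset_covering (fun V f hf' => hc f hf') hR₀
  have key : ∀ V : Over S, R V.hom → ∃ i, 𝒜.base i = V.left := fun V hV => hV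
  choose o ho using key
  -- `b` is `k`, transported to the bases of the chosen objects, which are equal to `V` and `W` only
  -- propositionally. The canonical arrows over the `b` form a descent datum.
  let b {V W : Over S} (hV : R V.hom) (hW : R W.hom) (k : V ⟶ W) :
    𝒜.base (o V hV) ⟶ 𝒜.base (o W hW) := eqToHom (ho V hV) ≫ k.left ≫ eqToHom (ho W hW).symm
  let D : sieveBased R ⥤ᵇ 𝒳 :=
    { obj := fun V => 𝒜.obj (o V.1 V.2)
      map := fun {V W} k => 𝒜.transition h𝒳 hf h𝒜 (b V.2 W.2 k.hom)
      map_id := fun V => (congrArg (fun t => 𝒜.transition h𝒳 hf h𝒜 t) (by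
        change eqToHom (ho V.1 V.2) ≫ 𝟙 _ ≫ eqToHom (ho V.1 V.2).symm = 𝟙 _
        simp)).trans (𝒜.transition_id h𝒳 hf h𝒜 _)
      map_comp := fun {U V W} k l => (congrArg (fun t => 𝒜.transition h𝒳 hf h𝒜 t) (by
        change eqToHom (ho U.1 U.2) ≫ (k.hom.left ≫ l.hom.left) ≫ eqToHom (ho W.1 W.2).symm =
          (eqToHom (ho U.1 U.2) ≫ k.hom.left ≫ eqToHom (ho V.1 V.2).symm) ≫
            eqToHom (ho V.1 V.2) ≫ l.hom.left ≫ eqToHom (ho W.1 W.2).symm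
        simp)).trans
          (𝒜.transition_comp_transition h𝒳 hf h𝒜 _ _).symm
      w := CategoryTheory.Functor.ext (fun V => ho V.1 V.2)
        (fun V W k => 𝒜.map_transition h𝒳 hf h𝒜 _) }
  obtain ⟨y, τ, hy, hτ, hτ'⟩ := h𝒳.exists_glue_obj hf hR D
  let V (i : 𝒜.ι) (f : 𝒜.base i ⟶ S) : Over S := Over.mk f
  have hV (i : 𝒜.ι) (f : 𝒜.base i ⟶ S) : R (V i f).hom := ⟨i, rfl⟩
  let e (i : 𝒜.ι) (f : 𝒜.base i ⟶ S) : 𝒜.base i ⟶ 𝒜.base (o (V i f) (hV i f)) :=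
    eqToHom (ho (V i f) (hV i f)).symm
  let τ₁ (V : Over S) (hV : R V.hom) : 𝒜.obj (o V hV) ⟶ y := τ V hV
  have hτ₁ (V : Over S) (hV : R V.hom) : 𝒳.p.IsHomLift V.hom (τ₁ V hV) := hτ V hV
  have hτ₁' (V W : Over S) (hV : R V.hom) (hW : R W.hom) (k : V ⟶ W) :
    𝒜.transition h𝒳 hf h𝒜 (b hV hW k) ≫ τ₁ W hW = τ₁ V hV := hτ' V W hV hW k
  refine ⟨⟨y, hy, fun i f => 𝒜.transition h𝒳 hf h𝒜 (e i f) ≫ τ₁ (V i f) (hV i f), ?_, ?_⟩⟩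
  · intro i f
    have h₁ : 𝒳.p.IsHomLift f (τ₁ (V i f) (hV i f)) := hτ₁ (V i f) (hV i f)
    have h₂ := 𝒜.transition_lift h𝒳 hf h𝒜 (e i f)
    have h₃ : 𝒳.p.IsHomLift (𝟙 (𝒜.base i)) (𝒜.transition h𝒳 hf h𝒜 (e i f)) := by
      have := IsHomLift.lift_comp_eqToHom 𝒳.p (e i f) (𝒜.transition h𝒳 hf h𝒜 (e i f))
        (ho (V i f) (hV i f))
      simpa [e] using this
    exact IsHomLift.comp_lift_id_left 𝒳.p f (τ₁ (V i f) (hV i f))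
      (𝒜.transition h𝒳 hf h𝒜 (e i f))
  · intro i j m hm f
    rw [← Category.assoc, 𝒜.comp_transition' h𝒳 hf h𝒜 _ hm,
      ← hτ₁' (V i (𝒳.p.map m ≫ f)) (V j f) (hV _ _) (hV _ _) (Over.homMk (𝒳.p.map m)),
      ← Category.assoc, 𝒜.transition_comp_transition]
    congr 2
    simp [e, b]

include h𝒳 hf h𝒜 in
/-- A stack with a rigid atlas has a section: it sends `S` to the vertex of a cocone over `S`. -/
theorem nonempty_cartesianSection : Nonempty (CartesianSection 𝒳) := by
  have C (S : E) : 𝒜.Cocone S := (𝒜.exists_cocone h𝒳 hf h𝒜 S).some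
  have key {S S' : E} (f : S ⟶ S') := (C S).exists_hom 𝒜 h𝒳 hf h𝒜 (C S') f
  choose s hs hs' using @key
  exact ⟨{
    obj := fun S => (C S).pt
    map := fun f => s f
    map_id := fun S => (C S).hom_ext 𝒜 h𝒳 hf (hs (𝟙 S)) (IsHomLift.id (C S).pt_base)
      fun i g => by rw [hs', Category.comp_id, Category.comp_id]
    map_comp := fun {S T U} f g => by
      have := hs f
      have := hs g
      refine (C S).hom_ext 𝒜 h𝒳 hf (hs (f ≫ g)) inferInstance fun i k => ?_
      rw [hs', ← Category.assoc (Cocone.arrow _ _ _), hs', hs', Category.assoc]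
    w := CategoryTheory.Functor.ext (fun S => (C S).pt_base) (fun S T f => by
      have := hs f
      exact IsHomLift.fac' 𝒳.p f (s f))
    cartesian := fun f => hf.isCartesian f _ (hs f) }⟩

end Atlas

end Atlas

/-! ### The isomorphisms `j` in terms of values on sections of torsors -/

section Values

variable {E : Type u} [Category.{v} E] {J : GrothendieckTopology E}

/-- An automorphism of `x` has a restriction along every arrow to `x`. -/
lemma IsFiberedInGroupoids.exists_vaut_restrict {𝒢 : BasedCategory.{v₁, u₁} E}
    (h𝒢 : IsFiberedInGroupoids 𝒢) {y x : 𝒢.obj} (m : y ⟶ x) (σ : VAut 𝒢 x) :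
    ∃ τ : VAut 𝒢 y, τ.1.hom ≫ m = m ≫ σ.1.hom := by
  have hσ : 𝒢.p.map (m ≫ σ.1.hom) = 𝒢.p.map m := by
    rw [Functor.map_comp, show 𝒢.p.map σ.1.hom = 𝟙 _ from σ.2, Category.comp_id]
  obtain ⟨e, he, h⟩ := h𝒢.exists_iso (𝒢.p.map m) m inferInstance
    (m ≫ σ.1.hom) (hσ ▸ inferInstance)
  exact ⟨⟨e, (IsHomLift.eq_of_isHomLift _ _ _).symm⟩, h⟩

/-- A torsor has sections over a covering, stated for coverings in `E` instead of `E/S`. -/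
lemma Torsor.exists_cover {G : Sheaf J GrpCat.{w}} {S : E} (P : Torsor G S) {T : E} (f : T ⟶ S) :
    ∃ R ∈ J T, ∀ ⦃W⦄ (g : W ⟶ T), R g → Nonempty (P.carrier.obj (op (Over.mk (g ≫ f)))) := by
  obtain ⟨R, hR, h⟩ := P.locally_nonempty (Over.mk f)
  refine ⟨Sieve.overEquiv _ R, (J.mem_over_iff R).1 hR, fun W g hg => ?_⟩
  exact h _ ((Sieve.overEquiv_iff R g).1 hg)

/-- Two sections of a sheaf of groups are equal if they are so locally. -/
lemma sec_ext {G : Sheaf J GrpCat.{w}} {U : E} {a b : Sec G U} {R : Sieve U} (hR : R ∈ J U)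
    (h : ∀ ⦃W : E⦄ (g : W ⟶ U), R g → res G g a = res G g b) : a = b :=
  (isSheaf_forget G R hR).isSeparatedFor.ext fun _ g hg => h g hg

section

variable {G : Sheaf J GrpCat.{w}} {S : E} {P : Torsor G S} {Q : LeftObj G}

lemma ContractedSection.isLocalRep_iff (x : ContractedSection P Q (Over.mk (𝟙 S))) {V : Over S}
    {p : P.carrier.obj (op V)} {q : Q.carrier.obj (op V.left)} :
    x.IsLocalRep V p q ↔ x.toFun V (Over.mkIdTerminal.from V) p = q := by
  refine (class_eq_iff p q _).trans ?_
  change x.toFun V (𝟙 V ≫ _) p = q ↔ _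
  rw [Category.id_comp]
  rfl

end

namespace CrossedGerbeStructure

variable {Φ Φ' Φ'' : CrossedSheaf.{w} J} {𝒢 : BasedCategory.{v₁, u₁} E}
  (X : CrossedGerbeStructure Φ 𝒢)

/-- The object of `E` over which the torsor `μ(x)` lives. It is equal to the image of `x` in `E`,
but not by definition. -/
abbrev base (x : 𝒢.obj) : E := TorsObj.base (X.μ.obj x)

/-- The torsor `μ(x)`. -/
abbrev tors (x : 𝒢.obj) : Torsor Φ.Pi (X.base x) := TorsObj.torsor (X.μ.obj x)

lemma base_eq (x : 𝒢.obj) : X.base x = 𝒢.p.obj x := X.μ.w_obj x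

/-- The section `a` of `A` with `j(σ) = [(p, a)]`. -/
noncomputable def val (x : 𝒢.obj) (σ : VAut 𝒢 x) (V : Over (X.base x))
    (p : (X.tors x).carrier.obj (op V)) : Sec Φ.A V.left :=
  (X.j x σ).aval V (Over.mkIdTerminal.from V) p

lemma isLocalRep_iff {x : 𝒢.obj} {σ : VAut 𝒢 x} {V : Over (X.base x)}
    {p : (X.tors x).carrier.obj (op V)} {a : Sec Φ.A V.left} :
    (X.j x σ).IsLocalRep V p a ↔ X.val x σ V p = a :=
  (X.j x σ).isLocalRep_iff

lemma val_res (x : 𝒢.obj) (σ : VAut 𝒢 x) {V W : Over (X.base x)} (l : W ⟶ V)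
    (p : (X.tors x).carrier.obj (op V)) :
    X.val x σ W ((X.tors x).carrier.map l.op p) = res Φ.A l.left (X.val x σ V p) :=
  (X.j x σ).map_res' l _ _ (Over.mkIdTerminal.hom_ext _ _) p

/-- Values are not affected by the transport of a section along an equality of arrows to the base.
-/
lemma val_overEq (x : 𝒢.obj) (σ : VAut 𝒢 x) {U : E} {s t : U ⟶ X.base x} (h : s = t)
    (p : (X.tors x).carrier.obj (op (Over.mk t))) :
    X.val x σ (Over.mk s) ((X.tors x).carrier.map (overEq h).op p) = X.val x σ (Over.mk t) p :=
  (X.val_res x σ (overEq h) p).trans (res_id Φ.A _)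

lemma val_act (x : 𝒢.obj) (σ : VAut 𝒢 x) {V : Over (X.base x)}
    (p : (X.tors x).carrier.obj (op V)) (g : Sec Φ.Pi V.left) :
    X.val x σ V ((X.tors x).act p g) = Φ.smul V.left g⁻¹ (X.val x σ V p) :=
  (X.j x σ).aval_act _ p g

lemma val_one (x : 𝒢.obj) (V : Over (X.base x)) (p : (X.tors x).carrier.obj (op V)) :
    X.val x 1 V p = 1 := by
  rw [val, map_one]
  rfl

/-- The naturality of `j` in terms of values. -/
lemma val_natural {y x : 𝒢.obj} (m : y ⟶ x) {τ : VAut 𝒢 y} {σ : VAut 𝒢 x}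
    (h : τ.1.hom ≫ m = m ≫ σ.1.hom) (V : Over (X.base y)) (p : (X.tors y).carrier.obj (op V)) :
    X.val x σ ((Over.map (TorsHom.base (X.μ.map m))).obj V) (TorsHom.map (X.μ.map m) V p) =
      X.val y τ V p :=
  X.isLocalRep_iff.1 (X.j_natural m τ σ h V p _ (X.isLocalRep_iff.2 rfl))

/-- The value of `j(σ)` on the image of a section under a morphism of torsors. It lives in a group
which does not depend on the morphism, so that equations between morphisms can be applied to it. -/
noncomputable def valMap (x : 𝒢.obj) (σ : VAut 𝒢 x) {Y : TorsObj Φ.Pi} (n : TorsHom Y (X.μ.obj x))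
    (V : Over Y.base) (p : Y.torsor.carrier.obj (op V)) : Sec Φ.A V.left :=
  X.val x σ ((Over.map n.base).obj V) (n.map V p)

lemma valMap_id (x : 𝒢.obj) (σ : VAut 𝒢 x) (V : Over (X.base x))
    (p : (X.tors x).carrier.obj (op V)) :
    X.valMap x σ (TorsHom.id _) V p = X.val x σ V p :=
  (X.val_res x σ _ p).trans (res_id Φ.A _)

lemma valMap_comp (x : 𝒢.obj) (σ : VAut 𝒢 x) {Y Z : TorsObj Φ.Pi} (m : TorsHom Z Y)
    (n : TorsHom Y (X.μ.obj x)) (V : Over Z.base) (p : Z.torsor.carrier.obj (op V)) :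
    X.valMap x σ (TorsHom.comp m n) V p =
      X.valMap x σ n ((Over.map m.base).obj V) (m.map V p) :=
  (X.val_res x σ _ _).trans (res_id Φ.A _)

lemma valMap_res (x : 𝒢.obj) (σ : VAut 𝒢 x) {Y : TorsObj Φ.Pi} (n : TorsHom Y (X.μ.obj x))
    {V W : Over Y.base} (l : W ⟶ V) (p : Y.torsor.carrier.obj (op V)) :
    X.valMap x σ n W (Y.torsor.carrier.map l.op p) = res Φ.A l.left (X.valMap x σ n V p) := by
  rw [valMap, n.map_res]
  exact X.val_res x σ _ _

/-- Two automorphisms are equal if the values of their images under `j` agree on a covering. -/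
lemma vaut_ext (x : 𝒢.obj) {σ τ : VAut 𝒢 x}
    (h : ∀ V : Over (X.base x), ∃ R ∈ J V.left, ∀ ⦃W : E⦄ (g : W ⟶ V.left), R g →
      ∃ p : (X.tors x).carrier.obj (op (Over.mk (g ≫ V.hom))),
        X.val x σ _ p = X.val x τ _ p) : σ = τ := by
  apply (X.j x).injective
  refine ContractedSection.ext_toFun fun V k q => ?_
  obtain rfl : k = Over.mkIdTerminal.from V := Over.mkIdTerminal.hom_ext _ _
  change X.val x σ V q = X.val x τ V q
  obtain ⟨R, hR, hc⟩ := h V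
  refine sec_ext hR fun W g hg => ?_
  obtain ⟨p, hp⟩ := hc g hg
  let l : Over.mk (g ≫ V.hom) ⟶ V := Over.homMk g
  have key := X.val_res x σ l q
  have key' := X.val_res x τ l q
  obtain ⟨a, ha, -⟩ := (X.tors x).simply_transitive p ((X.tors x).carrier.map l.op q)
  rw [← ha, val_act] at key key'
  exact key.symm.trans ((congrArg _ hp).trans key')

/-- The automorphism with prescribed value of its image under `j` on a global section of the
torsor. -/
lemma exists_vaut (x : 𝒢.obj) (p : (X.tors x).carrier.obj (op (Over.mk (𝟙 (X.base x)))))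
    (a : Sec Φ.A (X.base x)) : ∃ σ : VAut 𝒢 x, X.val x σ _ p = a := by
  refine ⟨(X.j x).symm (contractedClass (X.tors x) Φ.leftObj p a), ?_⟩
  rw [val, MulEquiv.apply_symm_apply]
  have : Over.mkIdTerminal.from (Over.mk (𝟙 (X.base x))) = 𝟙 _ := Over.mkIdTerminal.hom_ext _ _
  rw [ContractedSection.aval, this]
  exact contractedClass_self (Q := Φ.leftObj) p a

/-- The automorphism `σ` belongs to the kernel of `P ∧ A ⟶ P ∧ A'` for a morphism of sheaves of
crossed groups with source `(A, Π)`. -/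
def InKer (η : CrossedHom Φ Φ') {x : 𝒢.obj} (σ : VAut 𝒢 x) : Prop :=
  ∀ (V : Over (X.base x)) (p : (X.tors x).carrier.obj (op V)),
    app η.f V.left (X.val x σ V p) = 1

lemma inKer_one (η : CrossedHom Φ Φ') (x : 𝒢.obj) : X.InKer η (1 : VAut 𝒢 x) := fun V p => by
  rw [val_one, map_one]

lemma InKer.restrict {η : CrossedHom Φ Φ'} {y x : 𝒢.obj} {m : y ⟶ x} {τ : VAut 𝒢 y}
    {σ : VAut 𝒢 x} (hσ : X.InKer η σ) (h : τ.1.hom ≫ m = m ≫ σ.1.hom) : X.InKer η τ :=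
  fun V p => by
    rw [← X.val_natural m h]
    exact hσ ((Over.map (TorsHom.base (X.μ.map m))).obj V) _

/-- The kernel of the identity is trivial. -/
lemma inKer_id_iff {x : 𝒢.obj} {σ : VAut 𝒢 x} : X.InKer (CrossedHom.id Φ) σ ↔ σ = 1 := by
  constructor
  · intro h
    apply (X.j x).injective
    refine ContractedSection.ext_toFun fun V k q => ?_
    obtain rfl : k = Over.mkIdTerminal.from V := Over.mkIdTerminal.hom_ext _ _
    exact (h V q).trans (X.val_one x V q).symm
  · rintro rfl
    exact X.inKer_one _ x

/-- It can be checked locally, on a single section of the torsor, whether an automorphism belongs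
to the kernel. -/
lemma inKer_of_locally (η : CrossedHom Φ Φ') {x : 𝒢.obj} {σ : VAut 𝒢 x}
    (h : ∀ V : Over (X.base x), ∃ R ∈ J V.left, ∀ ⦃W : E⦄ (g : W ⟶ V.left), R g →
      ∃ p : (X.tors x).carrier.obj (op (Over.mk (g ≫ V.hom))),
        app η.f W (X.val x σ _ p) = 1) : X.InKer η σ := by
  intro V q
  obtain ⟨R, hR, hc⟩ := h V
  refine sec_ext hR fun W g hg => ?_
  obtain ⟨p, hp⟩ := hc g hg
  let l : Over.mk (g ≫ V.hom) ⟶ V := Over.homMk g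
  have key := X.val_res x σ l q
  obtain ⟨a, ha, -⟩ := (X.tors x).simply_transitive p ((X.tors x).carrier.map l.op q)
  rw [← ha, val_act] at key
  rw [← app_res, map_one]
  refine (congrArg (app η.f W) key.symm).trans ((η.map_smul (U := W) a⁻¹ _).trans ?_)
  exact (congrArg _ hp).trans (map_one _)

end CrossedGerbeStructure

/-- The composition of morphisms of sheaves of crossed groups. -/
def CrossedHom.comp {Φ Φ' Φ'' : CrossedSheaf.{w} J} (θ : CrossedHom Φ Φ') (η : CrossedHom Φ' Φ'') :
    CrossedHom Φ Φ'' where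
  f := θ.f ≫ η.f
  φ := θ.φ ≫ η.φ
  comm {U} a := by
    change app η.φ U (app θ.φ U _) = app Φ''.ρ U (app η.f U (app θ.f U a))
    rw [θ.comm, η.comm]
  map_smul {U} g a := by
    change app η.f U (app θ.f U _) = Φ''.smul U (app η.φ U (app θ.φ U g)) (app η.f U (app θ.f U a))
    rw [θ.map_smul, η.map_smul]

/-- The map `p ↦ [(p, 1)]` from a torsor to its extension is natural in the torsor. -/
lemma contractedMap_toExtension {G H : Sheaf J GrpCat.{w}} (φ : G ⟶ H) {X Y : TorsObj G}
    (m : TorsHom X Y) (V : Over X.base) (p : X.torsor.carrier.obj (op V)) :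
    (TorsHom.extension φ m).map V (X.torsor.toExtension φ p) =
      Y.torsor.toExtension (U := (Over.map m.base).obj V) φ (m.map V p) := by
  refine ((class_eq_iff (P := Y.torsor) (Q := translationObj φ) (U := (Over.map m.base).obj V)
    (m.map V p) (1 : Sec H V.left) _).2 ?_).symm
  have := contractedMap_apply m V (X.torsor.toExtension φ p) (𝟙 V) p
  rw [CategoryTheory.Functor.map_id] at this
  exact this.trans (contractedClass_self p _)

lemma Torsor.map_toExtension {G H : Sheaf J GrpCat.{w}} (φ : G ⟶ H) {S : E} (P : Torsor G S)
    {V W : Over S} (l : W ⟶ V) (p : P.carrier.obj (op V)) :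
    (P.extension φ).carrier.map l.op (P.toExtension φ p) =
      P.toExtension φ (P.carrier.map l.op p) := by
  refine ((class_eq_iff (P := P) (Q := translationObj φ) (P.carrier.map l.op p)
    (1 : Sec H W.left) _).2 ?_).symm
  refine (ContractedSection.map_res' (P.toExtension φ p) l (𝟙 V) (𝟙 W ≫ l) (by simp) p).trans ?_
  refine (congrArg _ (contractedClass_self p _)).trans ?_
  exact map_one (res H l.left)

lemma Torsor.toExtension_act {G H : Sheaf J GrpCat.{w}} (φ : G ⟶ H) {S : E} (P : Torsor G S)
    {V : Over S} (p : P.carrier.obj (op V)) (g : Sec G V.left) :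
    P.toExtension φ (P.act p g) = (P.extension φ).act (P.toExtension φ p) (app φ V.left g) := by
  refine (class_eq_iff (P := P) (Q := translationObj φ) (P.act p g) (1 : Sec H V.left) _).2 ?_
  refine (ContractedSection.tval_act _ (𝟙 V) p g).trans ?_
  change app φ V.left g⁻¹ * (ContractedSection.tval (P.toExtension φ p) V (𝟙 V) p *
    res H (𝟙 V.left) (app φ V.left g)) = 1
  have : ContractedSection.tval (P.toExtension φ p) V (𝟙 V) p = 1 := contractedClass_self p _
  rw [this, res_id, map_inv, one_mul, inv_mul_cancel]

end Values

/-! ### Local behavior of morphisms of gerbes with structure -/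

section Morphisms

variable {E : Type u} [Category.{v} E] {J : GrothendieckTopology E}

/-- A property which holds locally on the members of a covering holds on a covering. -/
lemma bind_cover {S : E} {p : ∀ ⦃W : E⦄, (W ⟶ S) → Prop}
    (h : ∃ R ∈ J S, ∀ ⦃W : E⦄ (g : W ⟶ S), R g →
      ∃ R' ∈ J W, ∀ ⦃V : E⦄ (k : V ⟶ W), R' k → p (k ≫ g)) :
    ∃ R ∈ J S, ∀ ⦃W : E⦄ (g : W ⟶ S), R g → p g := by
  obtain ⟨R, hR, h⟩ := h
  choose R' hR' h' using h
  refine ⟨Sieve.bind R fun W g hg => R' g hg, J.bind_covering hR fun W g hg => hR' g hg, ?_⟩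
  rintro W _ ⟨V, k, g, hg, hk, rfl⟩
  exact h' g hg k hk

variable {Φ Φ' Φ'' : CrossedSheaf.{w} J} {𝒢 : BasedCategory.{v₁, u₁} E}
  {𝒢' : BasedCategory.{v₂, u₂} E} {X : CrossedGerbeStructure Φ 𝒢}
  {X' : CrossedGerbeStructure Φ' 𝒢'} {L : 𝒢 ⥤ᵇ 𝒢'} {θ : CrossedHom Φ Φ'}

namespace IsCrossedMorphism

/-- The existence of the isomorphism `i` of the definition, in terms of values. -/
lemma exists_iso_val (hL : IsCrossedMorphism θ X X' L) :
    ∃ i : BasedFunctor.comp X.μ (torsStackMap θ.φ) ≅ BasedFunctor.comp L X'.μ,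
    ∀ (x : 𝒢.obj) (σ : VAut 𝒢 x) (V : Over (X.base x)) (p : (X.tors x).carrier.obj (op V)),
      X'.valMap (L.obj x) (vautMap L x σ) (i.hom.app x) V ((X.tors x).toExtension θ.φ p) =
        app θ.f V.left (X.val x σ V p) := by
  obtain ⟨i, hi⟩ := hL.exists_iso
  exact ⟨i, fun x σ V p => X'.isLocalRep_iff.1 (hi x σ V p _ (X.isLocalRep_iff.2 rfl))⟩

/-- Every arrow to the base of `μ'(L(x))` factors through the base of `μ(x)`, by the inverse of the
isomorphism underlying `i`. -/
lemma exists_factor (i : BasedFunctor.comp X.μ (torsStackMap θ.φ) ≅ BasedFunctor.comp L X'.μ)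
    (x : 𝒢.obj) :
    ∃ c : X'.base (L.obj x) ⟶ X.base x, ∀ ⦃W : E⦄ (h : W ⟶ X'.base (L.obj x)),
      (h ≫ c) ≫ TorsHom.base (Y := X'.μ.obj (L.obj x)) (i.hom.app x) = h := by
  let b : X.base x ⟶ X'.base (L.obj x) := TorsHom.base (Y := X'.μ.obj (L.obj x)) (i.hom.app x)
  let c : X'.base (L.obj x) ⟶ X.base x := TorsHom.base (X := X'.μ.obj (L.obj x)) (i.inv.app x)
  have hc : c ≫ b = 𝟙 _ := congrArg (fun t : BasedFunctor.comp L X'.μ ⟶ _ =>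
    TorsHom.base (t.app x)) i.inv_hom_id
  refine ⟨c, fun W h => ?_⟩
  change (h ≫ c) ≫ b = h
  rw [Category.assoc, hc, Category.comp_id]

/-- The values of `L(σ)` on suitable local sections of `μ'(L(x))` are the images of values of `σ`;
the sections do not depend on `σ`. -/
lemma exists_val_cover (hL : IsCrossedMorphism θ X X' L) (x : 𝒢.obj)
    (V : Over (X'.base (L.obj x))) :
    ∃ R ∈ J V.left, ∀ ⦃W : E⦄ (g : W ⟶ V.left), R g →
      ∃ (p : (X'.tors (L.obj x)).carrier.obj (op (Over.mk (g ≫ V.hom)))) (u : W ⟶ X.base x)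
        (p₀ : (X.tors x).carrier.obj (op (Over.mk u))), ∀ σ : VAut 𝒢 x,
          X'.val (L.obj x) (vautMap L x σ) _ p = app θ.f W (X.val x σ _ p₀) := by
  obtain ⟨i, hi⟩ := hL.exists_iso_val
  obtain ⟨c, hc⟩ := exists_factor i x
  obtain ⟨R, hR, h⟩ := (X.tors x).exists_cover (V.hom ≫ c)
  refine ⟨R, hR, fun W g hg => ?_⟩
  obtain ⟨p₀⟩ := h g hg
  have e : g ≫ V.hom = (g ≫ V.hom ≫ c) ≫ TorsHom.base (Y := X'.μ.obj (L.obj x)) (i.hom.app x) := by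
    refine (hc (g ≫ V.hom)).symm.trans (congrArg (fun t => t ≫ _) (Category.assoc _ _ _))
  refine ⟨(X'.tors (L.obj x)).carrier.map (overEq e).op (TorsHom.map (i.hom.app x) _
    ((X.tors x).toExtension θ.φ p₀)), g ≫ V.hom ≫ c, p₀, fun σ => ?_⟩
  exact (X'.val_overEq _ _ e _).trans (hi x σ _ p₀)

/-- The image of an automorphism under a `θ`-morphism is in the kernel of `η` if and only if the
automorphism is in the kernel of the composite of `θ` and `η`. -/
lemma inKer_iff (hL : IsCrossedMorphism θ X X' L) (η : CrossedHom Φ' Φ'') {x : 𝒢.obj}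
    {σ : VAut 𝒢 x} : X'.InKer η (vautMap L x σ) ↔ X.InKer (θ.comp η) σ := by
  constructor
  · obtain ⟨i, hi⟩ := hL.exists_iso_val
    intro h V p
    change app η.f V.left (app θ.f V.left _) = 1
    rw [← hi]
    exact h ((Over.map (TorsHom.base (i.hom.app x))).obj V) _
  · intro h
    refine X'.inKer_of_locally η fun V => ?_
    obtain ⟨R, hR, hc⟩ := hL.exists_val_cover x V
    refine ⟨R, hR, fun W g hg => ?_⟩
    obtain ⟨p, u, p₀, hp⟩ := hc g hg
    exact ⟨p, (congrArg _ (hp σ)).trans (h _ p₀)⟩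

/-- The kernel of `Aut(x) ⟶ Aut(L(x))` is the kernel of `μ(x) ∧ A ⟶ μ(x) ∧ A'`. -/
lemma vautMap_eq_one_iff (hL : IsCrossedMorphism θ X X' L) {x : 𝒢.obj} {σ : VAut 𝒢 x} :
    vautMap L x σ = 1 ↔ X.InKer θ σ := by
  rw [← X'.inKer_id_iff, hL.inKer_iff]
  rfl

/-- If `A ⟶ A'` is an epimorphism, then the automorphisms of `L(x)` come locally from automorphisms
of `x`. -/
lemma exists_local_lift (hL : IsCrossedMorphism θ X X' L)
    (hθ : Presheaf.IsLocallySurjective J θ.f.hom) {x : 𝒢.obj} {S : E} (hS : 𝒢.p.obj x = S)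
    (σ' : VAut 𝒢' (L.obj x)) :
    ∃ R ∈ J S, ∀ ⦃W : E⦄ (g : W ⟶ S), R g → ∃ (y : 𝒢.obj) (m : y ⟶ x) (σ : VAut 𝒢 y),
      𝒢.p.IsHomLift g m ∧ (vautMap L y σ).1.hom ≫ L.map m = L.map m ≫ σ'.1.hom := by
  obtain rfl : S = X.base x := hS.symm.trans (X.base_eq x).symm
  obtain ⟨i, hi⟩ := hL.exists_iso_val
  apply bind_cover
  obtain ⟨R, hR, hc⟩ := (X.tors x).exists_cover (𝟙 (X.base x))
  refine ⟨R, hR, fun W g hg => ?_⟩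
  obtain ⟨p⟩ := hc g hg
  -- On a covering which trivializes `μ(x)` by a section `p`, the automorphism `σ'` is given by a
  -- section `a'` of `A'`, which lifts to a section `a` of `A` on a finer covering.
  let a' : Sec Φ'.A W := X'.valMap (L.obj x) σ' (i.hom.app x) _ ((X.tors x).toExtension θ.φ p)
  refine ⟨Presheaf.imageSieve θ.f.hom a', hθ.imageSieve_mem a', ?_⟩
  rintro W₂ k ⟨a, ha⟩
  have ha' : app θ.f W₂ a = res Φ'.A k a' := ha
  obtain ⟨y, m, hm⟩ := X.isGerbe.isFiberedInGroupoids.exists_pull x hS (k ≫ g)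
  obtain rfl : W₂ = X.base y := (IsHomLift.domain_eq 𝒢.p (k ≫ g) m).symm.trans (X.base_eq y).symm
  -- The torsor of `y` has a global section, namely the restriction of `p`.
  have hb : TorsHom.base (X.μ.map m) = k ≫ g := by
    have : (torsStack Φ.Pi).p.IsHomLift (k ≫ g) (X.μ.map m) :=
      BasedFunctor.preserves_isHomLift X.μ _ _
    have := IsHomLift.fac' (torsStack Φ.Pi).p (k ≫ g) (X.μ.map m)
    exact this.trans ((Category.id_comp _).trans (Category.comp_id _))
  let l : (Over.map (TorsHom.base (X.μ.map m))).obj (Over.mk (𝟙 (X.base y))) ⟶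
    Over.mk (g ≫ 𝟙 (X.base x)) := Over.homMk k (by simp [hb])
  let q : (X.tors y).carrier.obj (op (Over.mk (𝟙 (X.base y)))) :=
    TorsHom.inv (X.μ.map m) _ ((X.tors x).carrier.map l.op p)
  have hq : TorsHom.map (X.μ.map m) _ q = (X.tors x).carrier.map l.op p := TorsHom.map_inv _ _ _
  -- The required automorphism is the one with `j(σ) = [(q, a)]`.
  obtain ⟨σ, hσ⟩ := X.exists_vaut y q a
  refine ⟨y, m, σ, hm, ?_⟩
  obtain ⟨τ, hτ⟩ := X'.isGerbe.isFiberedInGroupoids.exists_vaut_restrict (L.map m) σ'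
  -- It remains to compare `L(σ)` with the restriction `τ` of `σ'`. Their values agree on the image
  -- of the global section `q`, hence on a covering.
  suffices h : vautMap L y σ = τ by rw [h, hτ]
  have key : X'.valMap (L.obj y) (vautMap L y σ) (i.hom.app y) _ ((X.tors y).toExtension θ.φ q) =
      X'.valMap (L.obj y) τ (i.hom.app y) _ ((X.tors y).toExtension θ.φ q) := by
    rw [hi, hσ]
    refine ha'.trans ?_
    let V₁ := (Over.map (TorsHom.base (i.hom.app y))).obj (Over.mk (𝟙 (X.base y)))
    let q₁ : (X'.tors (L.obj y)).carrier.obj (op V₁) :=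
      TorsHom.map (i.hom.app y) _ ((X.tors y).toExtension θ.φ q)
    have e₁ := X'.val_natural (L.map m) hτ V₁ q₁
    refine Eq.trans ?_ e₁
    have e₂ : TorsHom.comp (TorsHom.extension θ.φ (X.μ.map m)) (i.hom.app x) =
        TorsHom.comp (i.hom.app y) (X'.μ.map (L.map m)) := i.hom.naturality m
    have e₃ := X'.valMap_comp (L.obj x) σ' (i.hom.app y) (X'.μ.map (L.map m)) _
      ((X.tors y).toExtension θ.φ q)
    refine Eq.trans ?_ e₃
    rw [← e₂]
    refine Eq.trans ?_ (X'.valMap_comp (L.obj x) σ' (TorsHom.extension θ.φ (X.μ.map m))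
      (i.hom.app x) _ ((X.tors y).toExtension θ.φ q)).symm
    refine Eq.trans ?_ (congrArg (X'.valMap (L.obj x) σ' (i.hom.app x) _)
      ((contractedMap_toExtension θ.φ (X.μ.map m) _ q).trans ((congrArg _ hq).trans
        (Torsor.map_toExtension θ.φ (X.tors x) l p).symm)).symm)
    exact (X'.valMap_res (L.obj x) σ' (i.hom.app x) l ((X.tors x).toExtension θ.φ p)).symm
  obtain ⟨c, hc'⟩ := exists_factor i y
  refine X'.vaut_ext _ fun V => ⟨⊤, J.top_mem _, fun W g' _ => ?_⟩
  let r : Over.mk (g' ≫ V.hom) ⟶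
      (Over.map (TorsHom.base (i.hom.app y))).obj (Over.mk (𝟙 (X.base y))) :=
    Over.homMk ((g' ≫ V.hom) ≫ c)
      ((congrArg (fun t => ((g' ≫ V.hom) ≫ c) ≫ t) (Category.id_comp _)).trans (hc' _))
  refine ⟨(X'.tors (L.obj y)).carrier.map r.op (TorsHom.map (i.hom.app y) _
    ((X.tors y).toExtension θ.φ q)), ?_⟩
  exact (X'.val_res _ _ r _).trans ((congrArg _ key).trans (X'.val_res _ _ r _).symm)

/-- If `A ⟶ A'` is an epimorphism, then a `θ`-morphism is locally full: since `x` and `y` are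
locally isomorphic, it is enough to lift automorphisms of `L(x)`. -/
lemma locally_full (hL : IsCrossedMorphism θ X X' L)
    (hθ : Presheaf.IsLocallySurjective J θ.f.hom) {x y : 𝒢.obj} {S : E} (hx : 𝒢.p.obj x = S)
    (hy : 𝒢.p.obj y = S) (n : L.obj x ⟶ L.obj y) (hn : 𝒢'.p.IsHomLift (𝟙 S) n) :
    ∃ R ∈ J S, ∀ ⦃W : E⦄ (g : W ⟶ S), R g → ∃ (z : 𝒢.obj) (m : z ⟶ x) (m' : z ⟶ y),
      𝒢.p.IsHomLift g m ∧ 𝒢.p.IsHomLift g m' ∧ L.map m ≫ n = L.map m' := by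
  apply bind_cover
  obtain ⟨R, hR, hc⟩ := X.isGerbe.locally_isomorphic S x y hx hy
  refine ⟨R, hR, fun W g hg => ?_⟩
  obtain ⟨x', y', m, m', e, hm, hm', he⟩ := hc g hg
  have hm : 𝒢.p.IsHomLift g m := hm.toIsHomLift
  have hm' : 𝒢.p.IsHomLift g m' := hm'.toIsHomLift
  have h₁ : 𝒢'.p.IsHomLift g (L.map (e.hom ≫ m')) := BasedFunctor.preserves_isHomLift L _ _
  have h₂ : 𝒢'.p.IsHomLift g (L.map m) := BasedFunctor.preserves_isHomLift L _ _
  obtain ⟨ε, hε, hε'⟩ := X'.isGerbe.isFiberedInGroupoids.exists_iso g (L.map (e.hom ≫ m')) h₁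
    (L.map m ≫ n) inferInstance
  have hεv : 𝒢'.p.map ε.hom = 𝟙 _ := by
    obtain rfl : 𝒢'.p.obj (L.obj x') = W := IsHomLift.domain_eq 𝒢'.p g (L.map m)
    exact (IsHomLift.eq_of_isHomLift _ _ _).symm
  obtain ⟨R', hR', h'⟩ := hL.exists_local_lift hθ (IsHomLift.domain_eq 𝒢.p g m) ⟨ε, hεv⟩
  refine ⟨R', hR', fun V k hk => ?_⟩
  obtain ⟨z, r, σ, hr, hσ⟩ := h' k hk
  have hσ₁ : 𝒢.p.IsHomLift (𝟙 V) σ.1.hom := by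
    obtain rfl : 𝒢.p.obj z = V := IsHomLift.domain_eq 𝒢.p k r
    rw [← show 𝒢.p.map σ.1.hom = 𝟙 _ from σ.2]
    infer_instance
  refine ⟨z, r ≫ m, σ.1.hom ≫ r ≫ e.hom ≫ m', inferInstance, inferInstance, ?_⟩
  have hσ' : L.map σ.1.hom ≫ L.map r = L.map r ≫ ε.hom := hσ
  rw [Functor.map_comp, Category.assoc, ← hε', ← Category.assoc, ← hσ', Category.assoc,
    ← Functor.map_comp, ← Functor.map_comp]

end IsCrossedMorphism

end Morphisms

/-! ### Morphisms of torsors and restriction of the structural group -/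

section Restriction

variable {E : Type u} [Category.{v} E] {J : GrothendieckTopology E} {G H : Sheaf J GrpCat.{w}}

lemma app_bijective (φ : G ⟶ H) [IsIso φ] (U : E) : Function.Bijective (app φ U) := by
  have h₁ : ∀ g, app (inv φ) U (app φ U g) = g := fun g =>
    congrArg (fun t : G ⟶ G => app t U g) (IsIso.hom_inv_id φ)
  have h₂ : ∀ g, app φ U (app (inv φ) U g) = g := fun g =>
    congrArg (fun t : H ⟶ H => app t U g) (IsIso.inv_hom_id φ)
  exact ⟨Function.LeftInverse.injective h₁, Function.RightInverse.surjective h₂⟩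

variable (φ : G ⟶ H) [IsIso φ]

/-- The restriction of the structural group of a torsor along an isomorphism `φ`. -/
def Torsor.restrict {S : E} (P : Torsor H S) : Torsor G S where
  carrier := P.carrier
  isSheaf := P.isSheaf
  act {V} p g := P.act p (app φ V.left g)
  act_one p := by rw [map_one, P.act_one]
  act_mul p g h := by rw [map_mul, P.act_mul]
  act_res {V W} k p g := by rw [P.act_res, app_res]
  simply_transitive {V} p q := by
    obtain ⟨h, hh, hu⟩ := P.simply_transitive p q
    obtain ⟨g, rfl⟩ := (app_bijective φ V.left).2 h
    exact ⟨g, hh, fun g' hg' => (app_bijective φ V.left).1 (hu _ hg')⟩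
  locally_nonempty := P.locally_nonempty

/-- The restriction of the structural group along an isomorphism, on morphisms of torsors. -/
def TorsHom.restrict {X Y : TorsObj H} (m : TorsHom X Y) :
    TorsHom (⟨X.base, X.torsor.restrict φ⟩ : TorsObj G) ⟨Y.base, Y.torsor.restrict φ⟩ where
  base := m.base
  map := m.map
  map_res := m.map_res
  map_act p _ := m.map_act p _

/-- The functor from `H`-torsors to `G`-torsors given by an isomorphism `G ⟶ H`. -/
def torsRestrict : torsStack H ⥤ᵇ torsStack G where
  toFunctor :=
    { obj := fun X => (⟨TorsObj.base X, (TorsObj.torsor X).restrict φ⟩ : TorsObj G)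
      map := fun m => TorsHom.restrict φ m
      map_id := fun _ => rfl
      map_comp := fun _ _ => rfl }
  w := rfl

/-- Morphisms of torsors lift along morphisms of torsors. -/
lemma TorsHom.exists_lift {X Y Z : TorsObj G} (m : TorsHom Y Z) (n : TorsHom X Z)
    (b : X.base ⟶ Y.base) (hb : n.base = b ≫ m.base) :
    ∃ χ : TorsHom X Y, χ.base = b ∧ TorsHom.comp χ m = n := by
  have e (V : Over X.base) : (V.hom ≫ b) ≫ m.base = V.hom ≫ n.base := by
    rw [hb, Category.assoc]
  let c (V : Over X.base) : (Over.map m.base).obj ((Over.map b).obj V) ⟶ (Over.map n.base).obj V :=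
    overEq (e V)
  refine ⟨{ base := b
            map := fun V p => m.inv ((Over.map b).obj V) (Z.torsor.carrier.map (c V).op (n.map V p))
            map_res := fun {V W} k p => ?_
            map_act := fun {V} p g => ?_ }, rfl, TorsHom.ext' hb.symm fun V p => ?_⟩
  · refine Eq.trans ?_ (m.inv_res ((Over.map b).map k) _)
    congr 1
    rw [n.map_res, Torsor.map_map, Torsor.map_map]
    exact Torsor.map_congr _ _ _ (by simp [c]) _
  · refine Eq.trans ?_ (m.inv_act ((Over.map b).obj V) _ g)
    congr 1
    rw [n.map_act]
    exact Torsor.act_map_overEq _ _ _ _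
  · refine (Torsor.map_map _ _ _ _).trans ?_
    refine (congrArg _ (m.map_inv _ _)).trans ?_
    rw [Torsor.map_map]
    refine Torsor.map_self _ _ (Over.OverMorphism.ext ?_) _
    change (𝟙 V.left ≫ 𝟙 V.left) ≫ 𝟙 V.left = 𝟙 V.left
    rw [Category.id_comp, Category.id_comp]

/-- The lift in `TorsHom.exists_lift` is unique. -/
lemma TorsHom.cancel {X Y Z : TorsObj G} (m : TorsHom Y Z) (χ χ' : TorsHom X Y)
    (hb : χ.base = χ'.base) (h : TorsHom.comp χ m = TorsHom.comp χ' m) : χ = χ' := by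
  obtain ⟨b, f, hf, hf'⟩ := χ
  obtain ⟨b', f', hg, hg'⟩ := χ'
  obtain rfl : b = b' := hb
  congr
  funext V p
  apply m.map_injective
  -- The two composites with `m` have the same values, transported to a common set of sections.
  have e (n : TorsHom X Z) (h : n.base = b ≫ m.base) :
      (V.hom ≫ b) ≫ m.base = V.hom ≫ n.base := by rw [h, Category.assoc]
  have key : ∀ n n' : TorsHom X Z, n = n' → ∀ h : n.base = b ≫ m.base, ∀ h' : n'.base = b ≫ m.base,
      Z.torsor.carrier.map (overEq (e n h) :
        Over.mk ((V.hom ≫ b) ≫ m.base) ⟶ (Over.map n.base).obj V).op (n.map V p) =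
      Z.torsor.carrier.map (overEq (e n' h') :
        Over.mk ((V.hom ≫ b) ≫ m.base) ⟶ (Over.map n'.base).obj V).op (n'.map V p) := by
    rintro n _ rfl _ _
    rfl
  have := key _ _ h rfl rfl
  refine Eq.trans ?_ (this.trans ?_)
  · refine Eq.symm ((Torsor.map_map _ _ _ _).trans ?_)
    exact Torsor.map_self _ _ (Over.OverMorphism.ext (Category.id_comp _)) _
  · refine (Torsor.map_map _ _ _ _).trans ?_
    exact Torsor.map_self _ _ (Over.OverMorphism.ext (Category.id_comp _)) _

variable (G) in
/-- Every morphism of torsors is cartesian. -/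
lemma torsStack_isStronglyCartesian {Y Z : (torsStack G).obj} (m : Y ⟶ Z) {R S : E} (f : R ⟶ S)
    (h : (torsStack G).p.IsHomLift f m) : (torsStack G).p.IsStronglyCartesian f m := by
  refine isStronglyCartesian_of_lift m (fun {X} n b hb => ?_) f h
  obtain ⟨χ, h₁, h₂⟩ := TorsHom.exists_lift m n b hb
  exact ⟨χ, ⟨h₁, h₂⟩, fun χ' hχ' => TorsHom.cancel m χ' χ (hχ'.1.trans h₁.symm)
    (hχ'.2.trans h₂.symm)⟩

/-- The isomorphism of `H`-torsors `P ⟶ P ∧ H`, `p ↦ [(p, 1)]`, where on the right `P` is regarded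
as a `G`-torsor via the isomorphism `φ : G ⟶ H`. -/
noncomputable def toRestrictExtension (X : TorsObj H) :
    TorsHom X (⟨X.base, (X.torsor.restrict φ).extension φ⟩ : TorsObj H) where
  base := 𝟙 X.base
  map V p := ((X.torsor.restrict φ).extension φ).carrier.map
    (overEq (by simp) : (Over.map (𝟙 X.base)).obj V ⟶ V).op
      ((X.torsor.restrict φ).toExtension φ p)
  map_res {V W} k p := by
    refine (congrArg _ ((X.torsor.restrict φ).map_toExtension φ k p).symm).trans ?_
    refine (Torsor.map_map _ _ _ _).trans (Eq.trans ?_ (Torsor.map_map _ _ _ _).symm)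
    exact Torsor.map_congr _ _ _ (by simp) _
  map_act {V} p g := by
    obtain ⟨g, rfl⟩ := (app_bijective φ V.left).2 g
    refine (congrArg _ ((X.torsor.restrict φ).toExtension_act φ p g)).trans ?_
    exact Torsor.act_map_overEq _ _ _ _

/-- The isomorphism `P ⟶ P ∧ H` is natural in `P`. -/
lemma toRestrictExtension_comp {X Y : TorsObj H} (m : TorsHom X Y) :
    TorsHom.comp m (toRestrictExtension φ Y) =
      TorsHom.comp (toRestrictExtension φ X) (TorsHom.extension φ (TorsHom.restrict φ m)) := by
  refine TorsHom.ext' ((Category.comp_id _).trans (Category.id_comp _).symm) fun V p => ?_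
  have h₁ := contractedMap_toExtension φ (TorsHom.restrict φ m) V p
  have h₂ := (TorsHom.extension φ (TorsHom.restrict φ m)).map_res
    (overEq (by simp) : (Over.map (𝟙 X.base)).obj V ⟶ V) ((X.torsor.restrict φ).toExtension φ p)
  refine (congrArg _ (Torsor.map_map _ _ _ _)).trans ?_
  let T := (Y.torsor.restrict φ).extension φ
  let k : (Over.map (𝟙 X.base ≫ m.base)).obj V ⟶
    (Over.map m.base).obj ((Over.map (𝟙 X.base)).obj V) := overEq (by simp)
  refine Eq.trans ?_ (congrArg (fun t => T.carrier.map k.op t) h₂.symm)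
  refine Eq.trans ?_ (Torsor.map_map _ _ _ _).symm
  refine Eq.trans ?_ (congrArg _ h₁.symm)
  refine (Torsor.map_map _ _ _ _).trans ?_
  refine Torsor.map_congr _ _ _ ?_ _
  change 𝟙 V.left ≫ 𝟙 V.left ≫ 𝟙 V.left = 𝟙 V.left ≫ 𝟙 V.left
  rw [Category.id_comp]

/-- The restriction of the structural group along an isomorphism is inverse to the extension. -/
lemma exists_restrictExtensionIso :
    ∃ e : BasedFunctor.id (torsStack H) ≅ BasedFunctor.comp (torsRestrict φ) (torsStackMap φ),
      ∀ X : TorsObj H, e.hom.app X = toRestrictExtension φ X := by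
  let α : BasedFunctor.id (torsStack H) ⟶ BasedFunctor.comp (torsRestrict φ) (torsStackMap φ) :=
    { toNatTrans :=
        { app := fun X => toRestrictExtension φ X
          naturality := fun X Y m => toRestrictExtension_comp φ m }
      isHomLift' := fun X => by
        refine (isHomLift_iff_map_eq (𝒳 := torsStack H)).2 ⟨rfl, (Category.id_comp _).symm⟩ }
  have : IsIso (X := (BasedFunctor.id (torsStack H)).toFunctor) α.toNatTrans := by
    have (X : (torsStack H).obj) : IsIso (α.toNatTrans.app X) := by
      have h := torsStack_isStronglyCartesian H (α.toNatTrans.app X) _ (α.isHomLift' X)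
      exact Functor.IsStronglyCartesian.isIso_of_base_isIso (torsStack H).p
        (𝟙 ((torsStack H).p.obj X)) _
    exact NatIso.isIso_of_isIso_app _
  let e := asIso (X := (BasedFunctor.id (torsStack H)).toFunctor) α.toNatTrans
  exact ⟨BasedNatIso.mkNatIso e fun X => α.isHomLift' X, fun X => rfl⟩

end Restriction

/-! ### The stack of liftings of a section -/

section LiftingStack

variable {E : Type u} [Category.{v} E] {J : GrothendieckTopology E}
  {F : BasedCategory.{v₁, u₁} E} {H : BasedCategory.{v₂, u₂} E}

lemma map_comp_eqToHom {𝒳 : BasedCategory.{v₁, u₁} E} {x y : 𝒳.obj} {m : x ⟶ y} {A B : E}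
    {f : A ⟶ B} (hx : 𝒳.p.obj x = A) (hy : 𝒳.p.obj y = B) (h : 𝒳.p.IsHomLift f m) :
    𝒳.p.map m ≫ eqToHom hy = eqToHom hx ≫ f := by
  subst hx hy
  simpa using (IsHomLift.eq_of_isHomLift 𝒳.p f m).symm

lemma eqToHom_comp_map {𝒳 : BasedCategory.{v₁, u₁} E} {x y : 𝒳.obj} {m : x ⟶ y} {A B : E}
    {f : A ⟶ B} (hx : 𝒳.p.obj x = A) (hy : 𝒳.p.obj y = B) (h : 𝒳.p.IsHomLift f m) :
    eqToHom hx.symm ≫ 𝒳.p.map m = f ≫ eqToHom hy.symm := by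
  subst hx hy
  simpa using (IsHomLift.eq_of_isHomLift 𝒳.p f m).symm

lemma CartesianSection.isHomLift (s : CartesianSection H) {T S : E} (f : T ⟶ S) :
    H.p.IsHomLift f (s.map f) :=
  (s.cartesian f).toIsHomLift

lemma CartesianSection.obj_base (s : CartesianSection H) (S : E) : H.p.obj (s.obj S) = S :=
  Functor.congr_obj s.w S

variable {γ : F ⥤ᵇ H} {s : CartesianSection H}

lemma Lifting.isHomLift_iff {X Y : (liftings γ s).obj} {R S : E} (f : R ⟶ S) (m : X ⟶ Y) :
    (liftings γ s).p.IsHomLift f m ↔ F.p.IsHomLift f (LiftingHom.hom m) :=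
  (BasedFunctor.isHomLift_iff (liftingsForget γ s) f m).symm

/-- The composite of an arrow over `f` and the isomorphism of a lifting. -/
lemma Lifting.isHomLift_comp_iso (Y : Lifting γ s) {R : E} {f : R ⟶ F.p.obj Y.pt} {x : F.obj}
    (m : x ⟶ Y.pt) (hm : F.p.IsHomLift f m) : H.p.IsHomLift f (γ.map m ≫ Y.iso.hom) := by
  have := Y.vertical
  have : H.p.IsHomLift f (γ.map m) := BasedFunctor.preserves_isHomLift γ f m
  infer_instance

lemma Lifting.isHomLift_iso_comp (X : Lifting γ s) {T : E} (f : F.p.obj X.pt ⟶ T) :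
    H.p.IsHomLift f (X.iso.hom ≫ s.map f) := by
  have := X.vertical
  have := s.isHomLift f
  infer_instance

lemma CartesianSection.isHomLift_comp_eqToHom (s : CartesianSection H) {T T' : E} (h : T = T')
    {x : H.obj} {m : x ⟶ s.obj T} (hm : H.p.IsHomLift (𝟙 T) m) :
    H.p.IsHomLift (𝟙 T') (m ≫ s.map (eqToHom h)) := by
  subst h
  simpa using hm

lemma liftings_isFiberedInGroupoids (hF : IsFiberedInGroupoids F) (hH : IsFiberedInGroupoids H) :
    IsFiberedInGroupoids (liftings γ s) := by
  refine .of_lifts (fun (Y : Lifting γ s) T (f : T ⟶ F.p.obj Y.pt) => ?_)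
    fun {X Y Z : Lifting γ s} (ψ : LiftingHom Y Z) (φ : LiftingHom X Z)
      (g : F.p.obj X.pt ⟶ F.p.obj Y.pt) (h : F.p.map φ.hom = g ≫ F.p.map ψ.hom) => ?_
  · obtain ⟨x, m, hm⟩ := hF.exists_pull Y.pt rfl f
    obtain ⟨rfl, h⟩ := isHomLift_iff_map_eq.1 hm
    obtain rfl : F.p.map m = f := by simpa using h
    obtain ⟨e, he, hc⟩ := hH.exists_iso (F.p.map m) (s.map (F.p.map m)) (s.isHomLift _)
      (γ.map m ≫ Y.iso.hom) (Y.isHomLift_comp_iso m hm)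
    let X : Lifting γ s := ⟨x, e, he⟩
    exact ⟨X, (⟨m, hc⟩ : LiftingHom X Y), (Lifting.isHomLift_iff (X := X) (Y := Y) _ _).2 hm⟩
  · obtain ⟨χ, hχ, hc⟩ := hF.exists_lift (F.p.map ψ.hom) ψ.hom inferInstance g φ.hom
      (h ▸ inferInstance)
    obtain rfl : g = F.p.map χ := IsHomLift.eq_of_isHomLift _ _ _
    have e : X.iso.hom ≫ s.map (F.p.map χ) = γ.map χ ≫ Y.iso.hom := by
      refine hH.cancel (s.map (F.p.map ψ.hom)) (X.isHomLift_iso_comp _)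
        (Y.isHomLift_comp_iso χ hχ) ?_
      rw [Category.assoc, ← Functor.map_comp, ← h, φ.comm, Category.assoc, ψ.comm, ← hc,
        Functor.map_comp, Category.assoc]
    refine ⟨(⟨χ, e⟩ : LiftingHom X Y), ⟨rfl, LiftingHom.ext hc⟩, fun χ' hχ' => LiftingHom.ext ?_⟩
    exact hF.cancel' ψ.hom hχ'.1 ((congrArg LiftingHom.hom hχ'.2).trans hc.symm)

/-- Every arrow in the inverse image of a sieve is covered by a restriction of the functor `D` to an
object of the sieve. -/
lemma exists_sieve_hom {𝒳 : BasedCategory.{v₁, u₁} E} {S : E} {R : Sieve S}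
    (D : overBased S ⥤ᵇ 𝒳) (V : Over S) {W : E} (g : W ⟶ 𝒳.p.obj (D.obj V))
    (hg : R.pullback (eqToHom (D.w_obj V) ≫ V.hom) g) :
    ∃ (V' : Over S) (_ : R V'.hom) (k : V' ⟶ V), 𝒳.p.IsHomLift g (D.map k) := by
  let k : Over.mk (g ≫ eqToHom (D.w_obj V) ≫ V.hom) ⟶ V :=
    Over.homMk (g ≫ eqToHom (D.w_obj V)) (Category.assoc _ _ _)
  refine ⟨Over.mk (g ≫ eqToHom (D.w_obj V) ≫ V.hom), hg, k, isHomLift_iff_map_eq.2 ⟨D.w_obj _, ?_⟩⟩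
  refine (Functor.congr_hom D.w k).trans ?_
  change eqToHom _ ≫ (g ≫ eqToHom (D.w_obj V)) ≫ eqToHom _ = _
  rw [Category.assoc, eqToHom_trans, eqToHom_refl, Category.comp_id]

/-- The composition of a section with the projection of `E/S`. -/
def CartesianSection.restrict (s : CartesianSection H) (S : E) : overBased S ⥤ᵇ H where
  toFunctor := Over.forget S ⋙ s.toFunctor
  w := congrArg (fun t => Functor.comp (Over.forget S) t) s.w

/-- The liftings of a section form a stack: arrows and objects descend in `F`, and the
identifications `γ(z) ≅ s(S)`, being arrows of `H`, descend in `H`. -/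
theorem liftings_isStack (hF : IsStack J F) (hH : IsStack J H) (hF' : IsFiberedInGroupoids F)
    (hH' : IsFiberedInGroupoids H) : IsStack J (liftings γ s) := by
  have hK : IsFiberedInGroupoids (liftings γ s) := liftings_isFiberedInGroupoids hF' hH'
  let U := liftingsForget γ s
  refine .of_extend hK (fun {S R} hR {G G'} β => ?_) (fun {S R} hR {G G'} β β' h => ?_)
    fun {S R} hR D => ?_
  · -- Extend the underlying arrows in `F`; compatibility with the identifications is local.
    obtain ⟨δ, hδ⟩ := hF.exists_extend_hom hR (hF'.isCartesianFunctor (BasedFunctor.comp G U))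
      (hF'.isCartesianFunctor (BasedFunctor.comp G' U)) (BasedCategory.whiskerRight β U)
    let X (V : Over S) : Lifting γ s := G.obj V
    let X' (V : Over S) : Lifting γ s := G'.obj V
    let d (V : Over S) : (X V).pt ⟶ (X' V).pt := δ.app V
    let b (V : Over S) (hV : R V.hom) : LiftingHom (X V) (X' V) := β.app (sieveObj V hV)
    let r {V W : Over S} (k : V ⟶ W) : LiftingHom (X V) (X W) := G.map k
    let r' {V W : Over S} (k : V ⟶ W) : LiftingHom (X' V) (X' W) := G'.map k
    have hd : ∀ V hV, d V = (b V hV).hom := hδ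
    have hn : ∀ {V W : Over S} (k : V ⟶ W), (r k).hom ≫ d W = d V ≫ (r' k).hom :=
      fun k => δ.naturality k
    have comm : ∀ V, (X V).iso.hom ≫ s.map (F.p.map (d V)) = γ.map (d V) ≫ (X' V).iso.hom := by
      intro V
      refine hH.hom_ext' hH' (F.p.map (d V)) ((X V).isHomLift_iso_comp _)
        ((X' V).isHomLift_comp_iso (d V) inferInstance)
        (J.pullback_stable (eqToHom (G.w_obj V) ≫ V.hom) hR) fun W g hg => ?_
      obtain ⟨V', hV', k, hk⟩ := exists_sieve_hom G V g hg
      have hk' : F.p.IsHomLift g (r k).hom := (Lifting.isHomLift_iff _ _).1 hk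
      refine ⟨_, γ.map (r k).hom, BasedFunctor.preserves_isHomLift γ _ _, ?_⟩
      rw [← Category.assoc, ← (r k).comm, Category.assoc, ← Functor.map_comp, ← Functor.map_comp,
        hn, ← Category.assoc, ← Functor.map_comp, hn, Functor.map_comp, Functor.map_comp,
        Functor.map_comp, Category.assoc, ← (r' k).comm, hd V' hV', ← Category.assoc,
        ← Category.assoc, (b V' hV').comm]
    exact ⟨{ toNatTrans :=
              { app := fun V => (⟨d V, comm V⟩ : LiftingHom (X V) (X' V))
                naturality := fun V W k => LiftingHom.ext (hn k) }
             isHomLift' := fun V => (Lifting.isHomLift_iff _ _).2 (δ.isHomLift' V) },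
      fun V hV => LiftingHom.ext (hd V hV)⟩
  · have e := hF.hom_ext_of_sieve hR (hF'.isCartesianFunctor (BasedFunctor.comp G U))
      (hF'.isCartesianFunctor (BasedFunctor.comp G' U)) (BasedCategory.whiskerRight β U)
      (BasedCategory.whiskerRight β' U) fun V hV => congrArg U.map (h V hV)
    apply BasedNatTrans.homCategory.ext
    ext V
    exact LiftingHom.ext (congrArg (fun t : BasedFunctor.comp G U ⟶ BasedFunctor.comp G' U =>
      t.app V) e)
  · -- Extend the underlying objects in `F` to a functor `G`.
    obtain ⟨G, -, ⟨e⟩⟩ := hF.exists_extend_obj hR (BasedFunctor.comp D U)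
      (hF'.isCartesianFunctor _)
    let X (V : Over S) (hV : R V.hom) : Lifting γ s := D.obj (sieveObj V hV)
    let r {V W : Over S} (hV : R V.hom) (hW : R W.hom) (k : V ⟶ W) :
      LiftingHom (X V hV) (X W hW) := D.map (sieveHom hV hW k)
    let y (V : Over S) : F.obj := G.obj V
    let g {V W : Over S} (k : V ⟶ W) : y V ⟶ y W := G.map k
    let ε (V : Over S) (hV : R V.hom) : y V ⟶ (X V hV).pt := e.hom.app (sieveObj V hV)
    have hε : ∀ V hV, F.p.IsHomLift (𝟙 V.left) (ε V hV) := fun V hV =>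
      e.hom.isHomLift' (sieveObj V hV)
    have hXp : ∀ V hV, F.p.obj (X V hV).pt = V.left := fun V hV => D.w_obj (sieveObj V hV)
    have hyp : ∀ V, F.p.obj (y V) = V.left := fun V => G.w_obj V
    have hr : ∀ {V W} (hV hW) (k : V ⟶ W), F.p.map (r hV hW k).hom ≫ eqToHom (hXp W hW) =
        eqToHom (hXp V hV) ≫ k.left := fun hV hW k => by
      have : (sieveBased R).p.IsHomLift k.left (sieveHom hV hW k) := IsHomLift.map _ _
      exact map_comp_eqToHom (hXp _ hV) (hXp _ hW)
        (BasedFunctor.preserves_isHomLift (BasedFunctor.comp D U) _ _)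
    have hg : ∀ {V W} (k : V ⟶ W), eqToHom (hyp V).symm ≫ F.p.map (g k) =
        k.left ≫ eqToHom (hyp W).symm := fun k => by
      have : (overBased S).p.IsHomLift k.left k := IsHomLift.map _ _
      exact eqToHom_comp_map (hyp _) (hyp _) (BasedFunctor.preserves_isHomLift G _ _)
    have hn : ∀ {V W} (hV hW) (k : V ⟶ W), g k ≫ ε W hW = ε V hV ≫ (r hV hW k).hom :=
      fun hV hW k => e.hom.naturality (sieveHom hV hW k)
    -- The identifications, given on the sieve, extend by the stack condition of `H`.
    let b (V : Over S) (hV : R V.hom) : γ.obj (y V) ⟶ s.obj V.left :=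
      γ.map (ε V hV) ≫ (X V hV).iso.hom ≫ s.map (eqToHom (hXp V hV))
    have hb : ∀ V hV, H.p.IsHomLift (𝟙 V.left) (b V hV) := fun V hV => by
      have h₁ : H.p.IsHomLift (𝟙 V.left) (γ.map (ε V hV)) :=
        have := hε V hV
        BasedFunctor.preserves_isHomLift γ _ _
      have h₂ := s.isHomLift_comp_eqToHom (hXp V hV) (X V hV).vertical
      have : H.p.IsHomLift (𝟙 V.left ≫ 𝟙 V.left) (b V hV) := inferInstance
      rwa [Category.comp_id] at this
    have hb' : ∀ {V W} (hV hW) (k : V ⟶ W), γ.map (g k) ≫ b W hW = b V hV ≫ s.map k.left :=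
      fun {V W} hV hW k => by
        rw [← Category.assoc, ← Functor.map_comp, hn, Functor.map_comp, Category.assoc,
          ← Category.assoc (γ.map (r hV hW k).hom), ← (r hV hW k).comm, Category.assoc,
          ← Functor.map_comp, hr, Functor.map_comp, Category.assoc, Category.assoc]
    let β : BasedFunctor.comp (sieveInclusion R) (BasedFunctor.comp G γ) ⟶
        BasedFunctor.comp (sieveInclusion R) (s.restrict S) :=
      { toNatTrans :=
          { app := fun V => b V.1 V.2
            naturality := fun V W k => by
              exact (hb' V.2 W.2 k.hom) }
        isHomLift' := fun V => by
          exact hb V.1 V.2 }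
    obtain ⟨δ, hδ⟩ := hH.exists_extend_hom hR (hH'.isCartesianFunctor _)
      (hH'.isCartesianFunctor _) β
    let d (V : Over S) : γ.obj (y V) ⟶ s.obj V.left := δ.app V
    have hd : ∀ V, H.p.IsHomLift (𝟙 V.left) (d V) := fun V => δ.isHomLift' V
    have hd' : ∀ V, IsIso (d V) := fun V => hH'.groupoids _ _ (hd V)
    have hdb : ∀ V hV, d V = b V hV := hδ
    have hdn : ∀ {V W} (k : V ⟶ W), γ.map (g k) ≫ d W = d V ≫ s.map k.left :=
      fun k => δ.naturality k
    -- The extended objects with the extended identifications.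
    let Y (V : Over S) : Lifting γ s :=
      { pt := y V
        iso := asIso (d V) ≪≫ s.mapIso (eqToIso (hyp V).symm)
        vertical := by
          exact s.isHomLift_comp_eqToHom (hyp V).symm (hd V) }
    have hY : ∀ V hV, (Y V).iso.hom ≫ s.map (F.p.map (ε V hV)) =
        γ.map (ε V hV) ≫ (X V hV).iso.hom := fun V hV => by
      change (d V ≫ s.map (eqToHom (hyp V).symm)) ≫ _ = _
      have e₂ : eqToHom (hXp V hV) ≫ eqToHom (hyp V).symm ≫ F.p.map (ε V hV) = 𝟙 _ := by
        rw [eqToHom_comp_map (hyp V) (hXp V hV) (hε V hV), Category.id_comp, eqToHom_trans,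
          eqToHom_refl]
      rw [hdb V hV, Category.assoc, Category.assoc, Category.assoc, ← Functor.map_comp,
        ← Functor.map_comp, e₂, s.map_id, Category.comp_id]
    have hYg : ∀ {V W} (k : V ⟶ W), (Y V).iso.hom ≫ s.map (F.p.map (g k)) =
        γ.map (g k) ≫ (Y W).iso.hom := fun {V W} k => by
      change (d V ≫ s.map (eqToHom (hyp V).symm)) ≫ s.map (F.p.map (g k)) =
        γ.map (g k) ≫ d W ≫ s.map (eqToHom (hyp W).symm)
      rw [← Category.assoc (γ.map (g k)), hdn, Category.assoc, Category.assoc,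
        ← Functor.map_comp, ← Functor.map_comp, hg]
    let G' : overBased S ⥤ᵇ liftings γ s :=
      { obj := Y
        map := fun {V W} k => (⟨g k, hYg k⟩ : LiftingHom (Y V) (Y W))
        map_id := fun V => LiftingHom.ext (G.map_id V)
        map_comp := fun k l => LiftingHom.ext (G.map_comp k l)
        w := G.w }
    let α : BasedFunctor.comp (sieveInclusion R) G' ⟶ D :=
      { toNatTrans :=
          { app := fun V => (⟨ε V.1 V.2, hY V.1 V.2⟩ : LiftingHom (Y V.1) (X V.1 V.2))
            naturality := fun V W k => LiftingHom.ext (e.hom.naturality k) }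
        isHomLift' := fun V => (Lifting.isHomLift_iff _ _).2 (e.hom.isHomLift' V) }
    have hα (V : (sieveBased R).obj) : IsIso (α.app V) := hK.groupoids _ _ (α.isHomLift' V)
    have : IsIso (X := (BasedFunctor.comp (sieveInclusion R) G').toFunctor) α.toNatTrans :=
      NatIso.isIso_of_isIso_app _
    have := BasedNatIso.isIso_of_toNatTrans_isIso α
    exact ⟨G', ⟨asIso α⟩⟩

end LiftingStack

/-! ### The gerbe of liftings of a section -/

section LiftingGerbe

variable {E : Type u} [Category.{v} E] {J : GrothendieckTopology E}
  {F : BasedCategory.{v₁, u₁} E} {H : BasedCategory.{v₂, u₂} E} {γ : F ⥤ᵇ H}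
  {s : CartesianSection H}

/-- A lifting of `s` can be restricted along every arrow of `F`. -/
lemma Lifting.exists_restrict (hH : IsFiberedInGroupoids H) (Z : Lifting γ s) {z : F.obj}
    (m : z ⟶ Z.pt) : ∃ (A : Lifting γ s) (n : A ⟶ Z), ∃ h : z = A.pt,
      eqToHom h ≫ LiftingHom.hom n = m := by
  obtain ⟨e, he, hc⟩ := hH.exists_iso (F.p.map m) (s.map (F.p.map m)) (s.isHomLift _)
    (γ.map m ≫ Z.iso.hom) (Z.isHomLift_comp_iso m inferInstance)
  exact ⟨⟨z, e, he⟩, (⟨m, hc⟩ : LiftingHom _ Z), rfl, Category.id_comp _⟩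

/-- Locally, every object of `F` has an inverse image which underlies a lifting of `s`. -/
lemma exists_lifting_locally (hF : IsFiberedInGroupoids F) (hH : IsGerbe J H) {S : E} (x : F.obj)
    (hx : F.p.obj x = S) :
    ∃ R ∈ J S, ∀ ⦃W : E⦄ (g : W ⟶ S), R g → ∃ Z : Lifting γ s, F.p.obj Z.pt = W := by
  have hH' := hH.isFiberedInGroupoids
  obtain ⟨R, hR, h⟩ := hH.locally_isomorphic S (γ.obj x) (s.obj S) ((γ.w_obj x).trans hx)
    (s.obj_base S)
  refine ⟨R, hR, fun W g hg => ?_⟩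
  obtain ⟨x', y', m, n, e, hm, hn, he⟩ := h g hg
  obtain ⟨z, r, hr⟩ := hF.exists_pull x hx g
  obtain ⟨e₁, he₁, -⟩ := hH'.exists_iso g m hm.toIsHomLift (γ.map r)
    (BasedFunctor.preserves_isHomLift γ _ _)
  obtain ⟨e₂, he₂, -⟩ := hH'.exists_iso g (s.map g) (s.isHomLift g) n hn.toIsHomLift
  obtain rfl : F.p.obj z = W := IsHomLift.domain_eq F.p g r
  refine ⟨⟨z, e₁ ≪≫ e ≪≫ e₂, ?_⟩, rfl⟩
  have : H.p.IsHomLift (𝟙 (F.p.obj z) ≫ 𝟙 (F.p.obj z) ≫ 𝟙 (F.p.obj z))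
    (e₁.hom ≫ e.hom ≫ e₂.hom) := inferInstance
  simpa using this

variable {Φ Φ' : CrossedSheaf.{w} J} {X : CrossedGerbeStructure Φ F}
  {X' : CrossedGerbeStructure Φ' H} {η : CrossedHom Φ Φ'}

/-- If `A ⟶ A'` is an epimorphism, then any two liftings of `s` along an `η`-morphism are locally
isomorphic. -/
lemma liftings_locally_isomorphic (hγ : IsCrossedMorphism η X X' γ)
    (hη : Presheaf.IsLocallySurjective J η.f.hom) (S : E) (Z Z' : Lifting γ s)
    (hZ : F.p.obj Z.pt = S) (hZ' : F.p.obj Z'.pt = S) :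
    ∃ R ∈ J S, ∀ ⦃T : E⦄ (f : T ⟶ S), R f → ∃ (A : Lifting γ s) (m : LiftingHom A Z)
      (m' : LiftingHom A Z'), F.p.IsHomLift f m.hom ∧ F.p.IsHomLift f m'.hom := by
  let n : γ.obj Z.pt ⟶ γ.obj Z'.pt :=
    Z.iso.hom ≫ s.map (eqToHom (hZ.trans hZ'.symm)) ≫ Z'.iso.inv
  have hn : H.p.IsHomLift (𝟙 S) n := by
    have h₁ := s.isHomLift_comp_eqToHom (hZ.trans hZ'.symm) Z.vertical
    have h₂ : H.p.IsHomLift (𝟙 (F.p.obj Z'.pt)) Z'.iso.inv :=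
      have := Z'.vertical
      inferInstance
    have : H.p.IsHomLift (𝟙 (F.p.obj Z'.pt) ≫ 𝟙 (F.p.obj Z'.pt))
      ((Z.iso.hom ≫ s.map (eqToHom (hZ.trans hZ'.symm))) ≫ Z'.iso.inv) := inferInstance
    rw [Category.comp_id, Category.assoc] at this
    exact hZ' ▸ this
  obtain ⟨R, hR, h⟩ := hγ.locally_full hη hZ hZ' n hn
  refine ⟨R, hR, fun T f hf => ?_⟩
  obtain ⟨z, m, m', hm, hm', e⟩ := h f hf
  obtain ⟨A, r, rfl, hr⟩ := Z.exists_restrict X'.isGerbe.isFiberedInGroupoids m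
  rw [eqToHom_refl, Category.id_comp] at hr
  refine ⟨A, r, ⟨m', ?_⟩, hr ▸ hm, hm'⟩
  have e' : F.p.map m' = F.p.map m ≫ eqToHom (hZ.trans hZ'.symm) := by
    subst hZ
    rw [isHomLift_iff_map_eq] at hm
    obtain ⟨rfl, h₁⟩ := hm
    have := map_comp_eqToHom rfl hZ' hm'
    rw [h₁, ← cancel_mono (eqToHom hZ'), this]
    simp
  rw [← e, ← hr, e', ← hr, Functor.map_comp, ← Category.assoc, r.comm]
  simp [n]

/-- If `A ⟶ A'` is an epimorphism, then the liftings of a section along an `η`-morphism form a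
gerbe. -/
theorem liftings_isGerbe (hγ : IsCrossedMorphism η X X' γ)
    (hη : Presheaf.IsLocallySurjective J η.f.hom) : IsGerbe J (liftings γ s) := by
  have hF := X.isGerbe.isFiberedInGroupoids
  have hH := X'.isGerbe.isFiberedInGroupoids
  have hK : IsFiberedInGroupoids (liftings γ s) := liftings_isFiberedInGroupoids hF hH
  refine ⟨liftings_isStack X.isGerbe.stack X'.isGerbe.stack hF hH, hK.groupoids, ?_, ?_⟩
  · refine ⟨{S | ∃ Z : Lifting γ s, F.p.obj Z.pt = S}, ?_, fun S => ?_, ?_⟩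
    · rintro T S f ⟨Z, hZ⟩
      obtain ⟨A, m, hm⟩ := hK.exists_pull (𝒳 := liftings γ s) Z hZ f
      exact ⟨A, IsHomLift.domain_eq (liftings γ s).p f m⟩
    · let C : Sieve S :=
        { arrows := fun T _ => ∃ Z : Lifting γ s, F.p.obj Z.pt = T
          downward_closed := by
            rintro T T' f ⟨Z, hZ⟩ g
            obtain ⟨A, m, hm⟩ := hK.exists_pull (𝒳 := liftings γ s) Z hZ g
            exact ⟨A, IsHomLift.domain_eq (liftings γ s).p g m⟩ }
      refine ⟨C, ?_, fun T f => Iff.rfl⟩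
      obtain ⟨R₀, -, h₁, h₂⟩ := X.isGerbe.locally_nonempty
      obtain ⟨C₀, hC₀, hc⟩ := h₁ S
      obtain ⟨R, hR, h⟩ := bind_cover (J := J) (S := S)
        (p := fun T _ => ∃ Z : Lifting γ s, F.p.obj Z.pt = T)
        ⟨C₀, hC₀, fun T f hf => by
          obtain ⟨x, hx⟩ := h₂ T ((hc f).1 hf)
          exact exists_lifting_locally hF X'.isGerbe x hx⟩
      exact J.superset_covering (fun T f hf => h f hf) hR
    · rintro S ⟨Z, hZ⟩
      exact ⟨Z, hZ⟩
  · intro S Z Z' hZ hZ'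
    obtain ⟨R, hR, h⟩ := liftings_locally_isomorphic hγ hη S Z Z' hZ hZ'
    refine ⟨R, hR, fun T f hf => ?_⟩
    obtain ⟨A, m, m', hm, hm'⟩ := h f hf
    refine ⟨A, A, m, m', Iso.refl _, ?_, ?_, ?_⟩
    · exact hK.isCartesian _ _ ((Lifting.isHomLift_iff _ _).2 hm)
    · exact hK.isCartesian _ _ ((Lifting.isHomLift_iff _ _).2 hm')
    · exact IsHomLift.id (IsHomLift.domain_eq F.p f m.hom)

end LiftingGerbe

/-! ### The automorphisms of a lifting and the structure on the gerbe of liftings -/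

section LiftingStructure

variable {E : Type u} [Category.{v} E] {J : GrothendieckTopology E} {Φ Φ' Φ'' : CrossedSheaf.{w} J}

section Contracted

variable (θ : CrossedHom Φ Φ') [IsIso θ.φ] {S : E} (P : Torsor Φ'.Pi S) (U : Over S)

/-- The homomorphism `P ∧ A ⟶ P ∧ A'` given by a morphism of sheaves of crossed groups which is an
isomorphism on `Π`. -/
def contractedHom : ContractedSection (P.restrict θ.φ) Φ.leftObj U →*
    ContractedSection P Φ'.leftObj U where
  toFun c :=
    { toFun := fun V k p => app θ.f V.left (c.aval V k p)
      map_res := fun {V W} l k p => by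
        exact (congrArg (app θ.f W.left) (c.aval_res l k p)).trans (app_res θ.f l.left _)
      map_act := fun {V} k p g => by
        obtain ⟨g, rfl⟩ := (app_bijective θ.φ V.left).2 g
        refine (congrArg (app θ.f V.left) (c.aval_act k p g)).trans ((θ.map_smul _ _).trans ?_)
        rw [map_inv]
        rfl }
  map_one' := ContractedSection.ext_toFun fun V k p => map_one (app θ.f V.left)
  map_mul' c d := ContractedSection.ext_toFun fun V k p => map_mul (app θ.f V.left) _ _

variable {η : CrossedHom Φ' Φ''}

/-- `P ∧ A ⟶ P ∧ A'` is injective. -/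
lemma contractedHom_injective (hex : IsShortExact θ η) :
    Function.Injective (contractedHom θ P U) := fun _ _ h =>
  ContractedSection.ext_toFun fun V k p => hex.f_injective V.left
    (congrArg (fun t : ContractedSection P Φ'.leftObj U => t.aval V k p) h)

/-- The image of `P ∧ A ⟶ P ∧ A'` is the kernel of `P ∧ A' ⟶ P ∧ A''`. -/
lemma mem_range_contractedHom_iff (hex : IsShortExact θ η)
    (c : ContractedSection P Φ'.leftObj U) :
    c ∈ (contractedHom θ P U).range ↔
      ∀ (V : Over S) (k : V ⟶ U) p, app η.f V.left (c.aval V k p) = 1 := by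
  constructor
  · rintro ⟨c, rfl⟩ V k p
    exact (hex.exact _ _).2 ⟨c.aval V k p, rfl⟩
  · intro h
    choose a ha using fun V k p => (hex.exact _ _).1 (h V k p)
    refine ⟨{ toFun := a
              map_res := fun {V W} l k p => hex.f_injective W.left ?_
              map_act := fun {V} k p g => hex.f_injective V.left ?_ },
      ContractedSection.ext_toFun fun V k p => ha V k p⟩
    · refine (ha _ _ _).trans ((c.aval_res l k p).trans ?_)
      exact (congrArg (res Φ'.A l.left) (ha V k p).symm).trans (app_res θ.f l.left _).symm
    · refine (ha _ _ _).trans ((c.aval_act k p _).trans ?_)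
      refine Eq.trans ?_ (θ.map_smul _ _).symm
      rw [map_inv (app θ.φ V.left)]
      exact congrArg _ (ha V k p).symm

end Contracted

variable {F : BasedCategory.{v₁, u₁} E} {H : BasedCategory.{v₂, u₂} E} {γ : F ⥤ᵇ H}
  {s : CartesianSection H}

lemma vautMap_liftingsForget_injective (Z : Lifting γ s) :
    Function.Injective (vautMap (liftingsForget γ s) Z) := fun σ τ h => by
  refine Subtype.ext (Iso.ext (LiftingHom.ext ?_))
  exact congrArg (fun t : VAut F Z.pt => t.1.hom) h

/-- The automorphisms of a lifting are the automorphisms in the kernel of `γ`. -/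
lemma mem_range_vautMap_liftingsForget_iff (Z : Lifting γ s) (τ : VAut F Z.pt) :
    τ ∈ (vautMap (liftingsForget γ s) Z).range ↔ vautMap γ Z.pt τ = 1 := by
  constructor
  · rintro ⟨σ, rfl⟩
    let m : LiftingHom Z Z := σ.1.hom
    have h : Z.iso.hom ≫ s.map (F.p.map m.hom) = γ.map m.hom ≫ Z.iso.hom := m.comm
    rw [show F.p.map m.hom = 𝟙 _ from σ.2, s.map_id, Category.comp_id] at h
    refine Subtype.ext (Iso.ext ?_)
    change γ.map m.hom = 𝟙 _
    rw [← cancel_mono Z.iso.hom, ← h, Category.id_comp]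
  · intro h
    have h₁ : γ.map τ.1.hom = 𝟙 _ := congrArg (fun t : VAut H (γ.obj Z.pt) => t.1.hom) h
    have h₂ : γ.map τ.1.inv = 𝟙 _ := congrArg (fun t : VAut H (γ.obj Z.pt) => t.1.inv) h
    have comm (m : Z.pt ⟶ Z.pt) (hm : F.p.map m = 𝟙 _) (hm' : γ.map m = 𝟙 _) :
        Z.iso.hom ≫ s.map (F.p.map m) = γ.map m ≫ Z.iso.hom := by
      rw [hm, hm', s.map_id, Category.comp_id, Category.id_comp]
    let e : Aut (C := (liftings γ s).obj) Z :=
      { hom := (⟨τ.1.hom, comm _ τ.2 h₁⟩ : LiftingHom Z Z)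
        inv := (⟨τ.1.inv, comm _ (τ⁻¹).2 h₂⟩ : LiftingHom Z Z)
        hom_inv_id := LiftingHom.ext τ.1.hom_inv_id
        inv_hom_id := LiftingHom.ext τ.1.inv_hom_id }
    exact ⟨⟨e, τ.2⟩, Subtype.ext (Iso.ext rfl)⟩

variable {X : CrossedGerbeStructure Φ' F} {Y : CrossedGerbeStructure Φ'' H} {η : CrossedHom Φ' Φ''}

/-- The sequence `1 ⟶ P ∧ A ⟶ P ∧ A' ⟶ P ∧ A''` for `P = μ(z)` is exact, and the automorphisms of a
lifting `(z, α)` are the kernel of `Aut(z) ⟶ Aut(γ(z))`; hence they correspond to `P ∧ A`. -/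
lemma range_vautMap_eq_range_contractedHom (θ : CrossedHom Φ Φ') [IsIso θ.φ]
    (hex : IsShortExact θ η) (hγ : IsCrossedMorphism η X Y γ) (Z : Lifting γ s) :
    ((X.j Z.pt).toMonoidHom.comp (vautMap (liftingsForget γ s) Z)).range =
      (contractedHom θ (X.tors Z.pt) (Over.mk (𝟙 _))).range := by
  have key (τ : VAut F Z.pt) : τ ∈ (vautMap (liftingsForget γ s) Z).range ↔
      X.j Z.pt τ ∈ (contractedHom θ (X.tors Z.pt) (Over.mk (𝟙 _))).range := by
    rw [mem_range_vautMap_liftingsForget_iff, hγ.vautMap_eq_one_iff,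
      mem_range_contractedHom_iff θ _ _ hex]
    refine ⟨fun h V k p => ?_, fun h V p => h V _ p⟩
    obtain rfl : k = Over.mkIdTerminal.from V := Over.mkIdTerminal.hom_ext _ _
    exact h V p
  ext c
  obtain ⟨τ, rfl⟩ := (X.j Z.pt).surjective c
  rw [← key]
  constructor
  · rintro ⟨σ, hσ⟩
    exact ⟨σ, (X.j Z.pt).injective hσ⟩
  · rintro ⟨σ, rfl⟩
    exact ⟨σ, rfl⟩

/-- The isomorphism `j` of the gerbe of liftings, from the automorphisms of a lifting `(z, α)` to
`μ(z) ∧ A`, where `μ(z)` is regarded as a torsor under `Π ≅ Π'`. -/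
noncomputable def liftingsJ (θ : CrossedHom Φ Φ') [IsIso θ.φ] (hex : IsShortExact θ η)
    (hγ : IsCrossedMorphism η X Y γ) (Z : Lifting γ s) :
    VAut (liftings γ s) Z ≃*
      ContractedSection ((X.tors Z.pt).restrict θ.φ) Φ.leftObj (Over.mk (𝟙 _)) :=
  (MonoidHom.ofInjective (f := (X.j Z.pt).toMonoidHom.comp (vautMap (liftingsForget γ s) Z))
    ((X.j Z.pt).injective.comp (vautMap_liftingsForget_injective Z))).trans
  ((MulEquiv.subgroupCongr (range_vautMap_eq_range_contractedHom θ hex hγ Z)).trans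
    (MonoidHom.ofInjective (contractedHom_injective θ _ _ hex)).symm)

/-- The defining property of `liftingsJ`. -/
lemma contractedHom_liftingsJ (θ : CrossedHom Φ Φ') [IsIso θ.φ] (hex : IsShortExact θ η)
    (hγ : IsCrossedMorphism η X Y γ) (Z : Lifting γ s) (σ : VAut (liftings γ s) Z) :
    contractedHom θ _ _ (liftingsJ θ hex hγ Z σ) =
      X.j Z.pt (vautMap (liftingsForget γ s) Z σ) := by
  have := (MonoidHom.ofInjective
    (contractedHom_injective θ (X.tors Z.pt) (Over.mk (𝟙 _)) hex)).apply_symm_apply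
    (MulEquiv.subgroupCongr (range_vautMap_eq_range_contractedHom θ hex hγ Z)
      (MonoidHom.ofInjective
      (f := (X.j Z.pt).toMonoidHom.comp (vautMap (liftingsForget γ s) Z))
      ((X.j Z.pt).injective.comp (vautMap_liftingsForget_injective Z)) σ))
  exact congrArg Subtype.val this

/-- `liftingsJ` in terms of values: the value of an automorphism of a lifting maps to the value of
the underlying automorphism. -/
lemma liftingsJ_val (θ : CrossedHom Φ Φ') [IsIso θ.φ] (hex : IsShortExact θ η)
    (hγ : IsCrossedMorphism η X Y γ) (Z : Lifting γ s) (σ : VAut (liftings γ s) Z)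
    {V : Over (X.base Z.pt)} {p : (X.tors Z.pt).carrier.obj (op V)} {a : Sec Φ.A V.left} :
    (liftingsJ θ hex hγ Z σ).IsLocalRep V p a ↔
      X.val Z.pt (vautMap (liftingsForget γ s) Z σ) V p = app θ.f V.left a := by
  refine (liftingsJ θ hex hγ Z σ).isLocalRep_iff.trans ?_
  have h : app θ.f V.left ((liftingsJ θ hex hγ Z σ).aval V (Over.mkIdTerminal.from V) p) =
      X.val Z.pt (vautMap (liftingsForget γ s) Z σ) V p :=
    congrArg (fun c : ContractedSection (X.tors Z.pt) Φ'.leftObj (Over.mk (𝟙 _)) =>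
      c.aval V (Over.mkIdTerminal.from V) p) (contractedHom_liftingsJ θ hex hγ Z σ)
  rw [← h]
  exact (hex.f_injective V.left).eq_iff.symm

/-- The structure of `(A, Π)`-gerbe on the gerbe of liftings. -/
noncomputable def liftingsStructure (θ : CrossedHom Φ Φ') [IsIso θ.φ] (hex : IsShortExact θ η)
    (hγ : IsCrossedMorphism η X Y γ) : CrossedGerbeStructure Φ (liftings γ s) where
  isGerbe := liftings_isGerbe hγ hex.h_epi
  μ := BasedFunctor.comp (BasedFunctor.comp (liftingsForget γ s) X.μ) (torsRestrict θ.φ)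
  μ_cartesian := fun _ _ f a b φ h => by
    have := h.toIsHomLift
    have := torsStack_isStronglyCartesian Φ.Pi ((BasedFunctor.comp (BasedFunctor.comp
      (liftingsForget γ s) X.μ) (torsRestrict θ.φ)).map φ) f
      (BasedFunctor.preserves_isHomLift _ _ _)
    infer_instance
  j := liftingsJ θ hex hγ
  j_natural A Z m τ σ h V p a ha := by
    refine (liftingsJ_val θ hex hγ Z σ).2 ?_
    refine Eq.trans ?_ ((liftingsJ_val θ hex hγ A τ).1 ha)
    exact X.val_natural (LiftingHom.hom m) (τ := vautMap (liftingsForget γ s) A τ)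
      (σ := vautMap (liftingsForget γ s) Z σ) (congrArg LiftingHom.hom h) V p
  condition Z σ V α a ha := by
    have := X.condition Z.pt (vautMap (liftingsForget γ s) Z σ) V α _
      (X.isLocalRep_iff.2 ((liftingsJ_val θ hex hγ Z σ).1 ha))
    rw [← θ.comm] at this
    exact this

/-- The projection from the gerbe of liftings is a `θ`-morphism. The isomorphism `i` of the
definition is `[(p, u)] ↦ p·u`, the inverse of `p ↦ [(p, 1)]`. -/
theorem liftingsForget_isCrossedMorphism (θ : CrossedHom Φ Φ') [IsIso θ.φ]
    (hex : IsShortExact θ η) (hγ : IsCrossedMorphism η X Y γ) :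
    IsCrossedMorphism θ (liftingsStructure θ hex hγ) X (liftingsForget γ s) where
  cartesian := X.isGerbe.isFiberedInGroupoids.isCartesianFunctor _
  exists_iso := by
    obtain ⟨e, he⟩ := exists_restrictExtensionIso θ.φ
    let M := BasedFunctor.comp (liftingsForget γ s) X.μ
    refine ⟨⟨BasedCategory.whiskerLeft M e.inv, BasedCategory.whiskerLeft M e.hom, ?_, ?_⟩,
      fun (Z : Lifting γ s) σ V p a ha => ?_⟩
    · apply BasedNatTrans.homCategory.ext
      ext Z
      exact congrArg (fun t : BasedFunctor.comp (torsRestrict θ.φ) (torsStackMap θ.φ) ⟶ _ =>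
        t.app (M.obj Z)) e.inv_hom_id
    · apply BasedNatTrans.homCategory.ext
      ext Z
      exact congrArg (fun t : BasedFunctor.id _ ⟶ BasedFunctor.id (torsStack Φ'.Pi) =>
        t.app (M.obj Z)) e.hom_inv_id
    · have hv := (liftingsJ_val θ hex hγ Z σ).1 ha
      refine X.isLocalRep_iff.2 (Eq.trans ?_ hv)
      let σ' := vautMap (liftingsForget γ s) Z σ
      let P : TorsObj Φ'.Pi := X.μ.obj Z.pt
      let n : TorsHom (⟨P.base, (P.torsor.restrict θ.φ).extension θ.φ⟩ : TorsObj Φ'.Pi) P :=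
        e.inv.app (X.μ.obj Z.pt)
      have e₁ : TorsHom.comp (toRestrictExtension θ.φ P) n = TorsHom.id P := by
        have := congrArg (fun t : BasedFunctor.id _ ⟶ BasedFunctor.id (torsStack Φ'.Pi) =>
          t.app (X.μ.obj Z.pt)) e.hom_inv_id
        refine Eq.trans ?_ this
        exact congrArg (fun t => TorsHom.comp t n) (he P).symm
      have e₂ := X.valMap_comp Z.pt σ' (toRestrictExtension θ.φ P) n V p
      rw [e₁] at e₂
      refine Eq.trans ?_ (e₂.symm.trans (X.valMap_id Z.pt σ' V p))
      let l : (Over.map (𝟙 P.base)).obj V ⟶ V := overEq (by simp)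
      have e₃ := X.valMap_res Z.pt σ' n l ((P.torsor.restrict θ.φ).toExtension θ.φ p)
      exact (e₃.trans (res_id _ _)).symm

end LiftingStructure

/-! ### Reduction to the kernel of a morphism of sheaves of crossed groups -/

section Reduction

variable {E : Type u} [Category.{v} E] {J : GrothendieckTopology E} {Φ Φ' Φ'' : CrossedSheaf.{w} J}
  {𝒢 𝒢' : BasedCategory.{v₁, u₁} E}

/-- An `(A, Π)`-gerbe reduces to the kernel of `η : (A, Π) ⟶ (A', Π')` if it has an atlas in which
any two distinguished arrows over the same arrow of `E` differ by an automorphism in this kernel.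
The universe of the index set is large enough for the objects of `E` and of the gerbe, and for the
inverse images of atlases. -/
def CrossedGerbeStructure.Reduces (X : CrossedGerbeStructure Φ 𝒢) (η : CrossedHom Φ Φ') : Prop :=
  ∃ 𝒜 : Atlas.{v₁, u₁, v, u, max u u₁ v₁} J 𝒢, ∀ ⦃i j⦄ ⦃m n : 𝒜.obj i ⟶ 𝒜.obj j⦄,
    m ∈ 𝒜.hom i j → n ∈ 𝒜.hom i j → ∀ τ : VAut 𝒢 (𝒜.obj i), m = τ.1.hom ≫ n → X.InKer η τ

namespace CrossedGerbeStructure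

/-- Arrows over the same arrow of `E` with the same source and target differ by an automorphism. -/
lemma exists_vaut_comp (X : CrossedGerbeStructure Φ 𝒢) {x y : 𝒢.obj} {m n : x ⟶ y}
    (h : 𝒢.p.map m = 𝒢.p.map n) : ∃ τ : VAut 𝒢 x, m = τ.1.hom ≫ n := by
  obtain ⟨e, he, h⟩ := X.isGerbe.isFiberedInGroupoids.exists_iso (𝒢.p.map n) n inferInstance m
    (h ▸ inferInstance)
  exact ⟨⟨e, (IsHomLift.eq_of_isHomLift _ _ _).symm⟩, h.symm⟩

lemma map_vaut_comp {x y : 𝒢.obj} (τ : VAut 𝒢 x) (n : x ⟶ y) :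
    𝒢.p.map (τ.1.hom ≫ n) = 𝒢.p.map n := by
  rw [Functor.map_comp, show 𝒢.p.map τ.1.hom = 𝟙 _ from τ.2, Category.id_comp]

/-- The local existence of objects, stated with a covering sieve. -/
lemma locally_nonempty (X : CrossedGerbeStructure Φ 𝒢) (S : E) :
    ∃ R ∈ J S, ∀ ⦃V : E⦄ (f : V ⟶ S), R f → ∃ x : 𝒢.obj, 𝒢.p.obj x = V := by
  obtain ⟨R₀, -, h₁, h₂⟩ := X.isGerbe.locally_nonempty
  obtain ⟨C, hC, hc⟩ := h₁ S
  exact ⟨C, hC, fun V f hf => h₂ V ((hc f).1 hf)⟩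

/-- A gerbe with a section reduces to the trivial group: the values of the section form an atlas. -/
lemma reduces_id_of_section (X : CrossedGerbeStructure Φ 𝒢) (s : CartesianSection 𝒢) :
    X.Reduces (CrossedHom.id Φ) := by
  refine ⟨{
    ι := ULift.{max u₁ v₁} E
    obj := fun i => s.obj i.down
    hom := fun i j => Set.range fun f : i.down ⟶ j.down => s.map f
    comp := ?_
    restrict := ?_
    cover := fun S => ⟨⊤, J.top_mem S, fun V _ _ => ⟨⟨V⟩, s.obj_base V⟩⟩
    connect := ?_ }, ?_⟩
  · rintro i j k _ _ ⟨f, rfl⟩ ⟨g, rfl⟩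
    exact ⟨f ≫ g, s.map_comp f g⟩
  · rintro ⟨i⟩ S T h g
    obtain rfl : i = S := (s.obj_base i).symm.trans h
    exact ⟨⟨T⟩, s.map g, ⟨g, rfl⟩, s.isHomLift g⟩
  · rintro S ⟨i⟩ ⟨j⟩ hi hj
    obtain rfl : i = S := (s.obj_base i).symm.trans hi
    obtain rfl : j = i := (s.obj_base j).symm.trans hj
    exact ⟨⊤, J.top_mem _, fun T g _ =>
      ⟨⟨T⟩, s.map g, ⟨g, rfl⟩, s.map g, ⟨g, rfl⟩, s.isHomLift g, s.isHomLift g⟩⟩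
  · rintro ⟨i⟩ ⟨j⟩ _ _ ⟨f, rfl⟩ ⟨g, rfl⟩ τ h
    replace h : s.map f = τ.1.hom ≫ s.map g := h
    have e : 𝒢.p.map (s.map f) = 𝒢.p.map (s.map g) := by rw [h, map_vaut_comp]
    obtain rfl : f = g := by
      have e₁ := map_comp_eqToHom (s.obj_base i) (s.obj_base j) (s.isHomLift f)
      have e₂ := map_comp_eqToHom (s.obj_base i) (s.obj_base j) (s.isHomLift g)
      rw [e, e₂] at e₁
      exact ((cancel_epi _).1 e₁).symm
    obtain rfl : τ = 1 := Subtype.ext (Iso.ext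
      (X.isGerbe.isFiberedInGroupoids.cancel' (s.map f) (τ.2.trans (𝒢.p.map_id _).symm)
        (h.symm.trans (Category.id_comp _).symm)))
    exact X.inKer_one _ _

/-- A gerbe which reduces to the trivial group has a section, because the atlas is rigid. -/
lemma Reduces.nonempty_section {X : CrossedGerbeStructure Φ 𝒢}
    (h : X.Reduces (CrossedHom.id Φ)) : Nonempty (CartesianSection 𝒢) := by
  obtain ⟨𝒜, h⟩ := h
  refine 𝒜.nonempty_cartesianSection X.isGerbe.stack X.isGerbe.isFiberedInGroupoids
    fun i j m n hm hn e => ?_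
  obtain ⟨τ, rfl⟩ := X.exists_vaut_comp e
  obtain rfl : τ = 1 := X.inKer_id_iff.1 (h hm hn τ rfl)
  exact Category.id_comp n

/-- Every gerbe reduces to the kernel of a morphism which is trivial on `A`: all its arrows can be
distinguished. -/
lemma reduces_of_eq_one (X : CrossedGerbeStructure Φ 𝒢) (η : CrossedHom Φ Φ')
    (h : ∀ (U : E) (a : Sec Φ.A U), app η.f U a = 1) : X.Reduces η := by
  have hX := X.isGerbe.isFiberedInGroupoids
  refine ⟨{
    ι := ULift.{max u v₁} 𝒢.obj
    obj := fun x => x.down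
    hom := fun _ _ => Set.univ
    comp := fun _ _ => trivial
    restrict := ?_
    cover := ?_
    connect := ?_ }, fun _ _ _ _ _ _ τ _ V p => h _ _⟩
  · rintro ⟨x⟩ S T hx g
    obtain ⟨y, m, hm⟩ := hX.exists_pull x hx g
    exact ⟨⟨y⟩, m, trivial, hm⟩
  · intro S
    obtain ⟨R, hR, h⟩ := X.locally_nonempty S
    refine ⟨R, hR, fun V f hf => ?_⟩
    obtain ⟨x, hx⟩ := h f hf
    exact ⟨⟨x⟩, hx⟩
  · rintro S ⟨x⟩ ⟨y⟩ hx hy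
    obtain ⟨R, hR, h⟩ := X.isGerbe.locally_isomorphic S x y hx hy
    refine ⟨R, hR, fun T g hg => ?_⟩
    obtain ⟨x', y', m, n, e, hm, hn, he⟩ := h g hg
    have := hm.toIsHomLift
    have := hn.toIsHomLift
    exact ⟨⟨x'⟩, m, trivial, e.hom ≫ n, trivial, inferInstance, inferInstance⟩

variable {X : CrossedGerbeStructure Φ 𝒢} {X' : CrossedGerbeStructure Φ' 𝒢'} {L : 𝒢 ⥤ᵇ 𝒢'}
  {θ : CrossedHom Φ Φ'} {η : CrossedHom Φ' Φ''}

/-- Reductions can be transported along morphisms: the image of an atlas is an atlas. -/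
lemma Reduces.image (hX : X.Reduces (θ.comp η)) (hL : IsCrossedMorphism θ X X' L) :
    X'.Reduces η := by
  obtain ⟨𝒜, h⟩ := hX
  refine ⟨{
    ι := 𝒜.ι
    obj := fun i => L.obj (𝒜.obj i)
    hom := fun i j => (fun m => L.map m) '' 𝒜.hom i j
    comp := ?_
    restrict := ?_
    cover := ?_
    connect := ?_ }, ?_⟩
  · rintro i j k _ _ ⟨m, hm, rfl⟩ ⟨n, hn, rfl⟩
    exact ⟨m ≫ n, 𝒜.comp hm hn, L.map_comp m n⟩
  · intro i S T hi g
    obtain ⟨k, m, hm, hm'⟩ := 𝒜.restrict i ((L.w_obj _).symm.trans hi) g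
    exact ⟨k, L.map m, ⟨m, hm, rfl⟩, inferInstance⟩
  · intro S
    obtain ⟨R, hR, h⟩ := 𝒜.cover S
    refine ⟨R, hR, fun V f hf => ?_⟩
    obtain ⟨i, hi⟩ := h f hf
    exact ⟨i, (L.w_obj _).trans hi⟩
  · intro S i j hi hj
    obtain ⟨R, hR, h⟩ := 𝒜.connect S i j ((L.w_obj _).symm.trans hi) ((L.w_obj _).symm.trans hj)
    refine ⟨R, hR, fun T g hg => ?_⟩
    obtain ⟨k, m, hm, n, hn, hm', hn'⟩ := h g hg
    exact ⟨k, L.map m, ⟨m, hm, rfl⟩, L.map n, ⟨n, hn, rfl⟩, inferInstance, inferInstance⟩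
  · rintro i j _ _ ⟨m, hm, rfl⟩ ⟨n, hn, rfl⟩ τ' e
    replace e : L.map m = τ'.1.hom ≫ L.map n := e
    have e₁ : 𝒢.p.map m = 𝒢.p.map n := by
      have e₂ : 𝒢'.p.map (L.map m) = 𝒢'.p.map (L.map n) := by rw [e, map_vaut_comp]
      have h₁ := map_comp_eqToHom (L.w_obj _) (L.w_obj _)
        (BasedFunctor.preserves_isHomLift L (𝒢.p.map m) m)
      have h₂ := map_comp_eqToHom (L.w_obj _) (L.w_obj _)
        (BasedFunctor.preserves_isHomLift L (𝒢.p.map n) n)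
      rw [e₂, h₂] at h₁
      exact ((cancel_epi _).1 h₁).symm
    obtain ⟨τ, rfl⟩ := X.exists_vaut_comp e₁
    obtain rfl : τ' = vautMap L _ τ := by
      refine Subtype.ext (Iso.ext (X'.isGerbe.isFiberedInGroupoids.cancel' (L.map n)
        (τ'.2.trans (map_vertical L τ).symm) (e.symm.trans (L.map_comp _ _))))
    exact (hL.inKer_iff η).2 (h hm hn τ rfl)

/-- Let `w` and `w₂` be identified with `L(x)` and `L(x₂)`, such that `m` and `m₂` correspond to the
images of two arrows which differ by `τ`. If `m` and `m₂` differ by an automorphism in the kernel of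
`η`, then `τ` is in the kernel of the composite of `θ` and `η`. -/
lemma inKer_of_compare (hL : IsCrossedMorphism θ X X' L) {x x₂ : 𝒢.obj} {w w₂ : 𝒢'.obj}
    (e : w ≅ L.obj x) (e₂ : w₂ ≅ L.obj x₂) {m m₂ : w ⟶ w₂} {n : x ⟶ x₂} (τ : VAut 𝒢 x)
    (hc : m ≫ e₂.hom = e.hom ≫ L.map (τ.1.hom ≫ n)) (hc₂ : m₂ ≫ e₂.hom = e.hom ≫ L.map n)
    (h : ∀ σ : VAut 𝒢' w, m = σ.1.hom ≫ m₂ → X'.InKer η σ) : X.InKer (θ.comp η) τ := by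
  have hv : 𝒢'.p.map (e.hom ≫ L.map τ.1.hom ≫ e.inv) = 𝟙 _ := by
    rw [Functor.map_comp, Functor.map_comp, map_vertical L τ, Category.id_comp,
      ← Functor.map_comp, e.hom_inv_id, CategoryTheory.Functor.map_id]
  -- The automorphism `L(τ)`, transported to `w`.
  let σ : VAut 𝒢' w := ⟨e ≪≫ (vautMap L x τ).1 ≪≫ e.symm, hv⟩
  have hσ : X'.InKer η σ := h σ (by
    rw [← cancel_mono e₂.hom, hc]
    change _ = ((e.hom ≫ L.map τ.1.hom ≫ e.inv) ≫ m₂) ≫ e₂.hom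
    simp only [Category.assoc]
    rw [hc₂, e.inv_hom_id_assoc, L.map_comp])
  refine (hL.inKer_iff η).1 (InKer.restrict X' hσ (m := e.inv) ?_)
  change L.map τ.1.hom ≫ e.inv = e.inv ≫ e.hom ≫ L.map τ.1.hom ≫ e.inv
  rw [e.inv_hom_id_assoc]

end CrossedGerbeStructure

/-- An object of the inverse image of an atlas under a functor `L`: an object `x` with an
identification of `L(x)` with an object of the atlas. -/
structure Atlas.Lift (𝒜 : Atlas.{v₁, u₁, v, u, t} J 𝒢') (L : 𝒢 ⥤ᵇ 𝒢') where
  pt : 𝒢.obj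
  idx : 𝒜.ι
  iso : 𝒜.obj idx ≅ L.obj pt
  vertical : 𝒢'.p.IsHomLift (𝟙 (𝒢.p.obj pt)) iso.hom

namespace Atlas

variable {X : CrossedGerbeStructure Φ 𝒢} {X' : CrossedGerbeStructure Φ' 𝒢'} {L : 𝒢 ⥤ᵇ 𝒢'}
  {θ : CrossedHom Φ Φ'} {𝒜 : Atlas.{v₁, u₁, v, u, t} J 𝒢'}

lemma Lift.base_idx (a : 𝒜.Lift L) : 𝒢'.p.obj (𝒜.obj a.idx) = 𝒢.p.obj a.pt :=
  have := a.vertical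
  IsHomLift.domain_eq 𝒢'.p (𝟙 _) a.iso.hom

/-- The distinguished arrows of the inverse image of an atlas. -/
def liftHom (a b : 𝒜.Lift L) : Set (a.pt ⟶ b.pt) :=
  {n | ∃ m ∈ 𝒜.hom a.idx b.idx, m ≫ b.iso.hom = a.iso.hom ≫ L.map n}

/-- The identification of an object with an object of the atlas can be restricted. -/
lemma Lift.exists_restrict (h𝒢' : IsFiberedInGroupoids 𝒢') (a : 𝒜.Lift L) {T : E}
    {g : T ⟶ 𝒢.p.obj a.pt} {k : 𝒜.ι} {m : 𝒜.obj k ⟶ 𝒜.obj a.idx} (hm : m ∈ 𝒜.hom k a.idx)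
    (hmg : 𝒢'.p.IsHomLift g m) {y : 𝒢.obj} {r : y ⟶ a.pt} (hr : 𝒢.p.IsHomLift g r) :
    ∃ (e : 𝒜.obj k ≅ L.obj y) (he : 𝒢'.p.IsHomLift (𝟙 (𝒢.p.obj y)) e.hom),
      e.hom ≫ L.map r = m ≫ a.iso.hom ∧ r ∈ liftHom (⟨y, k, e, he⟩ : 𝒜.Lift L) a := by
  have := a.vertical
  obtain ⟨e, he, hc⟩ := h𝒢'.exists_iso g (L.map r) (BasedFunctor.preserves_isHomLift L _ _)
    (m ≫ a.iso.hom) inferInstance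
  obtain rfl := IsHomLift.domain_eq 𝒢.p g r
  exact ⟨e, he, hc, m, hm, hc.symm⟩

lemma liftHom_comp {a b c : 𝒜.Lift L} {n : a.pt ⟶ b.pt} {n' : b.pt ⟶ c.pt}
    (hn : n ∈ liftHom a b) (hn' : n' ∈ liftHom b c) : n ≫ n' ∈ liftHom a c := by
  obtain ⟨m, hm, e⟩ := hn
  obtain ⟨m', hm', e'⟩ := hn'
  exact ⟨m ≫ m', 𝒜.comp hm hm', by
    rw [Category.assoc, e', ← Category.assoc, e, Category.assoc, L.map_comp]⟩

/-- Locally, there are objects whose image is identified with an object of the atlas. -/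
lemma exists_lift_locally (𝒜 : Atlas.{v₁, u₁, v, u, t} J 𝒢') (X : CrossedGerbeStructure Φ 𝒢)
    (X' : CrossedGerbeStructure Φ' 𝒢') (L : 𝒢 ⥤ᵇ 𝒢') (S : E) :
    ∃ R ∈ J S, ∀ ⦃V : E⦄ (f : V ⟶ S), R f → ∃ a : 𝒜.Lift L, 𝒢.p.obj a.pt = V := by
  have hf := X.isGerbe.isFiberedInGroupoids
  have hf' := X'.isGerbe.isFiberedInGroupoids
  apply bind_cover (p := fun V _ => ∃ a : 𝒜.Lift L, 𝒢.p.obj a.pt = V)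
  obtain ⟨R, hR, hc⟩ := 𝒜.cover S
  refine ⟨R, hR, fun V f hf₁ => ?_⟩
  obtain ⟨i, hi⟩ := hc f hf₁
  apply bind_cover (p := fun V _ => ∃ a : 𝒜.Lift L, 𝒢.p.obj a.pt = V)
  obtain ⟨R', hR', hc'⟩ := X.locally_nonempty V
  refine ⟨R', hR', fun W k hk => ?_⟩
  obtain ⟨x, hx⟩ := hc' k hk
  obtain ⟨i', m, -, hm⟩ := 𝒜.restrict i hi k
  obtain ⟨R'', hR'', hc''⟩ := X'.isGerbe.locally_isomorphic W (𝒜.obj i') (L.obj x)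
    (IsHomLift.domain_eq 𝒢'.p k m) ((L.w_obj x).trans hx)
  refine ⟨R'', hR'', fun T g hg => ?_⟩
  obtain ⟨a, b, q, q', e, hq, hq', he⟩ := hc'' g hg
  obtain ⟨i'', m', -, hm'⟩ := 𝒜.restrict i' (IsHomLift.domain_eq 𝒢'.p k m) g
  obtain ⟨y, r, hr⟩ := hf.exists_pull x hx g
  obtain ⟨e₁, he₁, -⟩ := hf'.exists_iso g q hq.toIsHomLift m' hm'
  obtain ⟨e₂, he₂, -⟩ := hf'.exists_iso g (L.map r) (BasedFunctor.preserves_isHomLift L _ _) q'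
    hq'.toIsHomLift
  obtain rfl := IsHomLift.domain_eq 𝒢.p g r
  refine ⟨⟨y, i'', e₁ ≪≫ e ≪≫ e₂, ?_⟩, rfl⟩
  have : 𝒢'.p.IsHomLift (𝟙 (𝒢.p.obj y) ≫ 𝟙 (𝒢.p.obj y) ≫ 𝟙 (𝒢.p.obj y))
    (e₁.hom ≫ e.hom ≫ e₂.hom) := inferInstance
  simpa using this

/-- If `L` is an epimorphism on `A`, then the objects of the inverse image of an atlas are locally
connected by distinguished arrows. -/
lemma lift_connect (hL : IsCrossedMorphism θ X X' L)
    (hθ : Presheaf.IsLocallySurjective J θ.f.hom) (S : E) (a b : 𝒜.Lift L)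
    (ha : 𝒢.p.obj a.pt = S) (hb : 𝒢.p.obj b.pt = S) :
    ∃ R ∈ J S, ∀ ⦃T : E⦄ (g : T ⟶ S), R g → ∃ (c : 𝒜.Lift L), ∃ n ∈ liftHom c a,
      ∃ n' ∈ liftHom c b, 𝒢.p.IsHomLift g n ∧ 𝒢.p.IsHomLift g n' := by
  have hf := X.isGerbe.isFiberedInGroupoids
  have hf' := X'.isGerbe.isFiberedInGroupoids
  apply bind_cover (p := fun T g => ∃ (c : 𝒜.Lift L), ∃ n ∈ liftHom c a,
      ∃ n' ∈ liftHom c b, 𝒢.p.IsHomLift g n ∧ 𝒢.p.IsHomLift g n')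
  obtain ⟨R, hR, hc⟩ := 𝒜.connect S a.idx b.idx (a.base_idx.trans ha) (b.base_idx.trans hb)
  refine ⟨R, hR, fun T g hg => ?_⟩
  obtain ⟨k, m, hm, m₂, hm₂, hmg, hmg₂⟩ := hc g hg
  obtain ⟨y, r, hr⟩ := hf.exists_pull a.pt ha g
  obtain ⟨y₂, r₂, hr₂⟩ := hf.exists_pull b.pt hb g
  obtain ⟨ε, hε, h₁, hr'⟩ : ∃ (e : 𝒜.obj k ≅ L.obj y)
      (he : 𝒢'.p.IsHomLift (𝟙 (𝒢.p.obj y)) e.hom), e.hom ≫ L.map r = m ≫ a.iso.hom ∧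
        r ∈ liftHom (⟨y, k, e, he⟩ : 𝒜.Lift L) a := by
    subst ha
    exact a.exists_restrict hf' hm hmg hr
  obtain ⟨ε₂, hε₂, h₂, hr₂'⟩ : ∃ (e : 𝒜.obj k ≅ L.obj y₂)
      (he : 𝒢'.p.IsHomLift (𝟙 (𝒢.p.obj y₂)) e.hom), e.hom ≫ L.map r₂ = m₂ ≫ b.iso.hom ∧
        r₂ ∈ liftHom (⟨y₂, k, e, he⟩ : 𝒜.Lift L) b := by
    subst hb
    exact b.exists_restrict hf' hm₂ hmg₂ hr₂
  have hy := IsHomLift.domain_eq 𝒢.p g r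
  have hy₂ := IsHomLift.domain_eq 𝒢.p g r₂
  have hn : 𝒢'.p.IsHomLift (𝟙 T) (ε.inv ≫ ε₂.hom) := by
    rw [hy] at hε
    rw [hy₂] at hε₂
    have : 𝒢'.p.IsHomLift (𝟙 T ≫ 𝟙 T) (ε.inv ≫ ε₂.hom) := inferInstance
    simpa using this
  obtain ⟨R', hR', hc'⟩ := hL.locally_full hθ hy hy₂ (ε.inv ≫ ε₂.hom) hn
  refine ⟨R', hR', fun W l hl => ?_⟩
  obtain ⟨z, q, q₂, hq, hq₂, h₃⟩ := hc' l hl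
  subst hy
  obtain ⟨k', m', hm', hm''⟩ := 𝒜.restrict k (IsHomLift.domain_eq 𝒢'.p g m) l
  obtain ⟨ε', hε', h₄, hq'⟩ := Lift.exists_restrict hf' (⟨y, k, ε, hε⟩ : 𝒜.Lift L) hm' hm'' hq
  refine ⟨⟨z, k', ε', hε'⟩, q ≫ r, liftHom_comp hq' hr', q₂ ≫ r₂, liftHom_comp ?_ hr₂',
    inferInstance, inferInstance⟩
  refine ⟨m', hm', ?_⟩
  change m' ≫ ε₂.hom = ε'.hom ≫ L.map q₂
  rw [← h₃, reassoc_of% h₄]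
  rw [ε.hom_inv_id_assoc]

/-- The inverse image of an atlas under a morphism which is an epimorphism on `A`. -/
def preimage (𝒜 : Atlas.{v₁, u₁, v, u, t} J 𝒢') (hL : IsCrossedMorphism θ X X' L)
    (hθ : Presheaf.IsLocallySurjective J θ.f.hom) : Atlas J 𝒢 where
  ι := 𝒜.Lift L
  obj a := a.pt
  hom := liftHom
  comp := liftHom_comp
  restrict a S T h g := by
    subst h
    obtain ⟨k, m, hm, hm'⟩ := 𝒜.restrict a.idx a.base_idx g
    obtain ⟨y, r, hr⟩ := X.isGerbe.isFiberedInGroupoids.exists_pull a.pt rfl g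
    obtain ⟨e, he, -, hr'⟩ := a.exists_restrict X'.isGerbe.isFiberedInGroupoids hm hm' hr
    exact ⟨⟨y, k, e, he⟩, r, hr', hr⟩
  cover := 𝒜.exists_lift_locally X X' L
  connect := lift_connect hL hθ

end Atlas

/-- Reductions can be transported backwards along a morphism which is an epimorphism on `A`. Applied
to `id`-morphisms, this shows that reducibility depends only on the class of a gerbe. -/
lemma CrossedGerbeStructure.Reduces.preimage {X : CrossedGerbeStructure Φ 𝒢}
    {X' : CrossedGerbeStructure Φ' 𝒢'} {L : 𝒢 ⥤ᵇ 𝒢'} {θ : CrossedHom Φ Φ'} {η : CrossedHom Φ' Φ''}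
    (hX' : X'.Reduces η) (hL : IsCrossedMorphism θ X X' L)
    (hθ : Presheaf.IsLocallySurjective J θ.f.hom) : X.Reduces (θ.comp η) := by
  obtain ⟨𝒜, h⟩ := hX'
  refine ⟨𝒜.preimage hL hθ, ?_⟩
  rintro a b _ n ⟨m, hm, hc⟩ ⟨m₂, hm₂, hc₂⟩ τ rfl
  exact inKer_of_compare hL a.iso b.iso τ hc hc₂ (h hm hm₂)

end Reduction

/-! ### Reduction as a property of classes in `H²` -/

section Classes

variable {E : Type u} [Category.{v} E] {J : GrothendieckTopology E} {Φ Φ' Φ'' : CrossedSheaf.{w} J}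

lemma isLocallySurjective_id (G : Sheaf J GrpCat.{w}) :
    Presheaf.IsLocallySurjective J (𝟙 G : G ⟶ G).hom :=
  have : IsIso (𝟙 G : G ⟶ G).hom := inferInstanceAs (IsIso (𝟙 G.obj))
  inferInstance

/-- The property of a class of being the class of a gerbe which reduces to the kernel of `η`. -/
def H2.Reduces (η : CrossedHom Φ Φ') : H2.{w, v₁, u₁} Φ → Prop :=
  Quot.lift (fun X => X.str.Reduces η) fun _ _ ⟨_, hL⟩ => propext
    ⟨fun h => CrossedGerbeStructure.Reduces.image h hL,
      fun h => CrossedGerbeStructure.Reduces.preimage h hL (isLocallySurjective_id _)⟩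

/-- A class is neutral if and only if its gerbes reduce to the trivial group. Hence every gerbe of a
neutral class has a section. -/
lemma H2.isNeutral_iff (y : H2.{w, v₁, u₁} Φ) : y.IsNeutral ↔ y.Reduces (CrossedHom.id Φ) := by
  constructor
  · rintro ⟨X, rfl, ⟨s⟩⟩
    exact X.str.reduces_id_of_section s
  · induction y using Quot.ind with
    | mk X => exact fun h => ⟨X, rfl, CrossedGerbeStructure.Reduces.nonempty_section h⟩

end Classes

end CrossedGerbes

theorem mainTheorem11 {E : Type u} [CategoryTheory.Category.{v} E]
    {J : CategoryTheory.GrothendieckTopology E}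
    {Φ Φ' Φ'' : CrossedGerbes.CrossedSheaf.{w} J}
    (θ : CrossedGerbes.CrossedHom Φ Φ') (η : CrossedGerbes.CrossedHom Φ' Φ'')
    (hex : CrossedGerbes.IsShortExact θ η) :
    -- the gerbe of liftings of a section
    (∀ (F : CategoryTheory.BasedCategory.{v₁, u₁} E) (H : CategoryTheory.BasedCategory.{v₂, u₂} E)
      (X : CrossedGerbes.CrossedGerbeStructure Φ' F)
      (Y : CrossedGerbes.CrossedGerbeStructure Φ'' H)
      (γ : F ⥤ᵇ H) (_hγ : CrossedGerbes.IsCrossedMorphism η X Y γ)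
      (s : CrossedGerbes.CartesianSection H),
      ∃ K : CrossedGerbes.CrossedGerbeStructure Φ (CrossedGerbes.liftings γ s),
        CrossedGerbes.IsCrossedMorphism θ K X (CrossedGerbes.liftingsForget γ s)) ∧
    -- exactness at `H²(E; Φ')`
    (∀ (x : CrossedGerbes.H2.{w, v₃, max u₃ v₃} Φ') (y : CrossedGerbes.H2.{w, v₃, max u₃ v₃} Φ''),
      CrossedGerbes.H2.MapsTo η x y →
        (y.IsNeutral ↔ ∃ z : CrossedGerbes.H2.{w, v₃, max u₃ v₃} Φ,
          CrossedGerbes.H2.MapsTo θ z x)) := by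
  have := hex.φ_iso
  refine ⟨fun F H X Y γ hγ s => ⟨_, CrossedGerbes.liftingsForget_isCrossedMorphism θ hex hγ⟩, ?_⟩
  rintro _ _ ⟨X, Y, rfl, rfl, γ, hγ⟩
  refine (CrossedGerbes.H2.isNeutral_iff _).trans ?_
  constructor
  · -- The gerbe `Y` itself has a section `s`, and `K(s)` maps to `X`.
    intro h
    obtain ⟨s⟩ := CrossedGerbes.CrossedGerbeStructure.Reduces.nonempty_section h
    exact ⟨Quot.mk _ ⟨_, CrossedGerbes.liftingsStructure (s := s) θ hex hγ⟩, _, X, rfl, rfl, _,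
      CrossedGerbes.liftingsForget_isCrossedMorphism θ hex hγ⟩
  · rintro ⟨_, Z, X', rfl, hX', L, hL⟩
    -- The gerbe `Z` reduces to the kernel of the trivial map `A ⟶ A''`. The reduction is carried to
    -- `X'`, from there to the equivalent `X`, and on to `Y`.
    have hZ : Z.str.Reduces (θ.comp η) :=
      Z.str.reduces_of_eq_one _ fun U a => (hex.exact U _).2 ⟨a, rfl⟩
    have hx' : CrossedGerbes.H2.Reduces η (Quot.mk _ X') :=
      CrossedGerbes.CrossedGerbeStructure.Reduces.image hZ hL
    have hx : CrossedGerbes.H2.Reduces η (Quot.mk _ X) :=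
      (congrArg (CrossedGerbes.H2.Reduces η) hX').mp hx'
    exact CrossedGerbes.CrossedGerbeStructure.Reduces.image (η := CrossedGerbes.CrossedHom.id Φ'')
      hx hγ
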